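/- Let $M$ be a smooth 4-manifold with a para-Kähler-Einstein structure $(g,K)$: $g$ is a metric of signature $(2,2)$, $K$ is an endomorphism field of $TM$ with $K^2=\mathrm{id}$, $g(KX,KY)=-g(X,Y)$, whose $\pm1$-eigendistributions have rank 2 and are integrable, the 2-form $\rho(X,Y)=g(KX,Y)$ is closed, and the trace-free Ricci tensor of $g$ vanishes. Let $\pi:\mathcal F^8\to M$ be the principal $GL_2(\mathbb R)$-bundle of adapted null coframes, i.e. coframes $(\theta^1,\theta^2,\theta^3,\theta^4)$ with dual frame $(\partial_{\theta^a})$ such that $$g=2\theta^1\theta^3+2\theta^2\theta^4,\qquad K=\theta^1\otimes\partial_{\theta^1}+\theta^2\otimes\partial_{\theta^2}-\theta^3\otimes\partial_{\theta^3}-\theta^4\otimes\partial_{\theta^4},$$ where $\alpha\beta=\tfrac12(\alpha\otimes\beta+\beta\otimes\alpha)$. Assume that the component $\Psi_2'=C_{1234}$ of the Weyl tensor of $g$ in adapted null frames (a multiple of the scalar curvature, equal to $-\mathrm{Scal}/12$) is a non-zero constant. Then: (a) $M$ is covered by charts carrying smooth adapted null coframes. On $\mathcal F^8$, with $\theta^1,\dots,\theta^4$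 now denoting the tautological 1-forms, there are unique smooth 1-forms $\Gamma^i_{\ j}$ ($i,j=1,2$) with $d\theta^i=-\Gamma^i_{\ j}\wedge\theta^j$ and $d\theta^{2+i}=\Gamma^j_{\ i}\wedge\theta^{2+j}$. (b) The Pfaffian system $\{\theta^1,\theta^2,\theta^3,\theta^4,\Gamma^1_{\ 1}+\Gamma^2_{\ 2}\}$ on $\mathcal F^8$ is integrable. Its leaves are the $SL_2(\mathbb R)$-orbits, so that its leaf space is the $\mathbb R^*$-bundle $\mathcal Q^5=\mathcal F^8/SL_2(\mathbb R)$ over $M$; over a domain of $M$ with an adapted coframe, $\mathcal F^8\to\mathcal Q$ is $(y,A)\mapsto(y,\det A)$. (c) Put $\eta^1=\frac{-1}{6\Psi_2'}(\theta^1+\theta^4)$, $\eta^2=\frac{-1}{6\Psi_2'}(\theta^2-\theta^3)$, $\eta^3=\frac{-1}{6\Psi_2'}(\Gamma^1_{\ 1}+\Gamma^2_{\ 2})$, $\eta^4=\theta^4$, $\eta^5=-\theta^3$. The formulas $$\beta=\sqrt{\tfrac23}\,\eta^3,\qquad \xi=\sqrt{\tfrac32}\,\frac{\partial}{\partial\eta^3},\qquad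 h=\eta^1\eta^5-\eta^2\eta^4+\tfrac23(\eta^3)^2,$$ and $\phi=\theta^1\otimes\partial_{\theta^1}+\theta^2\otimes\partial_{\theta^2}-\theta^3\otimes\partial_{\theta^3}-\theta^4\otimes\partial_{\theta^4}$ (the lift of $K$ to $\ker\beta$, with $\phi(\xi)=0$), forms on $\mathcal Q$ being identified with their pullbacks to $\mathcal F^8$, define global smooth tensor fields on $\mathcal Q$. They satisfy $$\phi^2=\mathrm{id}-\beta\otimes\xi,\quad \beta(\xi)=1,\quad \phi(\xi)=0,\quad \beta\circ\phi=0,\quad h(\xi,\cdot)=\beta,$$ $$h(\phi X,\phi Y)=-h(X,Y)+\beta(X)\beta(Y),\qquad d\beta(X,Y)=2\sqrt6\,\Psi_2'\,h(\phi X,Y);$$ the $\pm1$-eigenspaces of $\phi$ are rank 2 integrable subdistributions of $\ker\beta$; and $h$ has signature $(3,2)$ and is Einstein with $\mathrm{Ric}(h)=-24(\Psi_2')^2\,h$. (d) Consequently the homothetic quadruple $(\phi,\kappa^{-1}\xi,\kappa\beta,\kappa^2h)$ with $\kappa=2\sqrt6\,\Psi_2'$ is a para-Sasaki-Einstein structure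 on $\mathcal Q$: it satisfies all the conditions of (c) with the normalization $d\beta(X,Y)=h(\phi X,Y)$, and its Einstein constant is $-1$. -/

import Mathlib

open scoped Manifold ContDiff

noncomputable section

namespace ParaKE

/-! ### Local tensor calculus on a finite-dimensional real vector space

Tensor fields on an open subset of `V` are functions on `V`; all conditions are imposed on the
open set in question. -/

section Local

variable {V : Type*} [NormedAddCommGroup V] [NormedSpace ℝ V]

/-- `a ∧ b` for covectors, with the convention `(a ∧ b)(u,v) = a(u) b(v) - a(v) b(u)`. -/
def wedge (a b : V →L[ℝ] ℝ) (u v : V) : ℝ := a u * b v - a v * b u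

/-- The symmetric product `a b = ½ (a ⊗ b + b ⊗ a)` of covectors. -/
def symProd (a b : V →L[ℝ] ℝ) (u v : V) : ℝ := (1 / 2) * (a u * b v + a v * b u)

/-- Exterior derivative of a 1-form, evaluated on two vectors. -/
def d1 (η : V → V →L[ℝ] ℝ) (x u v : V) : ℝ := fderiv ℝ η x u v - fderiv ℝ η x v u

/-- `d1` is Mathlib's exterior derivative `extDeriv` on 1-forms. -/
theorem d1_eq_extDeriv (η : V → V →L[ℝ] ℝ) (x u v : V) (h : DifferentiableAt ℝ η x) :
    extDeriv (fun y => ContinuousAlternatingMap.ofSubsingleton ℝ V ℝ (0 : Fin 1) (η y)) x ![u, v]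
      = d1 η x u v := by
  have hd : DifferentiableAt ℝ
      (fun y => ContinuousAlternatingMap.ofSubsingleton ℝ V ℝ (0 : Fin 1) (η y)) x :=
    (ContinuousAlternatingMap.ofSubsingletonLIE (𝕜 := ℝ) (E := V) (F := ℝ)
      (i := (0 : Fin 1))).differentiableAt.comp x h
  rw [extDeriv_apply hd]
  have key : ∀ w z : V, fderiv ℝ (fun y => η y w) x z = fderiv ℝ η x z w := by
    intro w z
    rw [fderiv_clm_apply h (differentiableAt_const w)]
    simp
  simp [Fin.sum_univ_two, d1, key, Fin.removeNth, sub_eq_add_neg]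

/-- The exterior derivative of the 2-form `(u,v) ↦ ρ x u v` (for skew-symmetric `ρ`). -/
def d2 (ρ : V → V →L[ℝ] V →L[ℝ] ℝ) (x u v w : V) : ℝ :=
  fderiv ℝ ρ x u v w + fderiv ℝ ρ x v w u + fderiv ℝ ρ x w u v

/-- A distribution is involutive (Frobenius integrable) on `s`: the bracket of two smooth local
sections is again a section. -/
def IsInvolutiveOn (D : V → Submodule ℝ V) (s : Set V) : Prop :=
  ∀ O : Set V, IsOpen O → O ⊆ s → ∀ X Y : V → V, ContDiffOn ℝ ∞ X O → ContDiffOn ℝ ∞ Y O →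
    (∀ x ∈ O, X x ∈ D x) → (∀ x ∈ O, Y x ∈ D x) →
    ∀ x ∈ O, VectorField.lieBracket ℝ X Y x ∈ D x

/-- The eigenspace distribution of a field of endomorphisms. -/
def eigDist (K : V → V →L[ℝ] V) (c : ℝ) (x : V) : Submodule ℝ V :=
  Module.End.eigenspace (K x : V →ₗ[ℝ] V) c

/-- The bilinear form `B` has signature `(p, q)`: it is `diag(1,…,1,-1,…,-1)` in some basis. -/
def HasSignature (B : V →L[ℝ] V →L[ℝ] ℝ) (p q : ℕ) : Prop :=
  ∃ b : Module.Basis (Fin p ⊕ Fin q) ℝ V, ∀ i j,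
    B (b i) (b j) = if i = j then Sum.elim (fun _ => 1) (fun _ => -1) i else 0

/-- Christoffel map of the Levi-Civita connection of `h`: for constant vector fields,
`∇_u v = christoffel h x u v`, given by the Koszul formula. -/
def christoffel (h : V → V →L[ℝ] V →L[ℝ] ℝ) (x u v : V) : V :=
  (h x).inverse ((1 / 2 : ℝ) • (fderiv ℝ h x u v + fderiv ℝ h x v u
    - ((fderiv ℝ h x).flip u).flip v))

/-- Riemann curvature `R(u,v)w = ∇_u ∇_v w - ∇_v ∇_u w` (constant `u`, `v`, `w`). -/
def riemann (h : V → V →L[ℝ] V →L[ℝ] ℝ) (x u v w : V) : V :=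
  fderiv ℝ (fun y => christoffel h y v w) x u - fderiv ℝ (fun y => christoffel h y u w) x v
    + christoffel h x u (christoffel h x v w) - christoffel h x v (christoffel h x u w)

variable [FiniteDimensional ℝ V]

/-- Ricci tensor `Ric(v,w) = tr (u ↦ R(u,w)v)`. -/
def ricci (h : V → V →L[ℝ] V →L[ℝ] ℝ) (x v w : V) : ℝ :=
  ∑ i, (Module.finBasis ℝ V).coord i (riemann h x (Module.finBasis ℝ V i) w v)

/-- Scalar curvature `h^{ij} Ric_{ij}`. -/
def scal (h : V → V →L[ℝ] V →L[ℝ] ℝ) (x : V) : ℝ :=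
  ∑ i, ∑ j, (Module.finBasis ℝ V).coord i
      ((h x).inverse (LinearMap.toContinuousLinearMap ((Module.finBasis ℝ V).coord j)))
    * ricci h x (Module.finBasis ℝ V i) (Module.finBasis ℝ V j)

/-- Schouten tensor in dimension four. -/
def schouten4 (h : V → V →L[ℝ] V →L[ℝ] ℝ) (x u v : V) : ℝ :=
  (1 / 2) * ricci h x u v - (1 / 12) * scal h x * h x u v

/-- Weyl tensor in dimension four with all indices lowered, `C(a,b,c,d) = h(a, C(c,d) b)`. -/
def weyl4 (h : V → V →L[ℝ] V →L[ℝ] ℝ) (x a b c d : V) : ℝ :=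
  h x a (riemann h x c d b) + h x a d * schouten4 h x c b - h x a c * schouten4 h x d b
    + h x b c * schouten4 h x d a - h x b d * schouten4 h x c a

/-- `(g, K)` is a para-Kähler-Einstein structure on the open subset `s` of a four-dimensional
vector space. -/
structure IsParaKahlerEinsteinOn (s : Set V) (g : V → V →L[ℝ] V →L[ℝ] ℝ)
    (K : V → V →L[ℝ] V) : Prop where
  smooth_g : ContDiffOn ℝ ∞ g s
  smooth_K : ContDiffOn ℝ ∞ K s
  symm : ∀ x ∈ s, ∀ u v, g x u v = g x v u
  signature : ∀ x ∈ s, HasSignature (g x) 2 2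
  para_complex : ∀ x ∈ s, ∀ u, K x (K x u) = u
  rank_pos : ∀ x ∈ s, Module.finrank ℝ (eigDist K 1 x) = 2
  rank_neg : ∀ x ∈ s, Module.finrank ℝ (eigDist K (-1) x) = 2
  compatible : ∀ x ∈ s, ∀ u v, g x (K x u) (K x v) = - g x u v
  integrable_pos : IsInvolutiveOn (eigDist K 1) s
  integrable_neg : IsInvolutiveOn (eigDist K (-1)) s
  /-- The 2-form `ρ(u,v) = g(Ku,v)` is closed. -/
  closed : ∀ x ∈ s, ∀ u v w, d2 (fun y => (g y).comp (K y)) x u v w = 0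
  /-- The trace-free Ricci tensor vanishes. -/
  einstein : ∀ x ∈ s, ∀ u v, ricci g x u v = scal g x / 4 * g x u v

/-- `(e₁,e₂,e₃,e₄)` is an adapted null frame: it is dual to a coframe `(θ¹,θ²,θ³,θ⁴)` with
`g = 2θ¹θ³ + 2θ²θ⁴` in which `K = diag(1,1,-1,-1)`. -/
def IsAdaptedFrame (g : V →L[ℝ] V →L[ℝ] ℝ) (K : V →L[ℝ] V) (e₁ e₂ e₃ e₄ : V) : Prop :=
  K e₁ = e₁ ∧ K e₂ = e₂ ∧ K e₃ = - e₃ ∧ K e₄ = - e₄ ∧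
  g e₁ e₃ = 1 ∧ g e₂ e₄ = 1 ∧ g e₁ e₄ = 0 ∧ g e₂ e₃ = 0

/-- A quadruple of tensor fields `(φ, ξ, β, h)`. -/
structure ContactData (V : Type*) [NormedAddCommGroup V] [NormedSpace ℝ V] where
  φ : V → V →L[ℝ] V
  ξ : V → V
  β : V → V →L[ℝ] ℝ
  h : V → V →L[ℝ] V →L[ℝ] ℝ

/-- The homothety `(φ, κ⁻¹ ξ, κ β, κ² h)`. -/
def ContactData.rescale (S : ContactData V) (κ : ℝ) : ContactData V where
  φ := S.φ
  ξ := fun x => κ⁻¹ • S.ξ x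
  β := fun x => κ • S.β x
  h := fun x => κ ^ 2 • S.h x

/-- `(φ, ξ, β, h)` is, on the open subset `s` of a five-dimensional vector space, a para-Sasaki
structure up to the constant normalization factor `κ` in `dβ(X,Y) = κ h(φX,Y)`, and `h` is an
Einstein metric with Einstein constant `lam`. -/
structure IsScaledParaSasakiEinsteinOn (κ lam : ℝ) (s : Set V) (S : ContactData V) : Prop where
  smooth_φ : ContDiffOn ℝ ∞ S.φ s
  smooth_ξ : ContDiffOn ℝ ∞ S.ξ s
  smooth_β : ContDiffOn ℝ ∞ S.β s
  smooth_h : ContDiffOn ℝ ∞ S.h s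
  symm : ∀ x ∈ s, ∀ u v, S.h x u v = S.h x v u
  signature : ∀ x ∈ s, HasSignature (S.h x) 3 2
  φ_sq : ∀ x ∈ s, ∀ u, S.φ x (S.φ x u) = u - S.β x u • S.ξ x
  β_ξ : ∀ x ∈ s, S.β x (S.ξ x) = 1
  φ_ξ : ∀ x ∈ s, S.φ x (S.ξ x) = 0
  β_φ : ∀ x ∈ s, ∀ u, S.β x (S.φ x u) = 0
  h_ξ : ∀ x ∈ s, ∀ u, S.h x (S.ξ x) u = S.β x u
  eig_le_ker : ∀ x ∈ s, ∀ u, u ∈ eigDist S.φ 1 x ∨ u ∈ eigDist S.φ (-1) x → S.β x u = 0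
  rank_pos : ∀ x ∈ s, Module.finrank ℝ (eigDist S.φ 1 x) = 2
  rank_neg : ∀ x ∈ s, Module.finrank ℝ (eigDist S.φ (-1) x) = 2
  integrable_pos : IsInvolutiveOn (eigDist S.φ 1) s
  integrable_neg : IsInvolutiveOn (eigDist S.φ (-1)) s
  h_φ : ∀ x ∈ s, ∀ u v, S.h x (S.φ x u) (S.φ x v) = - S.h x u v + S.β x u * S.β x v
  dβ : ∀ x ∈ s, ∀ u v, d1 S.β x u v = κ * S.h x (S.φ x u) v
  einstein : ∀ x ∈ s, ∀ u v, ricci S.h x u v = lam * S.h x u v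

/-- A para-Sasaki-Einstein structure with Einstein constant `lam`: the normalization is
`dβ(X,Y) = h(φX,Y)`. -/
def IsParaSasakiEinsteinOn (lam : ℝ) (s : Set V) (S : ContactData V) : Prop :=
  IsScaledParaSasakiEinsteinOn 1 lam s S

end Local

/-- The Pfaffian system spanned by the 1-forms `I k` on the open set `F` satisfies the Frobenius
condition `dI ⊂ I` (the forms being pointwise linearly independent). -/
def IsIntegrablePfaffianOn {X ι : Type*} [NormedAddCommGroup X] [NormedSpace ℝ X]
    (I : ι → X → X →L[ℝ] ℝ) (F : Set X) : Prop :=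
  ∀ x ∈ F, LinearIndependent ℝ (fun k => I k x) ∧
    ∀ k u v, (∀ l, I l x u = 0) → (∀ l, I l x v = 0) → d1 (I k) x u v = 0

/-- `q : F → Q` exhibits `Q` as the leaf space of the Pfaffian system `I` on `F`: it is a smooth
surjective submersion with `ker dq = ker I` and connected fibres, so that its fibres are exactly
the leaves (maximal connected integral manifolds) of `I`. -/
structure IsLeafProjection {X Y ι : Type*} [NormedAddCommGroup X] [NormedSpace ℝ X]
    [NormedAddCommGroup Y] [NormedSpace ℝ Y]
    (I : ι → X → X →L[ℝ] ℝ) (F : Set X) (Q : Set Y) (q : X → Y) : Prop where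
  smooth : ContDiffOn ℝ ∞ q F
  image : q '' F = Q
  submersion : ∀ x ∈ F, Function.Surjective (fderiv ℝ q x)
  ker : ∀ x ∈ F, ∀ u, fderiv ℝ q x u = 0 ↔ ∀ k, I k x u = 0
  connected : ∀ y ∈ Q, IsConnected (F ∩ q ⁻¹' {y})

/-! ### Para-Kähler-Einstein 4-manifolds -/

/-- The model space `ℝ⁴`. -/
abbrev E4 := EuclideanSpace ℝ (Fin 4)

section Manifold

variable {M : Type*} [TopologicalSpace M] [ChartedSpace E4 M]

/-- The derivative `T_y ℝ⁴ → T_{e⁻¹(y)} M` of the inverse of a chart (in Mathlib every tangent space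
of `M` is, as a vector space, the model space `ℝ⁴`). -/
def chartInvDeriv (e : OpenPartialHomeomorph M E4) (y : E4) : E4 →L[ℝ] E4 :=
  mfderiv (𝓡 4) (𝓡 4) e.symm y

/-- The derivative `T_{e⁻¹(y)} M → T_y ℝ⁴` of a chart. -/
def chartDeriv (e : OpenPartialHomeomorph M E4) (y : E4) : E4 →L[ℝ] E4 :=
  mfderiv (𝓡 4) (𝓡 4) e (e.symm y)

/-- Expression of a field of bilinear forms in a chart. -/
def chartMetric (g : ∀ p : M, TangentSpace (𝓡 4) p →L[ℝ] TangentSpace (𝓡 4) p →L[ℝ] ℝ)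
    (e : OpenPartialHomeomorph M E4) (y : E4) : E4 →L[ℝ] E4 →L[ℝ] ℝ :=
  let G : E4 →L[ℝ] E4 →L[ℝ] ℝ := g (e.symm y)
  G.bilinearComp (chartInvDeriv e y) (chartInvDeriv e y)

/-- Expression of a field of endomorphisms in a chart. -/
def chartEndo (K : ∀ p : M, TangentSpace (𝓡 4) p →L[ℝ] TangentSpace (𝓡 4) p)
    (e : OpenPartialHomeomorph M E4) (y : E4) : E4 →L[ℝ] E4 :=
  let k : E4 →L[ℝ] E4 := K (e.symm y)
  (chartDeriv e y).comp (k.comp (chartInvDeriv e y))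

variable (g : ∀ p : M, TangentSpace (𝓡 4) p →L[ℝ] TangentSpace (𝓡 4) p →L[ℝ] ℝ)
  (K : ∀ p : M, TangentSpace (𝓡 4) p →L[ℝ] TangentSpace (𝓡 4) p)

/-- `(g, K)` is a (smooth) para-Kähler-Einstein structure on the 4-manifold `M`. -/
def IsParaKahlerEinstein : Prop :=
  ∀ e ∈ IsManifold.maximalAtlas (𝓡 4) ∞ M,
    IsParaKahlerEinsteinOn e.target (chartMetric g e) (chartEndo K e)

/-- The self-dual Weyl component `Ψ₂' = C₁₂₃₄` (indices with respect to adapted null frames) of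
`(g, K)` is the constant `Ψ`. -/
def HasConstantPsi2' (Ψ : ℝ) : Prop :=
  ∀ e ∈ IsManifold.maximalAtlas (𝓡 4) ∞ M, ∀ y ∈ e.target, ∀ e₁ e₂ e₃ e₄ : E4,
    IsAdaptedFrame (chartMetric g e y) (chartEndo K e y) e₁ e₂ e₃ e₄ →
      weyl4 (chartMetric g e) y e₁ e₂ e₃ e₄ = Ψ

/-- The covectors `(θ¹,θ²,θ³,θ⁴) = (a 0, a 1, a' 0, a' 1)` form an adapted null coframe of
`(g, K)`: `g = 2θ¹θ³ + 2θ²θ⁴` and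
`K = θ¹ ⊗ ∂/∂θ¹ + θ² ⊗ ∂/∂θ² - θ³ ⊗ ∂/∂θ³ - θ⁴ ⊗ ∂/∂θ⁴`. -/
def IsAdaptedCoframe (g : E4 →L[ℝ] E4 →L[ℝ] ℝ) (K : E4 →L[ℝ] E4)
    (a a' : Fin 2 → E4 →L[ℝ] ℝ) : Prop :=
  LinearIndependent ℝ (Sum.elim a a') ∧
  (∀ u v, g u v = ∑ i, 2 * symProd (a i) (a' i) u v) ∧
  ∀ i u, a i (K u) = a i u ∧ a' i (K u) = - a' i u

/-- A chart of `M` together with a smooth adapted null coframe on its domain (written in the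
chart). These are the local trivializations of the bundle of adapted coframes over charts. -/
structure AdaptedChart where
  e : OpenPartialHomeomorph M E4
  mem_atlas : e ∈ IsManifold.maximalAtlas (𝓡 4) ∞ M
  a : Fin 2 → E4 → E4 →L[ℝ] ℝ
  a' : Fin 2 → E4 → E4 →L[ℝ] ℝ
  smooth_a : ∀ i, ContDiffOn ℝ ∞ (a i) e.target
  smooth_a' : ∀ i, ContDiffOn ℝ ∞ (a' i) e.target
  adapted : ∀ y ∈ e.target, IsAdaptedCoframe (chartMetric g e y) (chartEndo K e y)
    (fun i => a i y) (fun i => a' i y)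

/-- Coordinates `(y, A)` on the bundle `𝓕⁸` of adapted coframes, `A ∈ GL₂(ℝ)` standing for the
coframe `(A a, (Aᵀ)⁻¹ a')` at `y`. -/
abbrev X8 := E4 × (Fin 2 → Fin 2 → ℝ)

/-- Coordinates `(y, t)` on the leaf space `𝒬`. -/
abbrev X5 := E4 × ℝ

end Manifold

namespace AdaptedChart

variable {M : Type*} [TopologicalSpace M] [ChartedSpace E4 M]
  {g : ∀ p : M, TangentSpace (𝓡 4) p →L[ℝ] TangentSpace (𝓡 4) p →L[ℝ] ℝ}
  {K : ∀ p : M, TangentSpace (𝓡 4) p →L[ℝ] TangentSpace (𝓡 4) p}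
  (c : AdaptedChart g K)

/-- The part of `𝓕⁸` over the adapted chart. -/
def F : Set X8 := {x | x.1 ∈ c.e.target ∧ (Matrix.of x.2).det ≠ 0}

/-- The first half `A a` of the coframe at the point `(y, A)`. -/
def cofr (x : X8) (i : Fin 2) : E4 →L[ℝ] ℝ := ∑ j, x.2 i j • c.a j x.1

/-- The second half `(Aᵀ)⁻¹ a'` of the coframe at the point `(y, A)`. -/
def cofr' (x : X8) (i : Fin 2) : E4 →L[ℝ] ℝ := ∑ j, (Matrix.of x.2)⁻¹ j i • c.a' j x.1

/-- The tautological (lifted) 1-forms `θ¹, θ²` on `𝓕⁸`. -/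
def θ (i : Fin 2) (x : X8) : X8 →L[ℝ] ℝ := (c.cofr x i).comp (ContinuousLinearMap.fst ℝ _ _)

/-- The tautological (lifted) 1-forms `θ³, θ⁴` on `𝓕⁸`. -/
def θ' (i : Fin 2) (x : X8) : X8 →L[ℝ] ℝ := (c.cofr' x i).comp (ContinuousLinearMap.fst ℝ _ _)

/-- `Γ i j` are the Levi-Civita connection forms `Γ^i_j` on `𝓕⁸`: the smooth
`𝔤𝔩₂(ℝ)`-valued 1-form solving the first structure equations for the lifted coframe,
`dθ^i = - Γ^i_j ∧ θ^j`, `dθ^{2+i} = Γ^j_i ∧ θ^{2+j}`. -/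
structure IsConnection (Γ : Fin 2 → Fin 2 → X8 → X8 →L[ℝ] ℝ) : Prop where
  smooth : ∀ i j, ContDiffOn ℝ ∞ (Γ i j) c.F
  dθ : ∀ x ∈ c.F, ∀ i u v, d1 (c.θ i) x u v = - ∑ j, wedge (Γ i j x) (c.θ j x) u v
  dθ' : ∀ x ∈ c.F, ∀ i u v, d1 (c.θ' i) x u v = ∑ j, wedge (Γ j i x) (c.θ' j x) u v

/-- The Pfaffian system `{θ¹, θ², θ³, θ⁴, Γ¹₁ + Γ²₂}` on `𝓕⁸`. -/
def pfaffian (Γ : Fin 2 → Fin 2 → X8 → X8 →L[ℝ] ℝ) : Fin 5 → X8 → X8 →L[ℝ] ℝ :=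
  ![c.θ 0, c.θ 1, c.θ' 0, c.θ' 1, fun x => Γ 0 0 x + Γ 1 1 x]

/-- The part of the leaf space `𝒬` over the adapted chart, an `ℝ^*`-bundle. -/
def Q : Set X5 := {z | z.1 ∈ c.e.target ∧ z.2 ≠ 0}

/-- The projection `𝓕⁸ → 𝒬`, `(y, A) ↦ (y, det A)`. -/
def proj (x : X8) : X5 := (x.1, (Matrix.of x.2).det)

/-- The forms `η¹, …, η⁵` on `𝓕⁸`:
`η¹ = -(θ¹ + θ⁴)/(6Ψ)`, `η² = -(θ² - θ³)/(6Ψ)`, `η³ = -(Γ¹₁ + Γ²₂)/(6Ψ)`, `η⁴ = θ⁴`,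
`η⁵ = -θ³`. -/
def η (Ψ : ℝ) (Γ : Fin 2 → Fin 2 → X8 → X8 →L[ℝ] ℝ) (x : X8) : Fin 5 → X8 →L[ℝ] ℝ :=
  ![(-1 / (6 * Ψ)) • (c.θ 0 x + c.θ' 1 x), (-1 / (6 * Ψ)) • (c.θ 1 x - c.θ' 0 x),
    (-1 / (6 * Ψ)) • (Γ 0 0 x + Γ 1 1 x), c.θ' 1 x, - c.θ' 0 x]

/-- `(φ, ξ, β, h)` on `𝒬` is given by
`φ = θ¹ ⊗ ∂/∂θ¹ + θ² ⊗ ∂/∂θ² - θ³ ⊗ ∂/∂θ³ - θ⁴ ⊗ ∂/∂θ⁴` (the lift of `K` to `ker β`),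
`ξ = √(3/2) ∂/∂η³`, `β = √(2/3) η³`, `h = η¹η⁵ - η²η⁴ + (2/3) (η³)²`,
all forms on `𝒬` being identified with their pullbacks to `𝓕⁸`. -/
structure IsExplicit (Ψ : ℝ) (Γ : Fin 2 → Fin 2 → X8 → X8 →L[ℝ] ℝ) (S : ContactData X5) :
    Prop where
  φ_eq : ∀ x ∈ c.F, ∀ u w, fderiv ℝ proj x w = S.φ (proj x) (fderiv ℝ proj x u) →
    (∀ i, c.θ i x w = c.θ i x u) ∧ (∀ i, c.θ' i x w = - c.θ' i x u) ∧ c.η Ψ Γ x 2 w = 0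
  ξ_eq : ∀ x ∈ c.F, ∀ u, fderiv ℝ proj x u = S.ξ (proj x) →
    ∀ k, c.η Ψ Γ x k u = if k = 2 then √(3 / 2) else 0
  β_eq : ∀ x ∈ c.F, ∀ u, S.β (proj x) (fderiv ℝ proj x u) = √(2 / 3) * c.η Ψ Γ x 2 u
  h_eq : ∀ x ∈ c.F, ∀ u v, S.h (proj x) (fderiv ℝ proj x u) (fderiv ℝ proj x v) =
    symProd (c.η Ψ Γ x 0) (c.η Ψ Γ x 4) u v - symProd (c.η Ψ Γ x 1) (c.η Ψ Γ x 3) u v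
      + 2 / 3 * symProd (c.η Ψ Γ x 2) (c.η Ψ Γ x 2) u v

/-- The coordinate change between two adapted charts, and the set where it is defined. -/
def trans (c' : AdaptedChart g K) (y : E4) : E4 := c'.e (c.e.symm y)

/-- The part of the target of the first chart lying over the intersection of the domains. -/
def overlap (c' : AdaptedChart g K) : Set E4 := (c.e.symm.trans c'.e).source

/-- `b` is the determinant of the change of coframe: the pullback of `θ'¹ ∧ θ'²` (second chart)
is `b θ¹ ∧ θ²` (first chart). The same coframe then has `det A' = det A / b`. -/
def IsCoframeDet (c' : AdaptedChart g K) (b : E4 → ℝ) : Prop :=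
  ContDiffOn ℝ ∞ b (c.overlap c') ∧ ∀ y ∈ c.overlap c', b y ≠ 0 ∧ ∀ u v,
    wedge (c'.a 0 (c.trans c' y)) (c'.a 1 (c.trans c' y))
      (fderiv ℝ (c.trans c') y u) (fderiv ℝ (c.trans c') y v)
      = b y * wedge (c.a 0 y) (c.a 1 y) u v

/-- The transition map of `𝒬` between two adapted charts. -/
def transQ (c' : AdaptedChart g K) (b : E4 → ℝ) (z : X5) : X5 := (c.trans c' z.1, z.2 / b z.1)

/-- Local tensor fields `S`, `S'` over two adapted charts agree under the transition map of `𝒬`. -/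
def Agree (c' : AdaptedChart g K) (b : E4 → ℝ) (S S' : ContactData X5) : Prop :=
  ∀ z : X5, z.1 ∈ c.overlap c' → z.2 ≠ 0 →
    (∀ u, fderiv ℝ (c.transQ c' b) z (S.φ z u) =
      S'.φ (c.transQ c' b z) (fderiv ℝ (c.transQ c' b) z u)) ∧
    fderiv ℝ (c.transQ c' b) z (S.ξ z) = S'.ξ (c.transQ c' b z) ∧
    (∀ u, S.β z u = S'.β (c.transQ c' b z) (fderiv ℝ (c.transQ c' b) z u)) ∧
    ∀ u v, S.h z u v = S'.h (c.transQ c' b z) (fderiv ℝ (c.transQ c' b) z u)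
      (fderiv ℝ (c.transQ c' b) z v)

end AdaptedChart

end ParaKE

end

open ParaKE

/-! The Levi-Civita connection of a para-Kähler metric preserves `K`. In an adapted null coframe its
connection form is therefore block diagonal, with a `𝔤𝔩₂`-valued form `γ` on `θ¹, θ²` and `-γᵀ` on
`θ³, θ⁴`. This has two consequences. The Riemann term of `C₁₂₃₄` lies in an off-diagonal block and
vanishes, so for an Einstein metric `C₁₂₃₄ = -scal/12`, and the hypothesis on `Ψ` says exactly that
`scal = -12Ψ` (`weyl4_nullFrame`, `AdaptedChart.scal_eq`). The first Bianchi identity expresses the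
curvature of `tr γ` through the Ricci tensor, so that `d(tr γ) = (scal/4) ρ = -3Ψ ρ`, where `ρ =
θ¹∧θ³ + θ²∧θ⁴` is the para-Kähler form (`IsAdaptedOn.d1_trace`).

On the frame bundle the connection form is the gauge transform `Γ = A γ A⁻¹ - dA A⁻¹`. Its trace `tr
γ - d log |det A|` is the pullback, under `(y, A) ↦ (y, det A)`, of the form `tr γ - dt/t` on the
line bundle (`frameConn_trace`). Hence the Pfaffian system has the same kernel as the differential
of that projection. Its leaves are the fibres of fixed determinant, which are `SL₂(ℝ)`-orbits and
are connected by a rotation-times-triangular parametrization.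

On the line bundle, `β` is a constant multiple of `tr γ - dt/t`, and the formula for `h` collapses
to `h = g/(12Ψ) + β ⊗ β`. The algebraic identities are then checked on horizontal lifts and on `ξ`;
`dβ` is a multiple of `ρ`, for which the eigenspaces of `K` are isotropic, and this gives
integrability. For the Einstein equation the Levi-Civita form of `h` is written down in the coframe
`(θ, β)` and its curvature computed (`sasaki_isCartanFrame`, `sasaki_ricci`). The horizontal part is
`(-3 + 3/2 - 1/2)Ψ g = -2Ψ g = -24Ψ² · g/(12Ψ)`, and the vertical part is `-24Ψ² β ⊗ β`.

The curvature in the statement comes from the Koszul formula in coordinates. The bridge is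
`IsCartanFrame.θ_riemann`: a torsion-free metric connection form in a coframe with constant Gram
matrix computes that curvature.

The local structures glue because a change of adapted coframe with determinant `b` changes `tr γ` by
`-d log |b|` and divides the fibre coordinate by `b`; the two effects cancel in `tr γ - dt/t`
(`traceConn_map`, `sasaki_agree`). -/

noncomputable section

namespace ParaKE

/-! ### Exterior calculus of 1-forms on open sets of a vector space. -/

section Calculus

variable {V W : Type*} [NormedAddCommGroup V] [NormedSpace ℝ V]
  [NormedAddCommGroup W] [NormedSpace ℝ W]

theorem diffAt_of_contDiffOn {f : V → W} {s : Set V} {x : V} (hf : ContDiffOn ℝ ∞ f s)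
    (hs : IsOpen s) (hx : x ∈ s) : DifferentiableAt ℝ f x :=
  (hf.contDiffAt (hs.mem_nhds hx)).differentiableAt (by simp)

theorem contDiffOn_fderiv {f : V → W} {s : Set V} (hf : ContDiffOn ℝ ∞ f s) (hs : IsOpen s) :
    ContDiffOn ℝ ∞ (fderiv ℝ f) s :=
  hf.fderiv_of_isOpen hs (by simp)

theorem fderiv_fderiv_comm {f : V → W} {s : Set V} {x : V} (hf : ContDiffOn ℝ ∞ f s)
    (hs : IsOpen s) (hx : x ∈ s) (u v : V) :
    fderiv ℝ (fderiv ℝ f) x u v = fderiv ℝ (fderiv ℝ f) x v u :=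
  ((hf.contDiffAt (hs.mem_nhds hx)).isSymmSndFDerivAt
    (by simpa using WithTop.coe_le_coe.2 (le_top (a := (2 : ℕ∞))))) u v

theorem fderiv_clm_apply_const {η : V → V →L[ℝ] W} {x : V} (h : DifferentiableAt ℝ η x)
    (u v : V) : fderiv ℝ (fun y => η y v) x u = fderiv ℝ η x u v := by
  rw [fderiv_clm_apply h (differentiableAt_const v)]
  simp

theorem d1_congr {η η' : V → V →L[ℝ] ℝ} {x : V} (h : η =ᶠ[nhds x] η') (u v : V) :
    d1 η x u v = d1 η' x u v := by
  simp only [d1, h.fderiv_eq]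

theorem d1_congr_on {η η' : V → V →L[ℝ] ℝ} {s : Set V} (hs : IsOpen s) {x : V} (hx : x ∈ s)
    (h : ∀ y ∈ s, η y = η' y) (u v : V) : d1 η x u v = d1 η' x u v :=
  d1_congr (Filter.eventually_of_mem (hs.mem_nhds hx) h) u v

theorem d1_add {η ζ : V → V →L[ℝ] ℝ} {x : V} (h : DifferentiableAt ℝ η x)
    (h' : DifferentiableAt ℝ ζ x) (u v : V) :
    d1 (fun y => η y + ζ y) x u v = d1 η x u v + d1 ζ x u v := by
  simp only [d1, fderiv_fun_add h h', add_apply]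
  ring

theorem d1_sub {η ζ : V → V →L[ℝ] ℝ} {x : V} (h : DifferentiableAt ℝ η x)
    (h' : DifferentiableAt ℝ ζ x) (u v : V) :
    d1 (fun y => η y - ζ y) x u v = d1 η x u v - d1 ζ x u v := by
  simp only [d1, fderiv_fun_sub h h', sub_apply]
  ring

theorem d1_const_smul {η : V → V →L[ℝ] ℝ} {x : V} (h : DifferentiableAt ℝ η x) (c : ℝ) (u v : V) :
    d1 (fun y => c • η y) x u v = c * d1 η x u v := by
  simp only [d1, fderiv_fun_const_smul h, smul_apply, smul_eq_mul]
  ring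

theorem d1_sum {ι : Type*} (s : Finset ι) {η : ι → V → V →L[ℝ] ℝ} {x : V}
    (h : ∀ i ∈ s, DifferentiableAt ℝ (η i) x) (u v : V) :
    d1 (fun y => ∑ i ∈ s, η i y) x u v = ∑ i ∈ s, d1 (η i) x u v := by
  simp only [d1, fderiv_fun_sum h, sum_apply, Finset.sum_sub_distrib]

theorem d1_smul {f : V → ℝ} {η : V → V →L[ℝ] ℝ} {x : V} (hf : DifferentiableAt ℝ f x)
    (h : DifferentiableAt ℝ η x) (u v : V) :
    d1 (fun y => f y • η y) x u v = wedge (fderiv ℝ f x) (η x) u v + f x * d1 η x u v := by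
  simp only [d1, wedge, fderiv_fun_smul hf h, add_apply,
    smul_apply, ContinuousLinearMap.smulRight_apply, smul_eq_mul]
  ring

theorem d1_comp_clm {η : W → W →L[ℝ] ℝ} (L : V →L[ℝ] W) {x : V}
    (h : DifferentiableAt ℝ η (L x)) (u v : V) :
    d1 (fun y => (η (L y)).comp L) x u v = d1 η (L x) (L u) (L v) := by
  have h2 : DifferentiableAt ℝ (fun y => η (L y)) x := h.comp x L.differentiableAt
  have h1 : fderiv ℝ (fun y => η (L y)) x = (fderiv ℝ η (L x)).comp L := by
    have := fderiv_comp (𝕜 := ℝ) x h L.differentiableAt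
    rw [L.fderiv] at this
    exact this
  have key : ∀ a b, fderiv ℝ (fun y => (η (L y)).comp L) x a b = fderiv ℝ η (L x) (L a) (L b) := by
    intro a b
    rw [fderiv_clm_comp h2 (differentiableAt_const L), h1]
    simp
  simp only [d1, key]

/-- Besides the expected term, the derivative of the pullback contains `η` applied to the second
derivative of `f`. That term is symmetric in `u` and `v` and cancels on antisymmetrization. -/
theorem d1_pullback {η : W → W →L[ℝ] ℝ} {f : V → W} {s : Set V} (hs : IsOpen s) {x : V}
    (hx : x ∈ s) (hf : ContDiffOn ℝ ∞ f s) (h : DifferentiableAt ℝ η (f x)) (u v : V) :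
    d1 (fun y => (η (f y)).comp (fderiv ℝ f y)) x u v
      = d1 η (f x) (fderiv ℝ f x u) (fderiv ℝ f x v) := by
  have hf' := diffAt_of_contDiffOn hf hs hx
  have hf'' := diffAt_of_contDiffOn (contDiffOn_fderiv hf hs) hs hx
  have h2 : DifferentiableAt ℝ (fun y => η (f y)) x := h.comp x hf'
  have h1 : fderiv ℝ (fun y => η (f y)) x = (fderiv ℝ η (f x)).comp (fderiv ℝ f x) :=
    fderiv_comp (𝕜 := ℝ) x h hf'
  have key : ∀ a b, fderiv ℝ (fun y => (η (f y)).comp (fderiv ℝ f y)) x a b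
      = fderiv ℝ η (f x) (fderiv ℝ f x a) (fderiv ℝ f x b)
        + η (f x) (fderiv ℝ (fderiv ℝ f) x a b) := by
    intro a b
    rw [fderiv_clm_comp h2 hf'', h1]
    simp [add_comm]
  simp only [d1, key, fderiv_fderiv_comm hf hs hx u v]
  ring

/-- For a 1-form vanishing on the vector fields `X` and `Y`, `η([X, Y]) = -dη(X, Y)`. -/
theorem apply_lieBracket {η : V → V →L[ℝ] ℝ} {X Y : V → V} {s : Set V} (hs : IsOpen s) {x : V}
    (hx : x ∈ s) (hη : DifferentiableAt ℝ η x) (hX : DifferentiableAt ℝ X x)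
    (hY : DifferentiableAt ℝ Y x) (h0 : ∀ y ∈ s, η y (X y) = 0) (h1 : ∀ y ∈ s, η y (Y y) = 0) :
    η x (VectorField.lieBracket ℝ X Y x) = - d1 η x (X x) (Y x) := by
  have key : ∀ Z : V → V, DifferentiableAt ℝ Z x → (∀ y ∈ s, η y (Z y) = 0) →
      ∀ u, fderiv ℝ η x u (Z x) + η x (fderiv ℝ Z x u) = 0 := by
    intro Z hZ hz u
    have e : (fun y => η y (Z y)) =ᶠ[nhds x] fun _ => (0 : ℝ) :=
      Filter.eventually_of_mem (hs.mem_nhds hx) hz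
    have := congrArg (fun L : V →L[ℝ] ℝ => L u) e.fderiv_eq
    rw [fderiv_clm_apply hη hZ] at this
    simp at this
    linarith
  have e1 := key X hX h0 (Y x)
  have e2 := key Y hY h1 (X x)
  simp only [VectorField.lieBracket, map_sub, d1]
  linarith

end Calculus

/-! ### Dual bases of covectors and vectors. -/

section Frames

variable {V : Type*} [NormedAddCommGroup V] [NormedSpace ℝ V] {ι : Type*} [Fintype ι]
  [DecidableEq ι]

/-- The covectors `θ` and the vectors `e` are dual bases. -/
structure IsDualFrame (θ : ι → V →L[ℝ] ℝ) (e : ι → V) : Prop where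
  pair : ∀ a b, θ a (e b) = if a = b then 1 else 0
  complete : ∀ u, ∑ a, θ a u • e a = u

namespace IsDualFrame

variable {θ : ι → V →L[ℝ] ℝ} {e : ι → V}

theorem ext_iff (h : IsDualFrame θ e) {u v : V} : u = v ↔ ∀ a, θ a u = θ a v := by
  refine ⟨fun h => by simp [h], fun H => ?_⟩
  rw [← h.complete u, ← h.complete v]
  simp [H]

theorem apply_sum (h : IsDualFrame θ e) (f : ι → ℝ) (a : ι) : θ a (∑ b, f b • e b) = f a := by
  simp [h.pair]

theorem linearIndependent (h : IsDualFrame θ e) : LinearIndependent ℝ θ := by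
  rw [Fintype.linearIndependent_iff]
  intro c hc i
  have := congrArg (fun L => L (e i)) hc
  simpa [h.pair] using this

/-- The basis underlying a dual frame. -/
def basis (h : IsDualFrame θ e) : Module.Basis ι ℝ V :=
  Module.Basis.ofEquivFun
    { toFun := fun u a => θ a u
      map_add' := fun u v => by ext; simp
      map_smul' := fun c u => by ext; simp
      invFun := fun f => ∑ a, f a • e a
      left_inv := h.complete
      right_inv := fun f => by ext a; exact h.apply_sum f a }

theorem basis_repr (h : IsDualFrame θ e) (u : V) (a : ι) : h.basis.repr u a = θ a u := rfl

theorem basis_apply (h : IsDualFrame θ e) (a : ι) : h.basis a = e a := by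
  apply h.basis.repr.injective
  ext b
  rw [Module.Basis.repr_self, basis_repr, h.pair, Finsupp.single_apply]
  simp [eq_comm]

/-- Traces can be computed in a dual frame. -/
theorem sum_coord (h : IsDualFrame θ e) {κ : Type*} [Fintype κ] (b : Module.Basis κ ℝ V)
    (T : V →ₗ[ℝ] V) : ∑ i, b.coord i (T (b i)) = ∑ a, θ a (T (e a)) := by
  classical
  have e1 := LinearMap.trace_eq_matrix_trace ℝ b T
  have e2 := LinearMap.trace_eq_matrix_trace ℝ h.basis T
  simp only [Matrix.trace, Matrix.diag, LinearMap.toMatrix_apply, h.basis_repr, h.basis_apply]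
    at e1 e2
  rw [← e2, e1]
  rfl

end IsDualFrame

end Frames

/-! ### Gauge transformations of connection forms. -/

section Gauge

variable {V : Type*} [NormedAddCommGroup V] [NormedSpace ℝ V] {ι : Type*} [Fintype ι]
  [DecidableEq ι]

/-- The gauge transform `B γ B⁻¹ - dB B⁻¹` of a connection form, where `C = B⁻¹`. -/
def gauge (B C : ι → ι → V → ℝ) (γ : ι → ι → V → V →L[ℝ] ℝ) (i j : ι) (x : V) : V →L[ℝ] ℝ :=
  ∑ k, ∑ l, (B i k x * C l j x) • γ k l x - ∑ k, C k j x • fderiv ℝ (B i k) x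

/-- Multiplying on the right by `B` removes `C = B⁻¹` and leaves `Bγ - dB`. This is the shape
produced by differentiating `Bα`, so `d1_gauge` never has to differentiate an inverse. -/
theorem gauge_mul {B C : ι → ι → V → ℝ} {γ : ι → ι → V → V →L[ℝ] ℝ} {x : V}
    (hCB : ∀ i j, ∑ k, C i k x * B k j x = if i = j then 1 else 0) (i m : ι) (u : V) :
    ∑ j, gauge B C γ i j x u * B j m x = ∑ k, B i k x * γ k m x u - fderiv ℝ (B i m) x u := by
  simp only [gauge, sub_apply, sum_apply,
    smul_apply, smul_eq_mul, sub_mul, Finset.sum_sub_distrib, Finset.sum_mul]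
  congr 1
  · rw [Finset.sum_comm]
    refine Finset.sum_congr rfl fun k _ => ?_
    rw [Finset.sum_comm]
    have : ∀ l, ∑ j, B i k x * C l j x * γ k l x u * B j m x
        = B i k x * γ k l x u * (if l = m then 1 else 0) := by
      intro l
      rw [← hCB, Finset.mul_sum]
      exact Finset.sum_congr rfl fun _ _ => by ring
    simp [this]
  · rw [Finset.sum_comm]
    have : ∀ k, ∑ j, C k j x * fderiv ℝ (B i k) x u * B j m x
        = fderiv ℝ (B i k) x u * (if k = m then 1 else 0) := by
      intro l
      rw [← hCB, Finset.mul_sum]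
      exact Finset.sum_congr rfl fun _ _ => by ring
    simp [this]

theorem d1_gauge {B C : ι → ι → V → ℝ} {γ : ι → ι → V → V →L[ℝ] ℝ} {α : ι → V → V →L[ℝ] ℝ} {x : V}
    (hB : ∀ i j, DifferentiableAt ℝ (B i j) x) (hα : ∀ i, DifferentiableAt ℝ (α i) x)
    (hCB : ∀ i j, ∑ k, C i k x * B k j x = if i = j then 1 else 0)
    (hd : ∀ i u v, d1 (α i) x u v = - ∑ j, wedge (γ i j x) (α j x) u v) (i : ι) (u v : V) :
    d1 (fun y => ∑ j, B i j y • α j y) x u v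
      = - ∑ j, wedge (gauge B C γ i j x) (∑ k, B j k x • α k x) u v := by
  rw [d1_sum _ (η := fun j y => B i j y • α j y) fun j _ => (hB i j).smul (hα j)]
  have e1 : ∀ a b, ∑ j, gauge B C γ i j x a * (∑ k, B j k x • α k x) b
      = ∑ m, (∑ k, B i k x * γ k m x a - fderiv ℝ (B i m) x a) * α m x b := by
    intro a b
    simp only [← gauge_mul hCB, sum_apply, smul_apply,
      smul_eq_mul, Finset.mul_sum, Finset.sum_mul]
    rw [Finset.sum_comm]
    exact Finset.sum_congr rfl fun _ _ => Finset.sum_congr rfl fun _ _ => by ring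
  simp only [wedge, Finset.sum_sub_distrib, e1]
  simp only [d1_smul (hB i _) (hα _), hd, wedge, Finset.sum_add_distrib, Finset.sum_sub_distrib,
    sub_mul, Finset.sum_mul, mul_neg, mul_sub, Finset.mul_sum, Finset.sum_neg_distrib, mul_assoc]
  rw [Finset.sum_comm (f := fun k m => B i k x * (γ k m x u * α m x v)),
    Finset.sum_comm (f := fun k m => B i k x * (γ k m x v * α m x u))]
  ring

theorem fderiv_mul_inverse {B C : ι → ι → V → ℝ} {x : V}
    (hB : ∀ i j, DifferentiableAt ℝ (B i j) x) (hC : ∀ i j, DifferentiableAt ℝ (C i j) x)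
    (hBC : ∀ᶠ y in nhds x, ∀ i j, ∑ k, B i k y * C k j y = if i = j then 1 else 0)
    (i j : ι) (u : V) :
    ∑ k, B i k x * fderiv ℝ (C k j) x u = - ∑ k, C k j x * fderiv ℝ (B i k) x u := by
  have e : (fun y => ∑ k, B i k y * C k j y) =ᶠ[nhds x] fun _ => if i = j then 1 else 0 :=
    hBC.mono fun y hy => hy i j
  have h := congrArg (fun L : V →L[ℝ] ℝ => L u) e.fderiv_eq
  rw [fderiv_fun_sum (A := fun k y => B i k y * C k j y) fun k _ => (hB i k).mul (hC k j)] at h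
  simp only [fderiv_fun_mul (hB i _) (hC _ j)] at h
  simp [Finset.sum_add_distrib] at h
  linarith

/-- The second half of an adapted coframe transforms by the contragredient matrix `Cᵀ` and has
connection form `-γᵀ`. Because `B dC = -dB C`, gauging `-γᵀ` by `Cᵀ` again gives minus the
transpose. Hence `d1_gauge'` is an instance of `d1_gauge`, and one form `Γ` serves both halves. -/
theorem gauge_transpose {B C : ι → ι → V → ℝ} {γ : ι → ι → V → V →L[ℝ] ℝ} {x : V}
    (hB : ∀ i j, DifferentiableAt ℝ (B i j) x) (hC : ∀ i j, DifferentiableAt ℝ (C i j) x)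
    (hBC : ∀ᶠ y in nhds x, ∀ i j, ∑ k, B i k y * C k j y = if i = j then 1 else 0) (i j : ι) :
    gauge (fun i j => C j i) (fun i j => B j i) (fun i j y => - γ j i y) i j x
      = - gauge B C γ j i x := by
  ext u
  have h := fderiv_mul_inverse hB hC hBC j i u
  simp only [gauge, sub_apply, sum_apply,
    smul_apply, neg_apply, smul_eq_mul, h]
  rw [Finset.sum_comm]
  simp only [mul_neg, Finset.sum_neg_distrib, mul_comm (C _ _ x) (B _ _ x)]
  ring

theorem d1_gauge' {B C : ι → ι → V → ℝ} {γ : ι → ι → V → V →L[ℝ] ℝ} {α : ι → V → V →L[ℝ] ℝ}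
    {x : V} (hB : ∀ i j, DifferentiableAt ℝ (B i j) x) (hC : ∀ i j, DifferentiableAt ℝ (C i j) x)
    (hα : ∀ i, DifferentiableAt ℝ (α i) x)
    (hBC : ∀ᶠ y in nhds x, ∀ i j, ∑ k, B i k y * C k j y = if i = j then 1 else 0)
    (hCB : ∀ i j, ∑ k, C i k x * B k j x = if i = j then 1 else 0)
    (hd : ∀ i u v, d1 (α i) x u v = ∑ j, wedge (γ j i x) (α j x) u v) (i : ι) (u v : V) :
    d1 (fun y => ∑ j, C j i y • α j y) x u v
      = ∑ j, wedge (gauge B C γ j i x) (∑ k, C k j x • α k x) u v := by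
  have h := d1_gauge (B := fun i j => C j i) (C := fun i j => B j i)
    (γ := fun i j y => - γ j i y) (α := α) (x := x) (fun i j => hC j i) hα
    (fun i j => by simpa [mul_comm, eq_comm] using hCB j i)
    (fun i u v => by
      rw [hd, ← Finset.sum_neg_distrib]
      exact Finset.sum_congr rfl fun j _ => by simp [wedge]; ring) i u v
  rw [h, ← Finset.sum_neg_distrib]
  refine Finset.sum_congr rfl fun j _ => ?_
  rw [gauge_transpose hB hC hBC]
  simp [wedge]
  ring

/-- A `𝔤𝔩(ι)`-valued covector annihilating both halves of a coframe vanishes. -/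
theorem eq_zero_of_wedge {α α' : ι → V →L[ℝ] ℝ} {e e' : ι → V}
    (h1 : ∀ i j, α i (e j) = if i = j then 1 else 0) (h3 : ∀ i j, α i (e' j) = 0)
    (h4 : ∀ i j, α' i (e' j) = if i = j then 1 else 0)
    {Δ : ι → ι → V →L[ℝ] ℝ} (hα : ∀ i u v, ∑ j, wedge (Δ i j) (α j) u v = 0)
    (hα' : ∀ i u v, ∑ j, wedge (Δ j i) (α' j) u v = 0) (i j : ι) : Δ i j = 0 := by
  -- `Δ` kills every vector annihilated by all `α'`, and likewise every vector annihilated by all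
  -- `α`. Any `u` is a sum of two such vectors, the second being its component along the `e'`.
  have k1 : ∀ i j v, (∀ k, α' k v = 0) → Δ i j v = 0 := by
    intro i j v hv
    have := hα' j (e' i) v
    simpa [wedge, hv, h4] using this
  have k2 : ∀ i j v, (∀ k, α k v = 0) → Δ i j v = 0 := by
    intro i j v hv
    have := hα i (e j) v
    simpa [wedge, hv, h1] using this
  ext u
  have := k1 i j (u - ∑ k, α' k u • e' k) (by intro k; simp [h4])
  have t := k2 i j (∑ k, α' k u • e' k) (by intro k; simp [h3])
  rw [map_sub, t, sub_zero] at this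
  simpa using this

end Gauge

end ParaKE

namespace ParaKE

/-! ### Cartan's structure equations and the curvature of the Koszul connection. -/

section Cartan

variable {V : Type*} [NormedAddCommGroup V] [NormedSpace ℝ V] {ι : Type*} [Fintype ι]
  [DecidableEq ι]

/-- The metric `h` has constant coefficients `H` in the coframe `θ`, and `σ` is a torsion-free
metric connection form. -/
structure IsCartanFrame (s : Set V) (h : V → V →L[ℝ] V →L[ℝ] ℝ) (H : ι → ι → ℝ)
    (θ : ι → V → V →L[ℝ] ℝ) (σ : ι → ι → V → V →L[ℝ] ℝ) (e : ι → V → V) : Prop where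
  isOpen : IsOpen s
  smooth_h : ContDiffOn ℝ ∞ h s
  smooth_θ : ∀ a, ContDiffOn ℝ ∞ (θ a) s
  smooth_σ : ∀ a b, ContDiffOn ℝ ∞ (σ a b) s
  dual : ∀ x ∈ s, IsDualFrame (fun a => θ a x) (fun a => e a x)
  inv : ∀ x ∈ s, (h x).IsInvertible
  symm : ∀ a b, H a b = H b a
  h_eq : ∀ x ∈ s, ∀ u v, h x u v = ∑ a, ∑ b, H a b * (θ a x u * θ b x v)
  dθ : ∀ x ∈ s, ∀ a u v, d1 (θ a) x u v = - ∑ b, wedge (σ a b x) (θ b x) u v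
  compat : ∀ x ∈ s, ∀ a b u, ∑ c, (H a c * σ c b x u + H b c * σ c a x u) = 0

/-- The curvature form `dσ + σ ∧ σ`. -/
def curvForm (σ : ι → ι → V → V →L[ℝ] ℝ) (a b : ι) (x u v : V) : ℝ :=
  d1 (σ a b) x u v + ∑ c, wedge (σ a c x) (σ c b x) u v

theorem contDiffOn_const_clm_comp {E F G : Type*} [NormedAddCommGroup E] [NormedSpace ℝ E]
    [NormedAddCommGroup F] [NormedSpace ℝ F] [NormedAddCommGroup G] [NormedSpace ℝ G]
    (L : F →L[ℝ] G) {f : V → E →L[ℝ] F} {s : Set V} (hf : ContDiffOn ℝ ∞ f s) :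
    ContDiffOn ℝ ∞ (fun x => L.comp (f x)) s :=
  contDiffOn_const.clm_comp hf

namespace IsCartanFrame

variable {s : Set V} {h : V → V →L[ℝ] V →L[ℝ] ℝ} {H : ι → ι → ℝ}
    {θ : ι → V → V →L[ℝ] ℝ} {σ : ι → ι → V → V →L[ℝ] ℝ} {e : ι → V → V}

theorem fderiv_h (F : IsCartanFrame s h H θ σ e) {x : V} (hx : x ∈ s) (u v w : V) :
    fderiv ℝ h x u v w = ∑ a, ∑ b, H a b *
      (fderiv ℝ (θ a) x u v * θ b x w + θ a x v * fderiv ℝ (θ b) x u w) := by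
  have hθ : ∀ a, DifferentiableAt ℝ (θ a) x := fun a =>
    diffAt_of_contDiffOn (F.smooth_θ a) F.isOpen hx
  have hh := diffAt_of_contDiffOn F.smooth_h F.isOpen hx
  have e0 : (fun y => h y v w) =ᶠ[nhds x] fun y => ∑ a, ∑ b, H a b * (θ a y v * θ b y w) :=
    Filter.eventually_of_mem (F.isOpen.mem_nhds hx) fun y hy => F.h_eq y hy v w
  have hv : ∀ a v, DifferentiableAt ℝ (fun y => θ a y v) x := fun a v =>
    (hθ a).clm_apply (differentiableAt_const v)
  have e1 : fderiv ℝ h x u v w = fderiv ℝ (fun y => h y v w) x u := by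
    rw [fderiv_clm_apply_const (hh.clm_apply (differentiableAt_const v)),
      fderiv_clm_apply hh (differentiableAt_const v)]
    simp
  have hp : ∀ a b, DifferentiableAt ℝ (fun y => θ a y v * θ b y w) x := fun a b =>
    (hv a v).mul (hv b w)
  rw [e1, e0.fderiv_eq, fderiv_fun_sum fun a _ => DifferentiableAt.fun_sum fun b _ =>
    (hp a b).const_mul _, sum_apply]
  refine Finset.sum_congr rfl fun a _ => ?_
  rw [fderiv_fun_sum fun b _ => (hp a b).const_mul _, sum_apply]
  refine Finset.sum_congr rfl fun b _ => ?_
  rw [fderiv_const_mul (hp a b), fderiv_fun_mul (hv a v) (hv b w)]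
  simp only [smul_apply, add_apply, smul_eq_mul, fderiv_clm_apply_const (hθ _)]
  ring

/-- Components of the covariant derivative of constant vector fields. -/
def cov (θ : ι → V → V →L[ℝ] ℝ) (σ : ι → ι → V → V →L[ℝ] ℝ) (a : ι) (x u v : V) : ℝ :=
  fderiv ℝ (θ a) x u v + ∑ b, σ a b x u * θ b x v

theorem cov_comm (F : IsCartanFrame s h H θ σ e) {x : V} (hx : x ∈ s) (a : ι) (u v : V) :
    cov θ σ a x u v = cov θ σ a x v u := by
  have := F.dθ x hx a u v
  simp only [d1, wedge, Finset.sum_sub_distrib] at this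
  simp only [cov]
  linarith

/-- This is `u(h(v,w)) = h(∇_u v, w) + h(v, ∇_u w)`. The connection terms on the right add up to
zero by `compat`, which is what turns ordinary derivatives of the coframe into covariant ones. -/
theorem fderiv_h_eq_cov (F : IsCartanFrame s h H θ σ e) {x : V} (hx : x ∈ s) (u v w : V) :
    fderiv ℝ h x u v w = ∑ a, ∑ b, H a b * (cov θ σ a x u v * θ b x w)
      + ∑ a, ∑ b, H a b * (cov θ σ a x u w * θ b x v) := by
  rw [F.fderiv_h hx]
  have e1 : ∑ a, ∑ b, H a b * (cov θ σ a x u w * θ b x v)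
      = ∑ a, ∑ b, H a b * (cov θ σ b x u w * θ a x v) := by
    rw [Finset.sum_comm]
    simp only [F.symm]
  have e2 : ∑ a, ∑ b, ∑ c, (H a c * σ c b x u + H b c * σ c a x u) * (θ b x v * θ a x w) = 0 := by
    simp only [← Finset.sum_mul, F.compat x hx, zero_mul, Finset.sum_const_zero]
  have e3 : ∑ a, ∑ b, H a b * ((∑ c, σ a c x u * θ c x v) * θ b x w)
      = ∑ a, ∑ b, ∑ c, H a c * σ c b x u * (θ b x v * θ a x w) := by
    simp only [Finset.mul_sum, Finset.sum_mul]
    rw [Finset.sum_comm]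
    refine Finset.sum_congr rfl fun a _ => ?_
    rw [Finset.sum_comm]
    refine Finset.sum_congr rfl fun b _ => Finset.sum_congr rfl fun c _ => ?_
    rw [F.symm a c]; ring
  have e4 : ∑ a, ∑ b, H a b * ((∑ c, σ b c x u * θ c x w) * θ a x v)
      = ∑ a, ∑ b, ∑ c, H b c * σ c a x u * (θ b x v * θ a x w) := by
    simp only [Finset.mul_sum, Finset.sum_mul]
    have : ∀ a, ∑ b, ∑ c, H a b * (σ b c x u * θ c x w * θ a x v)
      = ∑ c, ∑ b, H a b * σ b c x u * (θ a x v * θ c x w) := fun a => by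
      rw [Finset.sum_comm]
      exact Finset.sum_congr rfl fun _ _ => Finset.sum_congr rfl fun _ _ => by ring
    simp only [this]
    rw [Finset.sum_comm]
  simp only [add_mul, Finset.sum_add_distrib, ← e3, ← e4] at e2
  rw [e1]
  simp only [cov, mul_add, add_mul, Finset.sum_add_distrib]
  simp only [mul_comm (θ _ x v) (fderiv ℝ (θ _) x u w)]
  linarith

/-- Substituting metric compatibility into the three terms of the Koszul formula and using the
symmetry `cov_comm` (torsion-freeness), everything cancels except `h(∇_u v, ·)`. Invertibility of `h
x` then recovers the vector. -/
theorem θ_christoffel (F : IsCartanFrame s h H θ σ e) {x : V} (hx : x ∈ s) (a : ι) (u v : V) :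
    θ a x (christoffel h x u v) = cov θ σ a x u v := by
  set D := ∑ a, cov θ σ a x u v • e a x with hD
  have key : (1 / 2 : ℝ) • (fderiv ℝ h x u v + fderiv ℝ h x v u
      - ((fderiv ℝ h x).flip u).flip v) = h x D := by
    ext w
    simp only [smul_apply, sub_apply, add_apply, ContinuousLinearMap.flip_apply, smul_eq_mul,
      F.fderiv_h_eq_cov hx, F.h_eq x hx, hD, (F.dual x hx).apply_sum]
    simp only [F.cov_comm hx _ v u, F.cov_comm hx _ w u, F.cov_comm hx _ w v]
    ring
  have : christoffel h x u v = D := by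
    rw [christoffel, key]
    obtain ⟨f, hf⟩ := F.inv x hx
    rw [← hf, ContinuousLinearMap.inverse_equiv]
    exact f.symm_apply_apply D
  rw [this, hD, (F.dual x hx).apply_sum]

theorem christoffel_comm (F : IsCartanFrame s h H θ σ e) {x : V} (hx : x ∈ s) (u v : V) :
    christoffel h x u v = christoffel h x v u := by
  rw [(F.dual x hx).ext_iff]
  intro a
  rw [F.θ_christoffel hx, F.θ_christoffel hx, F.cov_comm hx]

/-- The derivatives of the Christoffel map cancel in pairs because that map is symmetric in a whole
neighbourhood of the point; the quadratic terms cancel for the same reason. -/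
theorem bianchi (F : IsCartanFrame s h H θ σ e) {x : V} (hx : x ∈ s) (u v w : V) :
    riemann h x u v w + riemann h x v w u + riemann h x w u v = 0 := by
  have e0 : ∀ u v w, fderiv ℝ (fun y => christoffel h y u v) x w
      = fderiv ℝ (fun y => christoffel h y v u) x w := fun u v w =>
    congrArg (fun L : V →L[ℝ] V => L w) (Filter.EventuallyEq.fderiv_eq
      (Filter.eventually_of_mem (F.isOpen.mem_nhds hx) fun y hy => F.christoffel_comm hy u v))
  simp only [riemann]
  rw [e0 w u v, e0 w v u, e0 u v w, F.christoffel_comm hx w u, F.christoffel_comm hx w v,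
    F.christoffel_comm hx u v]
  abel

variable [CompleteSpace V]

theorem smooth_christoffel (F : IsCartanFrame s h H θ σ e) (u v : V) :
    ContDiffOn ℝ ∞ (fun x => christoffel h x u v) s := by
  have h1 : ContDiffOn ℝ ∞ (fun x => (h x).inverse) s := fun x hx =>
    ((F.inv x hx).contDiffAt_map_inverse.comp x
      (F.smooth_h.contDiffAt (F.isOpen.mem_nhds hx))).contDiffWithinAt
  have h2 := contDiffOn_fderiv F.smooth_h F.isOpen
  refine h1.clm_apply (ContDiffOn.const_smul _ (ContDiffOn.sub (ContDiffOn.add ?_ ?_) ?_))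
  · exact (h2.clm_apply contDiffOn_const).clm_apply contDiffOn_const
  · exact (h2.clm_apply contDiffOn_const).clm_apply contDiffOn_const
  · let ev : (V →L[ℝ] V →L[ℝ] ℝ) →L[ℝ] ℝ :=
      (ContinuousLinearMap.apply ℝ ℝ v).comp (ContinuousLinearMap.apply ℝ (V →L[ℝ] ℝ) u)
    exact contDiffOn_const_clm_comp ev h2

/-- One of the two halves of the curvature, obtained by differentiating `θ_christoffel` along `u`.
The second derivative of `θ a` and the mixed products of `σ` with a derivative of `θ` are symmetric
in `u, v`. They disappear in `θ_riemann`, leaving `dσ + σ ∧ σ`. -/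
theorem θ_fderiv_christoffel (F : IsCartanFrame s h H θ σ e) {x : V} (hx : x ∈ s) (a : ι)
    (u v w : V) :
    θ a x (fderiv ℝ (fun y => christoffel h y v w) x u) + θ a x (christoffel h x u
      (christoffel h x v w)) = fderiv ℝ (fderiv ℝ (θ a)) x u v w
      + ∑ b, (fderiv ℝ (σ a b) x u v * θ b x w + σ a b x v * fderiv ℝ (θ b) x u w)
      + ∑ b, σ a b x u * fderiv ℝ (θ b) x v w
      + ∑ b, (∑ c, σ a c x u * σ c b x v) * θ b x w := by
  have hθ : ∀ a, DifferentiableAt ℝ (θ a) x := fun a =>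
    diffAt_of_contDiffOn (F.smooth_θ a) F.isOpen hx
  have hσ : ∀ a b, DifferentiableAt ℝ (σ a b) x := fun a b =>
    diffAt_of_contDiffOn (F.smooth_σ a b) F.isOpen hx
  have hθ' : DifferentiableAt ℝ (fderiv ℝ (θ a)) x :=
    diffAt_of_contDiffOn (contDiffOn_fderiv (F.smooth_θ a) F.isOpen) F.isOpen hx
  have hc := diffAt_of_contDiffOn (F.smooth_christoffel v w) F.isOpen hx
  have e0 : (fun y => θ a y (christoffel h y v w)) =ᶠ[nhds x]
      fun y => fderiv ℝ (θ a) y v w + ∑ b, σ a b y v * θ b y w :=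
    Filter.eventually_of_mem (F.isOpen.mem_nhds hx) fun y hy => F.θ_christoffel hy a v w
  have e1 := congrArg (fun L : V →L[ℝ] ℝ => L u) e0.fderiv_eq
  have g1 : DifferentiableAt ℝ (fun y => fderiv ℝ (θ a) y v w) x :=
    (hθ'.clm_apply (differentiableAt_const v)).clm_apply (differentiableAt_const w)
  have hσv : ∀ b, DifferentiableAt ℝ (fun y => σ a b y v) x := fun b =>
    (hσ a b).clm_apply (differentiableAt_const v)
  have hθw : ∀ b, DifferentiableAt ℝ (fun y => θ b y w) x := fun b =>
    (hθ b).clm_apply (differentiableAt_const w)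
  have g2 : ∀ b, DifferentiableAt ℝ (fun y => σ a b y v * θ b y w) x := fun b =>
    (hσv b).mul (hθw b)
  have g3 : fderiv ℝ (fun y => fderiv ℝ (θ a) y v w) x u = fderiv ℝ (fderiv ℝ (θ a)) x u v w := by
    rw [fderiv_clm_apply_const (hθ'.clm_apply (differentiableAt_const v)),
      fderiv_clm_apply hθ' (differentiableAt_const v)]
    simp
  rw [fderiv_clm_apply (hθ a) hc, fderiv_fun_add g1 (DifferentiableAt.fun_sum fun b _ => g2 b),
    fderiv_fun_sum fun b _ => g2 b] at e1
  simp only [add_apply, sum_apply, ContinuousLinearMap.comp_apply, ContinuousLinearMap.flip_apply,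
    fderiv_fun_mul (hσv _) (hθw _), smul_apply, smul_eq_mul, fderiv_clm_apply_const (hσ _ _),
    fderiv_clm_apply_const (hθ _), g3] at e1
  rw [F.θ_christoffel hx, cov]
  simp only [F.θ_christoffel hx]
  have e2 : ∑ b, σ a b x u * cov θ σ b x v w = ∑ b, σ a b x u * fderiv ℝ (θ b) x v w
      + ∑ b, (∑ c, σ a c x u * σ c b x v) * θ b x w := by
    simp only [cov, mul_add, Finset.sum_add_distrib, Finset.mul_sum, Finset.sum_mul]
    congr 1
    rw [Finset.sum_comm]
    simp only [mul_assoc]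
  rw [e2]
  simp only [Finset.sum_add_distrib] at e1 ⊢
  simp only [mul_comm (θ _ x w) (fderiv ℝ (σ _ _) x u v)] at e1
  linarith

theorem θ_riemann (F : IsCartanFrame s h H θ σ e) {x : V} (hx : x ∈ s) (a : ι) (u v w : V) :
    θ a x (riemann h x u v w) = ∑ b, curvForm σ a b x u v * θ b x w := by
  have e1 := F.θ_fderiv_christoffel hx a u v w
  have e2 := F.θ_fderiv_christoffel hx a v u w
  have e3 : fderiv ℝ (fderiv ℝ (θ a)) x u v = fderiv ℝ (fderiv ℝ (θ a)) x v u :=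
    fderiv_fderiv_comm (F.smooth_θ a) F.isOpen hx u v
  simp only [riemann, map_add, map_sub]
  have e4 : ∑ b, curvForm σ a b x u v * θ b x w =
      ∑ b, fderiv ℝ (σ a b) x u v * θ b x w - ∑ b, fderiv ℝ (σ a b) x v u * θ b x w
      + ∑ b, (∑ c, σ a c x u * σ c b x v) * θ b x w
      - ∑ b, (∑ c, σ a c x v * σ c b x u) * θ b x w := by
    simp only [← Finset.sum_sub_distrib, ← Finset.sum_add_distrib]
    refine Finset.sum_congr rfl fun b _ => ?_
    simp only [curvForm, d1, wedge, Finset.sum_sub_distrib]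
    ring
  rw [e4]
  rw [e3] at e1
  simp only [Finset.sum_add_distrib] at e1 e2
  linarith

theorem curvForm_bianchi (F : IsCartanFrame s h H θ σ e) {x : V} (hx : x ∈ s) (a : ι) (u v w : V) :
    ∑ b, curvForm σ a b x u v * θ b x w + ∑ b, curvForm σ a b x v w * θ b x u
      + ∑ b, curvForm σ a b x w u * θ b x v = 0 := by
  rw [← F.θ_riemann hx, ← F.θ_riemann hx, ← F.θ_riemann hx, ← map_add, ← map_add, F.bianchi hx,
    map_zero]

end IsCartanFrame

theorem IsCartanFrame.ricci_eq [FiniteDimensional ℝ V] {s : Set V}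
    {h : V → V →L[ℝ] V →L[ℝ] ℝ} {H : ι → ι → ℝ}
    {θ : ι → V → V →L[ℝ] ℝ} {σ : ι → ι → V → V →L[ℝ] ℝ} {e : ι → V → V}
    (F : IsCartanFrame s h H θ σ e) {x : V} (hx : x ∈ s) (v w : V) :
    ricci h x v w = ∑ a, ∑ b, curvForm σ a b x (e a x) w * θ b x v := by
  have : CompleteSpace V := FiniteDimensional.complete ℝ V
  have hadd : ∀ a b u u', curvForm σ a b x (u + u') w = curvForm σ a b x u w
      + curvForm σ a b x u' w := by
    intro a b u u'
    simp only [curvForm, d1, wedge, map_add, add_apply, Finset.sum_sub_distrib, add_mul,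
      mul_add, Finset.sum_add_distrib]
    ring
  have hsmul : ∀ a b (c : ℝ) u, curvForm σ a b x (c • u) w = c * curvForm σ a b x u w := by
    intro a b c u
    simp only [curvForm, d1, wedge, map_smul, smul_apply, smul_eq_mul, mul_add, Finset.mul_sum,
      mul_sub, mul_assoc, mul_left_comm c]
  -- The Ricci tensor is a trace in the fixed basis `Module.finBasis`. Once `u ↦ R(u,w)v` is known
  -- to be linear, the trace may be taken in the dual frame instead.
  let T : V →ₗ[ℝ] V :=
    { toFun := fun u => riemann h x u w v
      map_add' := fun u u' => by
        rw [(F.dual x hx).ext_iff]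
        intro a
        simp only [map_add, F.θ_riemann hx, hadd, add_mul, Finset.sum_add_distrib]
      map_smul' := fun c u => by
        rw [(F.dual x hx).ext_iff]
        intro a
        simp only [map_smul, F.θ_riemann hx, hsmul, Finset.mul_sum, mul_assoc, smul_eq_mul,
          RingHom.id_apply] }
  have := (F.dual x hx).sum_coord (Module.finBasis ℝ V) T
  rw [ricci]
  simpa only [T, LinearMap.coe_mk, AddHom.coe_mk, F.θ_riemann hx] using this

end Cartan

end ParaKE

namespace ParaKE

/-! ### Nondegenerate forms and bilinear forms evaluated on frames. -/

section LinearAlgebra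

variable {V : Type*} [NormedAddCommGroup V] [NormedSpace ℝ V]

theorem HasSignature.eq_zero {B : V →L[ℝ] V →L[ℝ] ℝ} {p q : ℕ} (hB : HasSignature B p q) {u : V}
    (hu : ∀ v, B u v = 0) : u = 0 := by
  obtain ⟨b, hb⟩ := hB
  apply b.repr.injective
  ext j
  have h1 : B u (b j) = b.repr u j * B (b j) (b j) := by
    conv_lhs => rw [← b.sum_repr u]
    rw [map_sum, sum_apply, Finset.sum_eq_single j]
    · simp
    · intro i _ hij
      simp [hb, hij]
    · simp
  rw [hu, hb, if_pos rfl] at h1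
  rcases j with j | j <;> simpa [eq_comm] using h1

/-- Christoffel maps and null frames are defined with `ContinuousLinearMap.inverse`, which takes the
default value `0` on non-invertible maps. In finite dimension nondegeneracy excludes that case. -/
theorem isInvertible_of_nondegenerate [FiniteDimensional ℝ V] {B : V →L[ℝ] V →L[ℝ] ℝ}
    (hB : ∀ u, (∀ v, B u v = 0) → u = 0) : B.IsInvertible := by
  have hinj : Function.Injective (B : V →ₗ[ℝ] V →L[ℝ] ℝ) := by
    rw [← LinearMap.ker_eq_bot, LinearMap.ker_eq_bot']
    intro u hu
    exact hB u fun v => by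
      have : B u = 0 := hu
      simp [this]
  have hdim : Module.finrank ℝ V = Module.finrank ℝ (V →L[ℝ] ℝ) := by
    rw [← (LinearMap.toContinuousLinearMap : (V →ₗ[ℝ] ℝ) ≃ₗ[ℝ] _).finrank_eq]
    exact (Subspace.dual_finrank_eq (K := ℝ) (V := V)).symm
  refine ⟨(LinearEquiv.ofInjectiveOfFinrankEq _ hinj hdim).toContinuousLinearEquiv, ?_⟩
  ext u v
  rfl

theorem HasSignature.isInvertible [FiniteDimensional ℝ V] {B : V →L[ℝ] V →L[ℝ] ℝ} {p q : ℕ}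
    (hB : HasSignature B p q) : B.IsInvertible :=
  isInvertible_of_nondegenerate fun _ => hB.eq_zero

theorem apply_inverse_of_isInvertible {B : V →L[ℝ] V →L[ℝ] ℝ} (hB : B.IsInvertible)
    (α : V →L[ℝ] ℝ) : B (B.inverse α) = α := by
  obtain ⟨f, rfl⟩ := hB
  rw [ContinuousLinearMap.inverse_equiv]
  exact f.apply_symm_apply α

theorem contDiffOn_inverse_apply [FiniteDimensional ℝ V] {h : V → V →L[ℝ] V →L[ℝ] ℝ}
    {α : V → V →L[ℝ] ℝ} {s : Set V} (hs : IsOpen s) (hh : ContDiffOn ℝ ∞ h s)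
    (hα : ContDiffOn ℝ ∞ α s) (hi : ∀ x ∈ s, (h x).IsInvertible) :
    ContDiffOn ℝ ∞ (fun x => (h x).inverse (α x)) s := by
  have : CompleteSpace V := FiniteDimensional.complete ℝ V
  have h1 : ContDiffOn ℝ ∞ (fun x => (h x).inverse) s := fun x hx =>
    ((hi x hx).contDiffAt_map_inverse.comp x
      (hh.contDiffAt (hs.mem_nhds hx))).contDiffWithinAt
  exact h1.clm_apply hα

theorem contDiffOn_d1 {η : V → V →L[ℝ] ℝ} {X Y : V → V} {s : Set V} (hs : IsOpen s)
    (hη : ContDiffOn ℝ ∞ η s) (hX : ContDiffOn ℝ ∞ X s) (hY : ContDiffOn ℝ ∞ Y s) :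
    ContDiffOn ℝ ∞ (fun y => d1 η y (X y) (Y y)) s := by
  have h := contDiffOn_fderiv hη hs
  exact ((h.clm_apply hX).clm_apply hY).sub ((h.clm_apply hY).clm_apply hX)

/-- `d1` as a bilinear map. -/
def d1L (η : V → V →L[ℝ] ℝ) (x : V) : V →L[ℝ] V →L[ℝ] ℝ := fderiv ℝ η x - (fderiv ℝ η x).flip

theorem d1L_apply (η : V → V →L[ℝ] ℝ) (x u v : V) : d1L η x u v = d1 η x u v := rfl

/-- `wedge` as a bilinear map. -/
def wedgeL (a b : V →L[ℝ] ℝ) : V →L[ℝ] V →L[ℝ] ℝ := a.smulRight b - b.smulRight a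

theorem wedgeL_apply (a b : V →L[ℝ] ℝ) (u v : V) : wedgeL a b u v = wedge a b u v := by
  simp [wedgeL, wedge]
  ring

theorem d1_swap (η : V → V →L[ℝ] ℝ) (x u v : V) : d1 η x u v = - d1 η x v u := by
  simp [d1]

theorem IsDualFrame.bilin_ext {ι : Type*} [Fintype ι] [DecidableEq ι] {θ : ι → V →L[ℝ] ℝ}
    {e : ι → V} (h : IsDualFrame θ e) {B C : V →L[ℝ] V →L[ℝ] ℝ}
    (hBC : ∀ a b, B (e a) (e b) = C (e a) (e b)) : B = C := by
  ext u v
  rw [← h.complete u, ← h.complete v]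
  simp [hBC]

/-- The frame dual to `Sum.elim a a'`: `g(e_j, ·) = a'_j` and `g(e'_j, ·) = a_j`. -/
def nullFrame (g : V →L[ℝ] V →L[ℝ] ℝ) (a a' : Fin 2 → V →L[ℝ] ℝ) : Fin 2 ⊕ Fin 2 → V :=
  Sum.elim (fun j => g.inverse (a' j)) (fun j => g.inverse (a j))

end LinearAlgebra

/-! ### The null frame dual to an adapted coframe. -/

section AdaptedCoframe

variable {g : E4 →L[ℝ] E4 →L[ℝ] ℝ} {K : E4 →L[ℝ] E4} {a a' : Fin 2 → E4 →L[ℝ] ℝ}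

theorem IsAdaptedCoframe.metric (h : IsAdaptedCoframe g K a a') (u v : E4) :
    g u v = ∑ i, (a i u * a' i v + a' i u * a i v) := by
  rw [h.2.1]
  exact Finset.sum_congr rfl fun i _ => by simp only [symProd]; ring

theorem IsAdaptedCoframe.coeff_eq (h : IsAdaptedCoframe g K a a') {c c' d d' : Fin 2 → ℝ}
    (hc : ∀ v, ∑ i, (c i * a' i v + c' i * a i v) = ∑ i, (d i * a' i v + d' i * a i v)) :
    c = d ∧ c' = d' := by
  have h1 := Fintype.linearIndependent_iff.1 h.1 (Sum.elim (fun i => c' i - d' i)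
    fun i => c i - d i) (by
      ext v
      have := hc v
      simp only [Finset.sum_add_distrib] at this
      simp only [Fintype.sum_sum_type, Sum.elim_inl, Sum.elim_inr, add_apply, sum_apply,
        smul_apply, smul_eq_mul, sub_mul, Finset.sum_sub_distrib, zero_apply]
      linarith)
  exact ⟨funext fun i => sub_eq_zero.1 (h1 (Sum.inr i)),
    funext fun i => sub_eq_zero.1 (h1 (Sum.inl i))⟩

/-- Expanding `g(e_j, ·) = a'_j` and `g(e'_j, ·) = a_j` by the null form of `g` and comparing
coefficients gives all pairings. For completeness, a vector killed by the whole coframe is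
`g`-orthogonal to everything, hence zero. -/
theorem IsAdaptedCoframe.isDualFrame (h : IsAdaptedCoframe g K a a') (hg : HasSignature g 2 2) :
    IsDualFrame (Sum.elim a a') (nullFrame g a a') := by
  have k1 : ∀ j, (fun i => a i (g.inverse (a' j))) = (fun i => if i = j then 1 else 0) ∧
      (fun i => a' i (g.inverse (a' j))) = fun _ => 0 := by
    intro j
    apply h.coeff_eq
    intro v
    rw [← h.metric, apply_inverse_of_isInvertible hg.isInvertible]
    simp
  have k2 : ∀ j, (fun i => a i (g.inverse (a j))) = (fun _ => 0) ∧
      (fun i => a' i (g.inverse (a j))) = fun i => if i = j then 1 else 0 := by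
    intro j
    apply h.coeff_eq
    intro v
    rw [← h.metric, apply_inverse_of_isInvertible hg.isInvertible]
    simp
  have hp : ∀ b c, Sum.elim a a' b (nullFrame g a a' c) = if b = c then 1 else 0 := by
    rintro (b | b) (c | c)
    · simpa [nullFrame] using congrFun (k1 c).1 b
    · simpa [nullFrame] using congrFun (k2 c).1 b
    · simpa [nullFrame] using congrFun (k1 c).2 b
    · simpa [nullFrame] using congrFun (k2 c).2 b
  refine ⟨hp, fun u => ?_⟩
  have : ∀ b, Sum.elim a a' b (u - ∑ c, Sum.elim a a' c u • nullFrame g a a' c) = 0 := by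
    intro b
    simp only [map_sub, map_sum, map_smul, hp, smul_eq_mul, mul_ite, mul_one, mul_zero,
      Finset.sum_ite_eq, Finset.mem_univ, if_true, sub_self]
  symm
  rw [← sub_eq_zero]
  refine hg.eq_zero fun v => ?_
  have h1 := fun i => this (Sum.inl i)
  have h2 := fun i => this (Sum.inr i)
  rw [h.metric]
  simp only [Sum.elim_inl, Sum.elim_inr] at h1 h2
  simp only [h1, h2]
  simp

end AdaptedCoframe

/-- A para-Kähler-Einstein structure on an open set of `ℝ⁴` with an adapted coframe. -/
structure IsAdaptedOn (s : Set E4) (g : E4 → E4 →L[ℝ] E4 →L[ℝ] ℝ) (K : E4 → E4 →L[ℝ] E4)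
    (a a' : Fin 2 → E4 → E4 →L[ℝ] ℝ) : Prop where
  isOpen : IsOpen s
  pke : IsParaKahlerEinsteinOn s g K
  smooth_a : ∀ i, ContDiffOn ℝ ∞ (a i) s
  smooth_a' : ∀ i, ContDiffOn ℝ ∞ (a' i) s
  adapted : ∀ y ∈ s, IsAdaptedCoframe (g y) (K y) (fun i => a i y) (fun i => a' i y)

/-- The Levi-Civita connection form of `g` in the adapted coframe. -/
def conn (g : E4 → E4 →L[ℝ] E4 →L[ℝ] ℝ) (a a' : Fin 2 → E4 → E4 →L[ℝ] ℝ) (i j : Fin 2)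
    (y : E4) : E4 →L[ℝ] ℝ :=
  ∑ k, d1 (a' j) y ((g y).inverse (a' k y)) ((g y).inverse (a i y)) • a k y
    + ∑ k, d1 (a i) y ((g y).inverse (a' j y)) ((g y).inverse (a k y)) • a' k y

/-- The coefficients of `g` in an adapted coframe. -/
def nullGram : Fin 2 ⊕ Fin 2 → Fin 2 ⊕ Fin 2 → ℝ
  | .inl i, .inr j => if i = j then 1 else 0
  | .inr i, .inl j => if i = j then 1 else 0
  | _, _ => 0

/-- The `𝔰𝔬(2,2)`-valued connection form induced by a `𝔤𝔩₂`-valued one. -/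
def blockConn {V : Type*} [NormedAddCommGroup V] [NormedSpace ℝ V]
    (γ : Fin 2 → Fin 2 → V → V →L[ℝ] ℝ) : Fin 2 ⊕ Fin 2 → Fin 2 ⊕ Fin 2 → V → V →L[ℝ] ℝ
  | .inl i, .inl j => γ i j
  | .inr i, .inr j => fun y => - γ j i y
  | .inl _, .inr _ => fun _ => 0
  | .inr _, .inl _ => fun _ => 0

/-! ### The Levi-Civita connection of a para-Kähler metric and the curvature of its trace. -/

namespace IsAdaptedOn

variable {s : Set E4} {g : E4 → E4 →L[ℝ] E4 →L[ℝ] ℝ} {K : E4 → E4 →L[ℝ] E4}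
    {a a' : Fin 2 → E4 → E4 →L[ℝ] ℝ}

section

variable (A : IsAdaptedOn s g K a a') {y : E4} (hy : y ∈ s)
include A hy

theorem isInvertible : (g y).IsInvertible := (A.pke.signature y hy).isInvertible

theorem dual : IsDualFrame (Sum.elim (fun i => a i y) (fun i => a' i y))
    (nullFrame (g y) (fun i => a i y) (fun i => a' i y)) :=
  (A.adapted y hy).isDualFrame (A.pke.signature y hy)

theorem a_e (i j : Fin 2) : a i y ((g y).inverse (a' j y)) = if i = j then 1 else 0 := by
  simpa [nullFrame] using (A.dual hy).pair (Sum.inl i) (Sum.inl j)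

theorem a_e' (i j : Fin 2) : a i y ((g y).inverse (a j y)) = 0 := by
  simpa [nullFrame] using (A.dual hy).pair (Sum.inl i) (Sum.inr j)

theorem a'_e (i j : Fin 2) : a' i y ((g y).inverse (a' j y)) = 0 := by
  simpa [nullFrame] using (A.dual hy).pair (Sum.inr i) (Sum.inl j)

theorem a'_e' (i j : Fin 2) : a' i y ((g y).inverse (a j y)) = if i = j then 1 else 0 := by
  simpa [nullFrame] using (A.dual hy).pair (Sum.inr i) (Sum.inr j)

theorem vec_ext {u v : E4} (h : ∀ i, a i y u = a i y v) (h' : ∀ i, a' i y u = a' i y v) :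
    u = v := by
  rw [(A.dual hy).ext_iff]
  rintro (i | i)
  exacts [h i, h' i]

theorem a_K (i : Fin 2) (u : E4) : a i y (K y u) = a i y u := ((A.adapted y hy).2.2 i u).1

theorem a'_K (i : Fin 2) (u : E4) : a' i y (K y u) = - a' i y u := ((A.adapted y hy).2.2 i u).2

theorem mem_eigDist_one {u : E4} : u ∈ eigDist K 1 y ↔ ∀ i, a' i y u = 0 := by
  rw [eigDist, Module.End.mem_eigenspace_iff]
  simp only [ContinuousLinearMap.coe_coe, one_smul]
  constructor
  · intro h i
    have := A.a'_K hy i u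
    rw [h] at this
    linarith
  · intro h
    refine A.vec_ext hy (fun i => A.a_K hy i u) fun i => ?_
    rw [A.a'_K hy, h, neg_zero]

theorem mem_eigDist_neg_one {u : E4} : u ∈ eigDist K (-1) y ↔ ∀ i, a i y u = 0 := by
  rw [eigDist, Module.End.mem_eigenspace_iff]
  simp only [ContinuousLinearMap.coe_coe, neg_smul, one_smul]
  constructor
  · intro h i
    have := A.a_K hy i u
    rw [h, map_neg] at this
    linarith
  · intro h
    refine A.vec_ext hy (fun i => ?_) fun i => ?_
    · rw [A.a_K hy, map_neg, h, neg_zero]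
    · rw [A.a'_K hy, map_neg]

end

variable (A : IsAdaptedOn s g K a a')
include A

theorem smooth_e (j : Fin 2) : ContDiffOn ℝ ∞ (fun y => (g y).inverse (a' j y)) s :=
  contDiffOn_inverse_apply A.isOpen A.pke.smooth_g (A.smooth_a' j) fun _ => A.isInvertible

theorem smooth_e' (j : Fin 2) : ContDiffOn ℝ ∞ (fun y => (g y).inverse (a j y)) s :=
  contDiffOn_inverse_apply A.isOpen A.pke.smooth_g (A.smooth_a j) fun _ => A.isInvertible

theorem smooth_conn (i j : Fin 2) : ContDiffOn ℝ ∞ (conn g a a' i j) s := by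
  refine ContDiffOn.add (ContDiffOn.sum fun k _ => ?_) (ContDiffOn.sum fun k _ => ?_)
  · exact (contDiffOn_d1 A.isOpen (A.smooth_a' j) (A.smooth_e k) (A.smooth_e' i)).smul
      (A.smooth_a k)
  · exact (contDiffOn_d1 A.isOpen (A.smooth_a i) (A.smooth_e j) (A.smooth_e' k)).smul
      (A.smooth_a' k)

variable {y : E4} (hy : y ∈ s)
include hy

theorem diffAt_a (i : Fin 2) : DifferentiableAt ℝ (a i) y :=
  diffAt_of_contDiffOn (A.smooth_a i) A.isOpen hy

theorem diffAt_a' (i : Fin 2) : DifferentiableAt ℝ (a' i) y :=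
  diffAt_of_contDiffOn (A.smooth_a' i) A.isOpen hy

theorem conn_e (i j k : Fin 2) : conn g a a' i j y ((g y).inverse (a' k y))
    = d1 (a' j) y ((g y).inverse (a' k y)) ((g y).inverse (a i y)) := by
  fin_cases k <;> simp [conn, A.a_e hy, A.a'_e hy]

theorem conn_e' (i j k : Fin 2) : conn g a a' i j y ((g y).inverse (a k y))
    = d1 (a i) y ((g y).inverse (a' j y)) ((g y).inverse (a k y)) := by
  fin_cases k <;> simp [conn, A.a_e' hy, A.a'_e' hy]

/-- Integrability of the `+1`-eigendistribution: it is the common kernel of the `a'`, so `a'`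
vanishes on brackets of the `e`, and such a value is minus the exterior derivative. -/
theorem d1_a'_e_e (i j k : Fin 2) :
    d1 (a' i) y ((g y).inverse (a' j y)) ((g y).inverse (a' k y)) = 0 := by
  have h := apply_lieBracket (η := a' i) A.isOpen hy (A.diffAt_a' hy i)
    (diffAt_of_contDiffOn (A.smooth_e j) A.isOpen hy)
    (diffAt_of_contDiffOn (A.smooth_e k) A.isOpen hy)
    (fun z hz => A.a'_e hz i j) (fun z hz => A.a'_e hz i k)
  have h2 := A.pke.integrable_pos s A.isOpen subset_rfl _ _ (A.smooth_e j) (A.smooth_e k)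
    (fun z hz => (A.mem_eigDist_one hz).2 fun l => A.a'_e hz l j)
    (fun z hz => (A.mem_eigDist_one hz).2 fun l => A.a'_e hz l k) y hy
  rw [(A.mem_eigDist_one hy).1 h2 i] at h
  linarith

theorem d1_a_e'_e' (i j k : Fin 2) :
    d1 (a i) y ((g y).inverse (a j y)) ((g y).inverse (a k y)) = 0 := by
  have h := apply_lieBracket (η := a i) A.isOpen hy (A.diffAt_a hy i)
    (diffAt_of_contDiffOn (A.smooth_e' j) A.isOpen hy)
    (diffAt_of_contDiffOn (A.smooth_e' k) A.isOpen hy)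
    (fun z hz => A.a_e' hz i j) (fun z hz => A.a_e' hz i k)
  have h2 := A.pke.integrable_neg s A.isOpen subset_rfl _ _ (A.smooth_e' j) (A.smooth_e' k)
    (fun z hz => (A.mem_eigDist_neg_one hz).2 fun l => A.a_e' hz l j)
    (fun z hz => (A.mem_eigDist_neg_one hz).2 fun l => A.a_e' hz l k) y hy
  rw [(A.mem_eigDist_neg_one hy).1 h2 i] at h
  linarith

theorem kahler_form (u v : E4) :
    g y (K y u) v = ∑ i, wedge (a i y) (a' i y) u v := by
  rw [(A.adapted y hy).metric]
  refine Finset.sum_congr rfl fun i _ => ?_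
  rw [A.a_K hy, A.a'_K hy, wedge]
  ring

theorem fderiv_kahler_form (u v w : E4) :
    fderiv ℝ (fun y => (g y).comp (K y)) y u v w = ∑ i,
      (fderiv ℝ (a i) y u v * a' i y w + a i y v * fderiv ℝ (a' i) y u w
        - fderiv ℝ (a i) y u w * a' i y v - a i y w * fderiv ℝ (a' i) y u v) := by
  have hd : DifferentiableAt ℝ (fun y => (g y).comp (K y)) y :=
    (diffAt_of_contDiffOn A.pke.smooth_g A.isOpen hy).clm_comp
      (diffAt_of_contDiffOn A.pke.smooth_K A.isOpen hy)
  have e1 : fderiv ℝ (fun y => (g y).comp (K y)) y u v w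
      = fderiv ℝ (fun y => (g y).comp (K y) v w) y u := by
    rw [fderiv_clm_apply_const (hd.clm_apply (differentiableAt_const v)),
      fderiv_clm_apply hd (differentiableAt_const v)]
    simp
  have e2 : (fun y => (g y).comp (K y) v w) =ᶠ[nhds y]
      fun y => ∑ i, (a i y v * a' i y w - a i y w * a' i y v) :=
    Filter.eventually_of_mem (A.isOpen.mem_nhds hy) fun z hz => A.kahler_form hz v w
  have h1 : ∀ i v, DifferentiableAt ℝ (fun y => a i y v) y := fun i v =>
    (A.diffAt_a hy i).clm_apply (differentiableAt_const v)
  have h2 : ∀ i v, DifferentiableAt ℝ (fun y => a' i y v) y := fun i v =>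
    (A.diffAt_a' hy i).clm_apply (differentiableAt_const v)
  rw [e1, e2.fderiv_eq, fderiv_fun_sum fun i _ => ((h1 i v).fun_mul (h2 i w)).fun_sub
    ((h1 i w).fun_mul (h2 i v)), sum_apply]
  refine Finset.sum_congr rfl fun i _ => ?_
  rw [fderiv_fun_sub ((h1 i v).fun_mul (h2 i w)) ((h1 i w).fun_mul (h2 i v)),
    fderiv_fun_mul (h1 i v) (h2 i w), fderiv_fun_mul (h1 i w) (h2 i v)]
  simp only [sub_apply, add_apply, smul_apply, smul_eq_mul, fderiv_clm_apply_const
    (A.diffAt_a hy i), fderiv_clm_apply_const (A.diffAt_a' hy i)]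
  ring

/-- Closedness of `ρ = Σ aᵢ ∧ a'ᵢ`, expanded by the Leibniz rule as `Σ (daᵢ ∧ a'ᵢ - aᵢ ∧ da'ᵢ) = 0`.
-/
theorem closed_coframe (u v w : E4) : ∑ i,
    (d1 (a i) y u v * a' i y w + d1 (a i) y v w * a' i y u + d1 (a i) y w u * a' i y v
      - d1 (a' i) y u v * a i y w - d1 (a' i) y v w * a i y u - d1 (a' i) y w u * a i y v) = 0 := by
  have h := A.pke.closed y hy u v w
  rw [d2, A.fderiv_kahler_form hy, A.fderiv_kahler_form hy, A.fderiv_kahler_form hy,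
    ← Finset.sum_add_distrib, ← Finset.sum_add_distrib] at h
  rw [← h]
  refine Finset.sum_congr rfl fun i _ => ?_
  simp only [d1]
  ring

/-- The values of `conn` are chosen so that the mixed components of both structure equations hold;
there they leave no freedom. Of the other components, those on `(e', e')` vanish by integrability,
and those on `(e, e)` follow from closedness of `ρ` evaluated on `e_k, e_l, e'_i`. The equation for
`a'` is the same with the two halves exchanged. -/
theorem d1_a (i : Fin 2) (u v : E4) :
    d1 (a i) y u v = - ∑ j, wedge (conn g a a' i j y) (a j y) u v := by
  have : d1L (a i) y = - ∑ j, wedgeL (conn g a a' i j y) (a j y) := by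
    refine (A.dual hy).bilin_ext ?_
    rintro (k | k) (l | l) <;>
      simp only [d1L_apply, neg_apply, sum_apply, wedgeL_apply, nullFrame, Sum.elim_inl,
        Sum.elim_inr, wedge, A.conn_e hy, A.conn_e' hy, A.a_e hy, A.a_e' hy, A.d1_a_e'_e' hy]
    · have := A.closed_coframe hy ((g y).inverse (a' k y)) ((g y).inverse (a' l y))
        ((g y).inverse (a i y))
      simp [A.a_e hy, A.a_e' hy, A.a'_e hy, A.a'_e' hy,
        d1_swap (a' _) y ((g y).inverse (a i y))] at this
      simp
      linarith
    · simp
    · simp [d1_swap (a i) y ((g y).inverse (a k y))]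
    · simp
  have := congrArg (fun B : E4 →L[ℝ] E4 →L[ℝ] ℝ => B u v) this
  simpa [d1L_apply, wedgeL_apply] using this

theorem d1_a' (i : Fin 2) (u v : E4) :
    d1 (a' i) y u v = ∑ j, wedge (conn g a a' j i y) (a' j y) u v := by
  have : d1L (a' i) y = ∑ j, wedgeL (conn g a a' j i y) (a' j y) := by
    refine (A.dual hy).bilin_ext ?_
    rintro (k | k) (l | l) <;>
      simp only [d1L_apply, sum_apply, wedgeL_apply, nullFrame, Sum.elim_inl,
        Sum.elim_inr, wedge, A.conn_e hy, A.conn_e' hy, A.a'_e hy, A.a'_e' hy, A.d1_a'_e_e hy]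
    · simp
    · simp
    · simp [d1_swap (a' i) y ((g y).inverse (a k y))]
    · have := A.closed_coframe hy ((g y).inverse (a k y)) ((g y).inverse (a l y))
        ((g y).inverse (a' i y))
      simp [A.a_e hy, A.a_e' hy, A.a'_e hy, A.a'_e' hy,
        d1_swap (a _) y ((g y).inverse (a l y))] at this
      rw [Finset.sum_sub_distrib]
      fin_cases k <;> fin_cases l <;> simp at this ⊢ <;> linarith
  have := congrArg (fun B : E4 →L[ℝ] E4 →L[ℝ] ℝ => B u v) this
  simpa [d1L_apply, wedgeL_apply] using this

omit hy

/-- The two structure equations are torsion-freeness. Metric compatibility is built into the blocks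
`γ` and `-γᵀ`, since the Gram matrix pairs the two halves with each other. -/
theorem isCartanFrame : IsCartanFrame s g nullGram (Sum.elim a a') (blockConn (conn g a a'))
    (fun b y => nullFrame (g y) (fun i => a i y) (fun i => a' i y) b) where
  isOpen := A.isOpen
  smooth_h := A.pke.smooth_g
  smooth_θ := by
    rintro (i | i)
    exacts [A.smooth_a i, A.smooth_a' i]
  smooth_σ := by
    rintro (i | i) (j | j)
    exacts [A.smooth_conn i j, contDiffOn_const, contDiffOn_const, (A.smooth_conn j i).neg]
  dual := fun y hy => by
    have := A.dual hy
    convert this using 2 with b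
    rcases b with b | b <;> rfl
  inv := fun y hy => A.isInvertible hy
  symm := by
    rintro (i | i) (j | j) <;> simp [nullGram, eq_comm]
  h_eq := fun y hy u v => by
    rw [(A.adapted y hy).metric]
    simp [nullGram, Finset.sum_add_distrib]
    ring
  dθ := fun y hy => by
    rintro (i | i) u v
    · simp [blockConn, A.d1_a hy, wedge]
    · simp [blockConn, A.d1_a' hy, wedge]
      ring
  compat := fun y hy => by
    rintro (i | i) (j | j) u <;> simp [nullGram, blockConn]

variable (hy : y ∈ s)
include hy

/-- The Riemann term pairs `e₁` with `R(e₃,e₄)e₂`, which lies in an off-diagonal curvature block and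
is zero. For an Einstein metric the Schouten tensor is `scal/24 · g`, and two of the four Schouten
terms survive, each contributing `-scal/24`. -/
theorem weyl4_nullFrame : weyl4 g y ((g y).inverse (a' 0 y)) ((g y).inverse (a' 1 y))
    ((g y).inverse (a 0 y)) ((g y).inverse (a 1 y)) = - scal g y / 12 := by
  have hg : ∀ α : E4 →L[ℝ] ℝ, g y ((g y).inverse α) = α := fun α =>
    apply_inverse_of_isInvertible (A.isInvertible hy) α
  have h1 := A.isCartanFrame.θ_riemann hy (Sum.inr 0) ((g y).inverse (a 0 y))
    ((g y).inverse (a 1 y)) ((g y).inverse (a' 1 y))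
  have h2 : curvForm (blockConn (conn g a a')) (Sum.inr 0) (Sum.inl 1) y ((g y).inverse (a 0 y))
      ((g y).inverse (a 1 y)) = 0 := by
    simp [curvForm, blockConn, wedge, d1]
  simp [A.a_e hy, A.a'_e hy, h2] at h1
  simp only [weyl4, hg, h1, schouten4, A.pke.einstein y hy, A.a_e hy, A.a'_e' hy]
  simp
  ring

theorem isAdaptedFrame : IsAdaptedFrame (g y) (K y) ((g y).inverse (a' 0 y))
    ((g y).inverse (a' 1 y)) ((g y).inverse (a 0 y)) ((g y).inverse (a 1 y)) := by
  have hg : ∀ α : E4 →L[ℝ] ℝ, g y ((g y).inverse α) = α := fun α =>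
    apply_inverse_of_isInvertible (A.isInvertible hy) α
  refine ⟨?_, ?_, ?_, ?_, ?_, ?_, ?_, ?_⟩
  iterate 4
    refine A.vec_ext hy (fun i => ?_) fun i => ?_ <;>
      simp [A.a_K hy, A.a'_K hy, A.a_e hy, A.a_e' hy, A.a'_e hy, A.a'_e' hy]
  all_goals simp [hg, A.a'_e' hy]

omit hy

theorem diffAt_conn (hy : y ∈ s) (i j : Fin 2) : DifferentiableAt ℝ (conn g a a' i j) y :=
  diffAt_of_contDiffOn (A.smooth_conn i j) A.isOpen hy

/-- The trace of `γ ∧ γ` vanishes by antisymmetry of the wedge product. -/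
theorem d1_trace_eq_curv (hy : y ∈ s) (u v : E4) :
    d1 (fun y => ∑ i, conn g a a' i i y) y u v
      = ∑ i, curvForm (blockConn (conn g a a')) (Sum.inl i) (Sum.inl i) y u v := by
  rw [d1_sum _ fun i _ => A.diffAt_conn hy i i]
  simp [curvForm, blockConn, wedge]
  ring

theorem ricci_pos (hy : y ∈ s) {u : E4} (hu : ∀ i, a' i y u = 0) (v : E4) :
    ricci g y u v = ∑ i, ∑ j, curvForm (blockConn (conn g a a')) (Sum.inl i) (Sum.inl j) y
      ((g y).inverse (a' i y)) v * a j y u := by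
  rw [A.isCartanFrame.ricci_eq hy]
  have h2 : ∀ i j v w, curvForm (blockConn (conn g a a')) (Sum.inr i) (Sum.inl j) y v w = 0 := by
    intro i j v w
    simp [curvForm, blockConn, wedge, d1]
  simp [h2, hu, nullFrame]

/-- The curvature of the trace connection. -/
theorem d1_trace (hy : y ∈ s) (u v : E4) :
    d1 (fun y => ∑ i, conn g a a' i i y) y u v
      = scal g y / 4 * ∑ i, wedge (a i y) (a' i y) u v := by
  -- The projection onto the `+1`-eigenspace of `K`.
  set P : E4 → E4 := fun u => ∑ i, a i y u • (g y).inverse (a' i y) with hP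
  have P0 : ∀ u i, a' i y (P u) = 0 := fun u i => by simp [hP, A.a'_e hy]
  have P1 : ∀ u i, a i y (P u) = a i y u := fun u i => by fin_cases i <;> simp [hP, A.a_e hy]
  have hsw : ∀ i j u v, curvForm (blockConn (conn g a a')) i j y u v
      = - curvForm (blockConn (conn g a a')) i j y v u := by
    intro i j u v
    simp only [curvForm, d1, wedge, Finset.sum_sub_distrib]
    ring
  -- Bianchi on `u, v, e_i`, in the component `i`, writes `Ω^i_i(u,v)` as a difference of two
  -- contractions with `e_i`. Summed over `i`, these are the two Ricci values by `ricci_pos`.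
  have key : ∑ i, curvForm (blockConn (conn g a a')) (Sum.inl i) (Sum.inl i) y u v
      = ricci g y (P u) v - ricci g y (P v) u := by
    rw [A.ricci_pos hy (P0 u), A.ricci_pos hy (P0 v), ← Finset.sum_sub_distrib]
    refine Finset.sum_congr rfl fun i _ => ?_
    have := A.isCartanFrame.curvForm_bianchi hy (Sum.inl i) u v ((g y).inverse (a' i y))
    have h2 : ∀ i j v w, curvForm (blockConn (conn g a a')) (Sum.inl i) (Sum.inr j) y v w = 0 := by
      intro i j v w
      simp [curvForm, blockConn, wedge, d1]
    simp only [Fintype.sum_sum_type, h2, zero_mul, Finset.sum_const_zero, add_zero,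
      Sum.elim_inl, A.a_e hy] at this
    simp only [P1]
    have h3 : ∑ j, curvForm (blockConn (conn g a a')) (Sum.inl i) (Sum.inl j) y v
        ((g y).inverse (a' i y)) * a j y u
        = - ∑ j, curvForm (blockConn (conn g a a')) (Sum.inl i) (Sum.inl j) y
        ((g y).inverse (a' i y)) v * a j y u := by
      rw [← Finset.sum_neg_distrib]
      exact Finset.sum_congr rfl fun j _ => by rw [hsw]; ring
    rw [h3] at this
    simp at this ⊢
    linarith
  rw [A.d1_trace_eq_curv hy, key, A.pke.einstein y hy, A.pke.einstein y hy,
    (A.adapted y hy).metric, (A.adapted y hy).metric, ← mul_sub, ← Finset.sum_sub_distrib]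
  congr 1
  refine Finset.sum_congr rfl fun i _ => ?_
  simp only [P0, P1, wedge]
  ring

end IsAdaptedOn

end ParaKE

/-! ### The para-Sasaki tensors on the line bundle and the differential of `β`. -/

namespace ParaKE

section Signature

variable {V : Type*} [NormedAddCommGroup V] [NormedSpace ℝ V]

theorem hasSignature_of_family [FiniteDimensional ℝ V] {B : V →L[ℝ] V →L[ℝ] ℝ} {p q : ℕ}
    (hd : Module.finrank ℝ V = p + q) (b : Fin p ⊕ Fin q → V) (hb : ∀ i j, B (b i) (b j)
      = if i = j then Sum.elim (fun _ => 1) (fun _ => -1) i else 0) : HasSignature B p q := by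
  have hli : LinearIndependent ℝ b := by
    rw [Fintype.linearIndependent_iff]
    intro c hc j
    have := congrArg (fun u => B u (b j)) hc
    simp only [map_sum, map_smul, sum_apply, smul_apply, hb, smul_eq_mul, mul_ite, mul_zero,
      Finset.sum_ite_eq', Finset.mem_univ, if_true, map_zero, zero_apply] at this
    rcases j with j | j <;> simpa using this
  refine ⟨Module.Basis.mk hli (hli.span_eq_top_of_card_eq_finrank' (by simp [hd])).ge,
    fun i j => ?_⟩
  simpa using hb i j

/-- The symmetric bilinear form `ε ∑ (αᵢ ⊗ α'ᵢ + α'ᵢ ⊗ αᵢ) + b ⊗ b`. -/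
def nullSum (ε : ℝ) (α α' : Fin 2 → V →L[ℝ] ℝ) (b : V →L[ℝ] ℝ) : V →L[ℝ] V →L[ℝ] ℝ :=
  ε • ∑ i, ((α i).smulRight (α' i) + (α' i).smulRight (α i)) + b.smulRight b

theorem nullSum_apply (ε : ℝ) (α α' : Fin 2 → V →L[ℝ] ℝ) (b : V →L[ℝ] ℝ) (u v : V) :
    nullSum ε α α' b u v = ε * ∑ i, (α i u * α' i v + α' i u * α i v) + b u * b v := by
  simp [nullSum]
  ring

theorem contDiffOn_nullSum (ε : ℝ) {α α' : Fin 2 → V → V →L[ℝ] ℝ} {b : V → V →L[ℝ] ℝ} {s : Set V}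
    (hα : ∀ i, ContDiffOn ℝ ∞ (α i) s) (hα' : ∀ i, ContDiffOn ℝ ∞ (α' i) s)
    (hb : ContDiffOn ℝ ∞ b s) :
    ContDiffOn ℝ ∞ (fun x => nullSum ε (fun i => α i x) (fun i => α' i x) (b x)) s :=
  (ContDiffOn.const_smul _ (ContDiffOn.sum fun i _ =>
    ((hα i).smulRight (hα' i)).add ((hα' i).smulRight (hα i)))).add (hb.smulRight hb)

end Signature

/-- The trace `γ¹₁ + γ²₂` of the connection form. -/
def traceConn (g : E4 → E4 →L[ℝ] E4 →L[ℝ] ℝ) (a a' : Fin 2 → E4 → E4 →L[ℝ] ℝ) (y : E4) :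
    E4 →L[ℝ] ℝ :=
  ∑ i, conn g a a' i i y

/-- The 1-form on the leaf space whose pullback is `Γ¹₁ + Γ²₂`. -/
def traceForm (g : E4 → E4 →L[ℝ] E4 →L[ℝ] ℝ) (a a' : Fin 2 → E4 → E4 →L[ℝ] ℝ) (z : X5) :
    X5 →L[ℝ] ℝ :=
  (traceConn g a a' z.1).comp (ContinuousLinearMap.fst ℝ _ _)
    - z.2⁻¹ • ContinuousLinearMap.snd ℝ _ _

/-- The para-Sasaki structure on the leaf space over an adapted coframe. -/
def sasaki (g : E4 → E4 →L[ℝ] E4 →L[ℝ] ℝ) (K : E4 → E4 →L[ℝ] E4)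
    (a a' : Fin 2 → E4 → E4 →L[ℝ] ℝ) (Ψ : ℝ) : ContactData X5 where
  φ := fun z => (ContinuousLinearMap.inl ℝ E4 ℝ).comp ((K z.1).comp (ContinuousLinearMap.fst ℝ _ _))
    + (ContinuousLinearMap.inr ℝ E4 ℝ).comp
      (z.2 • (traceConn g a a' z.1).comp ((K z.1).comp (ContinuousLinearMap.fst ℝ _ _)))
  ξ := fun z => (0, (6 * Ψ * √(3 / 2)) * z.2)
  β := fun z => (√(2 / 3) * (-1 / (6 * Ψ))) • traceForm g a a' z
  h := fun z => nullSum (1 / (12 * Ψ))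
    (fun i => (a i z.1).comp (ContinuousLinearMap.fst ℝ E4 ℝ))
    (fun i => (a' i z.1).comp (ContinuousLinearMap.fst ℝ E4 ℝ))
    ((√(2 / 3) * (-1 / (6 * Ψ))) • traceForm g a a' z)

/-- Horizontal lift to the leaf space. -/
def horLift (g : E4 → E4 →L[ℝ] E4 →L[ℝ] ℝ) (a a' : Fin 2 → E4 → E4 →L[ℝ] ℝ) (z : X5) :
    E4 →L[ℝ] X5 :=
  ContinuousLinearMap.inl ℝ E4 ℝ
    + (ContinuousLinearMap.inr ℝ E4 ℝ).comp (z.2 • traceConn g a a' z.1)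

/-- The `ℝ^*`-bundle over `s`. -/
def lineBundle (s : Set E4) : Set X5 := {z | z.1 ∈ s ∧ z.2 ≠ 0}

theorem sqrt_two_thirds : √(2 / 3 : ℝ) = √6 / 3 := by
  rw [show (2 / 3 : ℝ) = 6 / 3 ^ 2 by norm_num, Real.sqrt_div (by norm_num),
    Real.sqrt_sq (by norm_num)]

theorem sqrt_three_halves : √(3 / 2 : ℝ) = √6 / 2 := by
  rw [show (3 / 2 : ℝ) = 6 / 2 ^ 2 by norm_num, Real.sqrt_div (by norm_num),
    Real.sqrt_sq (by norm_num)]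

theorem sqrt_six_sq : √(6 : ℝ) ^ 2 = 6 := Real.sq_sqrt (by norm_num)

theorem finrank_X5 : Module.finrank ℝ X5 = 3 + 2 := by
  simp [X5, E4]

theorem isOpen_lineBundle {s : Set E4} (hs : IsOpen s) : IsOpen (lineBundle s) :=
  (hs.preimage continuous_fst).inter (isOpen_ne.preimage continuous_snd)

theorem contDiffOn_comp_fst {F : Type*} [NormedAddCommGroup F] [NormedSpace ℝ F] {s : Set E4}
    {f : E4 → F} (hf : ContDiffOn ℝ ∞ f s) :
    ContDiffOn ℝ ∞ (fun z : X5 => f z.1) (lineBundle s) :=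
  hf.comp contDiff_fst.contDiffOn fun _ hz => hz.1

namespace IsAdaptedOn

variable {s : Set E4} {g : E4 → E4 →L[ℝ] E4 →L[ℝ] ℝ} {K : E4 → E4 →L[ℝ] E4}
    {a a' : Fin 2 → E4 → E4 →L[ℝ] ℝ}

theorem traceForm_apply (z u : X5) :
    traceForm g a a' z u = traceConn g a a' z.1 u.1 - z.2⁻¹ * u.2 := by
  simp [traceForm]

theorem sasaki_φ (Ψ : ℝ) (z u : X5) : (sasaki g K a a' Ψ).φ z u
    = (K z.1 u.1, z.2 * traceConn g a a' z.1 (K z.1 u.1)) := by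
  simp [sasaki]

theorem sasaki_β (Ψ : ℝ) (z u : X5) : (sasaki g K a a' Ψ).β z u
    = √(2 / 3) * (-1 / (6 * Ψ)) * (traceConn g a a' z.1 u.1 - z.2⁻¹ * u.2) := by
  simp only [sasaki, smul_apply, smul_eq_mul, traceForm_apply]

theorem horLift_apply (z : X5) (w : E4) :
    horLift g a a' z w = (w, z.2 * traceConn g a a' z.1 w) := by
  simp [horLift]

theorem β_horLift (Ψ : ℝ) {z : X5} (hz : z.2 ≠ 0) (w : E4) :
    (sasaki g K a a' Ψ).β z (horLift g a a' z w) = 0 := by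
  rw [sasaki_β, horLift_apply]
  field_simp
  simp

theorem mem_eig_φ_one (Ψ : ℝ) {z u : X5} :
    u ∈ eigDist (sasaki g K a a' Ψ).φ 1 z ↔
      K z.1 u.1 = u.1 ∧ u.2 = z.2 * traceConn g a a' z.1 u.1 := by
  rw [eigDist, Module.End.mem_eigenspace_iff]
  simp only [ContinuousLinearMap.coe_coe, one_smul, sasaki_φ, Prod.ext_iff]
  constructor
  · rintro ⟨h1, h2⟩
    rw [h1] at h2
    exact ⟨h1, h2.symm⟩
  · rintro ⟨h1, h2⟩
    rw [h1]
    exact ⟨rfl, h2.symm⟩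

theorem mem_eig_φ_neg_one (Ψ : ℝ) {z u : X5} :
    u ∈ eigDist (sasaki g K a a' Ψ).φ (-1) z ↔
      K z.1 u.1 = -u.1 ∧ u.2 = z.2 * traceConn g a a' z.1 u.1 := by
  rw [eigDist, Module.End.mem_eigenspace_iff]
  simp only [ContinuousLinearMap.coe_coe, neg_smul, one_smul, sasaki_φ, Prod.ext_iff, Prod.fst_neg,
    Prod.snd_neg]
  constructor
  · rintro ⟨h1, h2⟩
    rw [h1, map_neg] at h2
    exact ⟨h1, by linarith⟩
  · rintro ⟨h1, h2⟩
    rw [h1, map_neg]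
    exact ⟨rfl, by linarith⟩

variable (A : IsAdaptedOn s g K a a')
include A

theorem sasaki_h (Ψ : ℝ) {z : X5} (hz : z ∈ lineBundle s) (u v : X5) :
    (sasaki g K a a' Ψ).h z u v = 1 / (12 * Ψ) * g z.1 u.1 v.1
      + (sasaki g K a a' Ψ).β z u * (sasaki g K a a' Ψ).β z v := by
  rw [(A.adapted z.1 hz.1).metric]
  exact nullSum_apply _ _ _ _ u v

theorem smooth_traceConn : ContDiffOn ℝ ∞ (traceConn g a a') s :=
  ContDiffOn.sum fun i _ => A.smooth_conn i i

theorem smooth_traceForm : ContDiffOn ℝ ∞ (traceForm g a a') (lineBundle s) :=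
  ((contDiffOn_comp_fst A.smooth_traceConn).clm_comp contDiffOn_const).sub
    ((contDiff_snd.contDiffOn.inv fun _ hz => hz.2).smul contDiffOn_const)

theorem smooth_β (Ψ : ℝ) : ContDiffOn ℝ ∞ (sasaki g K a a' Ψ).β (lineBundle s) :=
  A.smooth_traceForm.const_smul _

theorem smooth_lift_a (i : Fin 2) : ContDiffOn ℝ ∞
    (fun z : X5 => (a i z.1).comp (ContinuousLinearMap.fst ℝ E4 ℝ)) (lineBundle s) :=
  (contDiffOn_comp_fst (A.smooth_a i)).clm_comp contDiffOn_const

theorem smooth_lift_a' (i : Fin 2) : ContDiffOn ℝ ∞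
    (fun z : X5 => (a' i z.1).comp (ContinuousLinearMap.fst ℝ E4 ℝ)) (lineBundle s) :=
  (contDiffOn_comp_fst (A.smooth_a' i)).clm_comp contDiffOn_const

theorem smooth_h (Ψ : ℝ) : ContDiffOn ℝ ∞ (sasaki g K a a' Ψ).h (lineBundle s) := 
  contDiffOn_nullSum _ A.smooth_lift_a A.smooth_lift_a' (A.smooth_β Ψ)

theorem smooth_φ (Ψ : ℝ) : ContDiffOn ℝ ∞ (sasaki g K a a' Ψ).φ (lineBundle s) := by
  have hK : ContDiffOn ℝ ∞ (fun z : X5 => (K z.1).comp (ContinuousLinearMap.fst ℝ E4 ℝ))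
      (lineBundle s) := (contDiffOn_comp_fst A.pke.smooth_K).clm_comp contDiffOn_const
  exact (contDiffOn_const.clm_comp hK).add (contDiffOn_const.clm_comp
    (contDiff_snd.contDiffOn.smul ((contDiffOn_comp_fst A.smooth_traceConn).clm_comp hK)))

theorem d1_traceConn {Ψ : ℝ} (hs : ∀ y ∈ s, scal g y = -12 * Ψ) {y : E4} (hy : y ∈ s) (u v : E4) :
    d1 (traceConn g a a') y u v = -3 * Ψ * ∑ i, wedge (a i y) (a' i y) u v := by
  have := A.d1_trace hy u v
  rw [hs y hy] at this
  exact this.trans (by ring)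

/-- The term `dt/t` is closed, so only the curvature of the trace connection on the base remains. -/
theorem d1_traceForm {Ψ : ℝ} (hs : ∀ y ∈ s, scal g y = -12 * Ψ) {z : X5}
    (hz : z ∈ lineBundle s) (u v : X5) :
    d1 (traceForm g a a') z u v = -3 * Ψ * ∑ i, wedge (a i z.1) (a' i z.1) u.1 v.1 := by
  have h1 : DifferentiableAt ℝ (traceConn g a a') z.1 :=
    diffAt_of_contDiffOn A.smooth_traceConn A.isOpen hz.1
  have h2 : DifferentiableAt ℝ (fun z : X5 => (traceConn g a a' z.1).comp
      (ContinuousLinearMap.fst ℝ E4 ℝ)) z :=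
    DifferentiableAt.clm_comp (h1.comp z differentiableAt_fst) (differentiableAt_const _)
  have h3 : DifferentiableAt ℝ (fun z : X5 => z.2⁻¹) z := differentiableAt_snd.inv hz.2
  have h4 : fderiv ℝ (fun z : X5 => z.2⁻¹) z
      = (-(z.2 ^ 2)⁻¹) • ContinuousLinearMap.snd ℝ E4 ℝ := by
    have := (hasDerivAt_inv hz.2).comp_hasFDerivAt z
      (hasFDerivAt_snd (𝕜 := ℝ) (E := E4) (F := ℝ) (p := z))
    exact this.fderiv
  have e1 : d1 (fun z : X5 => z.2⁻¹ • ContinuousLinearMap.snd ℝ E4 ℝ) z u v = 0 := by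
    rw [d1_smul h3 (differentiableAt_const _), h4]
    simp [d1, wedge]
    ring
  have e2 : d1 (fun z : X5 => (traceConn g a a' z.1).comp (ContinuousLinearMap.fst ℝ E4 ℝ)) z u v
      = d1 (traceConn g a a') z.1 u.1 v.1 :=
    d1_comp_clm (ContinuousLinearMap.fst ℝ E4 ℝ) (x := z) h1 u v
  have := d1_sub h2 (h3.smul (differentiableAt_const (ContinuousLinearMap.snd ℝ E4 ℝ))) u v
  change d1 (traceForm g a a') z u v = _ at this
  rw [this, e2, A.d1_traceConn hs hz.1]
  exact (congrArg (fun t => _ - t) e1).trans (sub_zero _)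

/-- The factor `-3Ψ` cancels against `-1/(6Ψ)`, leaving `√(2/3)/2 = √6/6`; the result no longer
involves `Ψ`. -/
theorem d1_β {Ψ : ℝ} (hΨ : Ψ ≠ 0) (hs : ∀ y ∈ s, scal g y = -12 * Ψ) {z : X5}
    (hz : z ∈ lineBundle s) (u v : X5) :
    d1 (sasaki g K a a' Ψ).β z u v = √6 / 6 * ∑ i, wedge (a i z.1) (a' i z.1) u.1 v.1 := by
  have := d1_const_smul (diffAt_of_contDiffOn A.smooth_traceForm (isOpen_lineBundle A.isOpen) hz)
    (√(2 / 3) * (-1 / (6 * Ψ))) u v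
  refine this.trans ?_
  rw [A.d1_traceForm hs hz, sqrt_two_thirds]
  field_simp

end IsAdaptedOn

end ParaKE

/-! ### Connection, curvature and Ricci tensor of the para-Sasaki metric. -/

namespace ParaKE

/-- Pullback of a 1-form from the base to the line bundle. -/
def liftForm (α : E4 → E4 →L[ℝ] ℝ) (z : X5) : X5 →L[ℝ] ℝ :=
  (α z.1).comp (ContinuousLinearMap.fst ℝ E4 ℝ)

theorem liftForm_apply (α : E4 → E4 →L[ℝ] ℝ) (z u : X5) : liftForm α z u = α z.1 u.1 := rfl

/-- The sign `±1` of `K` on the two halves of an adapted coframe. -/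
def nullSign : Fin 2 ⊕ Fin 2 → ℝ := Sum.elim (fun _ => 1) fun _ => -1

/-- The coframe `(θ¹, θ², θ³, θ⁴, β)` of the para-Sasaki structure. -/
def sasakiCoframe (g : E4 → E4 →L[ℝ] E4 →L[ℝ] ℝ) (K : E4 → E4 →L[ℝ] E4)
    (a a' : Fin 2 → E4 → E4 →L[ℝ] ℝ) (Ψ : ℝ) :
    (Fin 2 ⊕ Fin 2) ⊕ Unit → X5 → X5 →L[ℝ] ℝ
  | .inl b => liftForm (Sum.elim a a' b)
  | .inr _ => (sasaki g K a a' Ψ).β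

/-- The frame dual to `sasakiCoframe`. -/
def sasakiFrame (g : E4 → E4 →L[ℝ] E4 →L[ℝ] ℝ) (K : E4 → E4 →L[ℝ] E4)
    (a a' : Fin 2 → E4 → E4 →L[ℝ] ℝ) (Ψ : ℝ) : (Fin 2 ⊕ Fin 2) ⊕ Unit → X5 → X5
  | .inl b => fun z => horLift g a a' z
      (nullFrame (g z.1) (fun i => a i z.1) (fun i => a' i z.1) b)
  | .inr _ => (sasaki g K a a' Ψ).ξ

/-- The coefficients of the para-Sasaki metric in `sasakiCoframe`. -/
def sasakiGram (Ψ : ℝ) : (Fin 2 ⊕ Fin 2) ⊕ Unit → (Fin 2 ⊕ Fin 2) ⊕ Unit → ℝ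
  | .inl b, .inl c => 1 / (12 * Ψ) * nullGram b c
  | .inr _, .inr _ => 1
  | _, _ => 0

/-- The Levi-Civita connection form of the para-Sasaki metric in `sasakiCoframe`. -/
def sasakiConn (g : E4 → E4 →L[ℝ] E4 →L[ℝ] ℝ) (K : E4 → E4 →L[ℝ] E4)
    (a a' : Fin 2 → E4 → E4 →L[ℝ] ℝ) (Ψ : ℝ) :
    (Fin 2 ⊕ Fin 2) ⊕ Unit → (Fin 2 ⊕ Fin 2) ⊕ Unit → X5 → X5 →L[ℝ] ℝ
  | .inl b, .inl c => fun z => liftForm (blockConn (conn g a a') b c) z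
      + (if b = c then √6 * Ψ * nullSign b else 0) • (sasaki g K a a' Ψ).β z
  | .inl b, .inr _ => fun z => (√6 * Ψ * nullSign b) • liftForm (Sum.elim a a' b) z
  | .inr _, .inl (.inl i) => fun z => (√6 / 12) • liftForm (a' i) z
  | .inr _, .inl (.inr i) => fun z => (-√6 / 12) • liftForm (a i) z
  | .inr _, .inr _ => fun _ => 0

theorem sum_sum_unit {ι : Type*} [Fintype ι] (f : ι ⊕ Unit → ι ⊕ Unit → ℝ) :
    ∑ x, ∑ y, f x y = ∑ b, ∑ c, f (.inl b) (.inl c) + ∑ b, f (.inl b) (.inr ())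
      + ∑ c, f (.inr ()) (.inl c) + f (.inr ()) (.inr ()) := by
  simp [Fintype.sum_sum_type, Finset.sum_add_distrib]
  ring

namespace IsAdaptedOn

variable {s : Set E4} {g : E4 → E4 →L[ℝ] E4 →L[ℝ] ℝ} {K : E4 → E4 →L[ℝ] E4}
    {a a' : Fin 2 → E4 → E4 →L[ℝ] ℝ}

theorem ξ_eq (Ψ : ℝ) (z : X5) : (sasaki g K a a' Ψ).ξ z = (0, (6 * Ψ * √(3 / 2)) * z.2) := rfl

theorem β_ξ {Ψ : ℝ} (hΨ : Ψ ≠ 0) {z : X5} (hz : z.2 ≠ 0) :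
    (sasaki g K a a' Ψ).β z ((sasaki g K a a' Ψ).ξ z) = 1 := by
  rw [sasaki_β, ξ_eq, sqrt_two_thirds, sqrt_three_halves]
  field_simp
  simp only [map_zero]
  linear_combination 6 * Ψ * sqrt_six_sq

theorem horLift_add_ξ {Ψ : ℝ} (hΨ : Ψ ≠ 0) {z : X5} (hz : z.2 ≠ 0) (u : X5) :
    horLift g a a' z u.1 + (sasaki g K a a' Ψ).β z u • (sasaki g K a a' Ψ).ξ z = u := by
  rw [sasaki_β, ξ_eq, horLift_apply, sqrt_two_thirds, sqrt_three_halves]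
  ext1
  · simp
  · simp
    field_simp
    linear_combination (u.2 - z.2 * traceConn g a a' z.1 u.1) * sqrt_six_sq

theorem d1_liftForm {α : E4 → E4 →L[ℝ] ℝ} {z : X5} (h : DifferentiableAt ℝ α z.1) (u v : X5) :
    d1 (liftForm α) z u v = d1 α z.1 u.1 v.1 :=
  d1_comp_clm (ContinuousLinearMap.fst ℝ E4 ℝ) (x := z) h u v

theorem smooth_liftForm {α : E4 → E4 →L[ℝ] ℝ} (h : ContDiffOn ℝ ∞ α s) :
    ContDiffOn ℝ ∞ (liftForm α) (lineBundle s) :=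
  (contDiffOn_comp_fst h).clm_comp contDiffOn_const

theorem diffAt_liftForm {α : E4 → E4 →L[ℝ] ℝ} {z : X5} (h : DifferentiableAt ℝ α z.1) :
    DifferentiableAt ℝ (liftForm α) z :=
  DifferentiableAt.clm_comp (h.comp z differentiableAt_fst) (differentiableAt_const _)

theorem curvForm_sasaki_inr_inr (Ψ : ℝ) (z u v : X5) :
    curvForm (sasakiConn g K a a' Ψ) (.inr ()) (.inr ()) z u v = 0 := by
  simp [curvForm, sasakiConn, d1, wedge, Fintype.sum_sum_type, liftForm_apply, nullSign]
  ring

variable (A : IsAdaptedOn s g K a a')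
include A

theorem sasaki_dual {Ψ : ℝ} (hΨ : Ψ ≠ 0) {z : X5} (hz : z ∈ lineBundle s) :
    IsDualFrame (fun b => sasakiCoframe g K a a' Ψ b z)
      (fun b => sasakiFrame g K a a' Ψ b z) where
  pair := by
    rintro (b | b) (c | c)
    · have := (A.isCartanFrame.dual z.1 hz.1).pair b c
      simpa [sasakiCoframe, sasakiFrame, liftForm_apply, horLift_apply] using this
    · simp [sasakiCoframe, sasakiFrame, liftForm_apply, ξ_eq]
    · simp [sasakiCoframe, sasakiFrame, β_horLift Ψ hz.2]
    · simp [sasakiCoframe, sasakiFrame, β_ξ hΨ hz.2]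
  complete := fun u => by
    have := (A.isCartanFrame.dual z.1 hz.1).complete u.1
    rw [Fintype.sum_sum_type]
    simp only [sasakiCoframe, sasakiFrame, liftForm_apply, ← map_smul, ← map_sum, this,
      Finset.univ_unique, Finset.sum_singleton]
    exact horLift_add_ξ hΨ hz.2 u

theorem sasaki_h_nondegenerate {Ψ : ℝ} (hΨ : Ψ ≠ 0) {z : X5} (hz : z ∈ lineBundle s) (u : X5)
    (hu : ∀ v, (sasaki g K a a' Ψ).h z u v = 0) : u = 0 := by
  have h1 : (sasaki g K a a' Ψ).β z u = 0 := by
    have := hu ((sasaki g K a a' Ψ).ξ z)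
    rw [A.sasaki_h Ψ hz, β_ξ hΨ hz.2] at this
    simpa [ξ_eq] using this
  have h2 : u.1 = 0 := by
    refine (A.pke.signature z.1 hz.1).eq_zero fun w => ?_
    have := hu (w, 0)
    rw [A.sasaki_h Ψ hz, h1] at this
    simpa [hΨ] using this
  have := horLift_add_ξ (g := g) (K := K) (a := a) (a' := a') hΨ hz.2 u
  rw [← this, h1, h2]
  simp

theorem diffAt_coframe {y : E4} (hy : y ∈ s) (b : Fin 2 ⊕ Fin 2) :
    DifferentiableAt ℝ (Sum.elim a a' b) y :=
  diffAt_of_contDiffOn (A.isCartanFrame.smooth_θ b) A.isOpen hy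

/-- The coefficients of `sasakiConn` are forced. The row of `β` must reproduce `dβ = (√6/6) Σ aᵢ ∧
a'ᵢ`, and splitting this equally between `a` and `a'` gives `±√6/12`. Compatibility with the Gram
matrix `1/(12Ψ)` then gives the column entries `√6 Ψ ε_b θ^b`, where `ε` is `nullSign`. Since the
forms `θ^b` come from the base, the resulting torsion `θ^b ∧ β` has to be cancelled by the multiple
`√6 Ψ ε_b` of `β` on the diagonal. -/
theorem sasaki_isCartanFrame {Ψ : ℝ} (hΨ : Ψ ≠ 0) (hs : ∀ y ∈ s, scal g y = -12 * Ψ) :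
    IsCartanFrame (lineBundle s) (sasaki g K a a' Ψ).h (sasakiGram Ψ) (sasakiCoframe g K a a' Ψ)
      (sasakiConn g K a a' Ψ) (sasakiFrame g K a a' Ψ) where
  isOpen := isOpen_lineBundle A.isOpen
  smooth_h := A.smooth_h Ψ
  smooth_θ := by
    rintro (b | b)
    exacts [smooth_liftForm (A.isCartanFrame.smooth_θ b), A.smooth_β Ψ]
  smooth_σ := by
    rintro (b | b) (c | c)
    · exact (smooth_liftForm (A.isCartanFrame.smooth_σ b c)).add ((A.smooth_β Ψ).const_smul _)
    · exact (smooth_liftForm (A.isCartanFrame.smooth_θ b)).const_smul _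
    · rcases c with c | c
      exacts [(smooth_liftForm (A.smooth_a' c)).const_smul _,
        (smooth_liftForm (A.smooth_a c)).const_smul _]
    · exact contDiffOn_const
  dual := fun z hz => A.sasaki_dual hΨ hz
  inv := fun z hz => isInvertible_of_nondegenerate (A.sasaki_h_nondegenerate hΨ hz)
  symm := by
    rintro (b | b) (c | c)
    · simp [sasakiGram, A.isCartanFrame.symm b c]
    all_goals rfl
  h_eq := fun z hz u v => by
    rw [A.sasaki_h Ψ hz, A.isCartanFrame.h_eq z.1 hz.1]
    simp only [Fintype.sum_sum_type, sasakiGram, sasakiCoframe, liftForm_apply]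
    simp
    ring
  dθ := fun z hz => by
    rintro ((i | i) | b) u v
    · have := d1_liftForm (A.diffAt_a hz.1 i) u v
      simp only [sasakiCoframe, Sum.elim_inl, this, A.d1_a hz.1, Fintype.sum_sum_type, sasakiConn]
      fin_cases i <;> simp [wedge, blockConn, liftForm_apply, nullSign] <;> ring
    · have := d1_liftForm (A.diffAt_a' hz.1 i) u v
      simp only [sasakiCoframe, Sum.elim_inr, this, A.d1_a' hz.1, Fintype.sum_sum_type, sasakiConn]
      fin_cases i <;> simp [wedge, blockConn, liftForm_apply, nullSign] <;> ring
    · simp only [sasakiCoframe, A.d1_β hΨ hs hz, Fintype.sum_sum_type, sasakiConn]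
      simp [wedge, liftForm_apply]
      ring
  compat := fun z hz => by
    rintro ((i | i) | b) ((j | j) | c) u <;>
      simp [sasakiGram, sasakiConn, nullGram, blockConn, liftForm_apply, Fintype.sum_sum_type,
        nullSign]
    · fin_cases i <;> fin_cases j <;> simp <;> ring
    · field_simp
      ring
    · fin_cases i <;> fin_cases j <;> simp <;> ring
    all_goals
      field_simp
      ring

variable {Ψ : ℝ} {z : X5} (hz : z ∈ lineBundle s)
include hz

/-- The base connection terms cancel by the first structure equation, because `blockConn` only
relates indices of equal sign. What is left is `(√6 Ψ ε_b)² β ∧ θ^b` with `ε_b² = 1`. -/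
theorem curvForm_sasaki_right (b : Fin 2 ⊕ Fin 2) (u v : X5) :
    curvForm (sasakiConn g K a a' Ψ) (.inl b) (.inr ()) z u v
      = 6 * Ψ ^ 2 * wedge ((sasaki g K a a' Ψ).β z) (liftForm (Sum.elim a a' b) z) u v := by
  have h0 := A.diffAt_coframe hz.1 b
  have e1 : d1 (sasakiConn g K a a' Ψ (.inl b) (.inr ())) z u v
      = √6 * Ψ * nullSign b * d1 (Sum.elim a a' b) z.1 u.1 v.1 := by
    rw [← d1_liftForm h0]
    exact d1_const_smul (diffAt_liftForm h0) _ u v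
  rw [curvForm, e1, A.isCartanFrame.dθ z.1 hz.1]
  have h6 := sqrt_six_sq
  rcases b with b | b <;> fin_cases b <;>
    simp [sasakiConn, wedge, blockConn, liftForm_apply, nullSign, Fintype.sum_sum_type] <;>
    ring_nf <;> rw [h6] <;> ring

theorem curvForm_sasaki_left (c : Fin 2 ⊕ Fin 2) (u v : X5) :
    curvForm (sasakiConn g K a a' Ψ) (.inr ()) (.inl c) z u v
      = Ψ / 2 * ∑ d, nullGram c d *
        wedge (liftForm (Sum.elim a a' d) z) ((sasaki g K a a' Ψ).β z) u v := by
  have h6 := sqrt_six_sq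
  rcases c with c | c
  · have h0 := A.diffAt_a' hz.1 c
    have e1 : d1 (sasakiConn g K a a' Ψ (.inr ()) (.inl (.inl c))) z u v
        = √6 / 12 * d1 (a' c) z.1 u.1 v.1 := by
      rw [← d1_liftForm h0]
      exact d1_const_smul (diffAt_liftForm h0) _ u v
    rw [curvForm, e1, A.d1_a' hz.1]
    fin_cases c <;>
    simp [sasakiConn, wedge, blockConn, liftForm_apply, nullSign, nullGram,
      Fintype.sum_sum_type] <;> ring_nf <;> rw [h6] <;> ring
  · have h0 := A.diffAt_a hz.1 c
    have e1 : d1 (sasakiConn g K a a' Ψ (.inr ()) (.inl (.inr c))) z u v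
        = -√6 / 12 * d1 (a c) z.1 u.1 v.1 := by
      rw [← d1_liftForm h0]
      exact d1_const_smul (diffAt_liftForm h0) _ u v
    rw [curvForm, e1, A.d1_a hz.1]
    fin_cases c <;>
    simp [sasakiConn, wedge, blockConn, liftForm_apply, nullSign, nullGram,
      Fintype.sum_sum_type] <;> ring_nf <;> rw [h6] <;> ring

variable (hΨ : Ψ ≠ 0) (hs : ∀ y ∈ s, scal g y = -12 * Ψ)
include hΨ hs

/-- Three contributions: the curvature of the base, the diagonal multiple of `dβ`, and the product
of the column and row entries belonging to `β`. -/
theorem curvForm_sasaki_block (b c : Fin 2 ⊕ Fin 2) (u v : X5) :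
    curvForm (sasakiConn g K a a' Ψ) (.inl b) (.inl c) z u v
      = curvForm (blockConn (conn g a a')) b c z.1 u.1 v.1
        + (if b = c then √6 * Ψ * nullSign b else 0)
          * (√6 / 6 * ∑ i, wedge (a i z.1) (a' i z.1) u.1 v.1)
        + √6 * Ψ * nullSign b * wedge (liftForm (Sum.elim a a' b) z)
          (sasakiConn g K a a' Ψ (.inr ()) (.inl c) z) u v := by
  have h0 : DifferentiableAt ℝ (blockConn (conn g a a') b c) z.1 :=
    diffAt_of_contDiffOn (A.isCartanFrame.smooth_σ b c) A.isOpen hz.1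
  have hβ : DifferentiableAt ℝ (sasaki g K a a' Ψ).β z :=
    diffAt_of_contDiffOn (A.smooth_β Ψ) (isOpen_lineBundle A.isOpen) hz
  have e1 : d1 (sasakiConn g K a a' Ψ (.inl b) (.inl c)) z u v
      = d1 (blockConn (conn g a a') b c) z.1 u.1 v.1
        + (if b = c then √6 * Ψ * nullSign b else 0)
          * (√6 / 6 * ∑ i, wedge (a i z.1) (a' i z.1) u.1 v.1) := by
    set k : ℝ := if b = c then √6 * Ψ * nullSign b else 0 with hk
    have h1 : DifferentiableAt ℝ (fun z => k • (sasaki g K a a' Ψ).β z) z := hβ.const_smul k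
    have e := d1_add (diffAt_liftForm h0) h1 u v
    rw [d1_liftForm h0, d1_const_smul hβ, A.d1_β hΨ hs hz] at e
    exact e
  -- The diagonal multiples of `β` form a matrix commuting with the block diagonal `blockConn`, so
  -- the terms containing `β` drop out of `σ ∧ σ`.
  have e2 : ∑ d, wedge (sasakiConn g K a a' Ψ (.inl b) (.inl d) z)
      (sasakiConn g K a a' Ψ (.inl d) (.inl c) z) u v
      = ∑ d, wedge (blockConn (conn g a a') b d z.1) (blockConn (conn g a a') d c z.1) u.1 v.1 := by
    have hk : ∀ u, (nullSign c - nullSign b) * blockConn (conn g a a') b c z.1 u = 0 := by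
      intro u
      rcases b with b | b <;> rcases c with c | c <;> simp [nullSign, blockConn]
    simp only [wedge, sasakiConn, add_apply, smul_apply, smul_eq_mul, liftForm_apply, ite_mul,
      zero_mul, mul_add, add_mul, mul_ite, mul_zero, Finset.sum_sub_distrib,
      Finset.sum_add_distrib, Finset.sum_ite_eq, Finset.sum_ite_eq', Finset.mem_univ, if_true]
    by_cases hbc : b = c
    · subst hbc
      simp
      ring
    · simp only [hbc, if_false]
      linear_combination √6 * Ψ * ((sasaki g K a a' Ψ).β z v * hk u.1
        - (sasaki g K a a' Ψ).β z u * hk v.1)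
  rw [curvForm, e1, Fintype.sum_sum_type, e2, curvForm]
  simp [sasakiConn, wedge]
  ring

theorem sasaki_ricci (v w : X5) :
    ricci (sasaki g K a a' Ψ).h z v w = -24 * Ψ ^ 2 * (sasaki g K a a' Ψ).h z v w := by
  have h6 := sqrt_six_sq
  have hg := A.isCartanFrame.ricci_eq hz.1 v.1 w.1
  rw [A.pke.einstein z.1 hz.1, hs z.1 hz.1] at hg
  have hG := (A.adapted z.1 hz.1).metric v.1 w.1
  rw [(A.sasaki_isCartanFrame hΨ hs).ricci_eq hz, A.sasaki_h Ψ hz]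
  have hf : ∀ b, (sasakiFrame g K a a' Ψ (.inl b) z).1
      = nullFrame (g z.1) (fun i => a i z.1) (fun i => a' i z.1) b := fun b => by
    simp [sasakiFrame, horLift_apply]
  have hβ : ∀ b, (sasaki g K a a' Ψ).β z (sasakiFrame g K a a' Ψ (.inl b) z) = 0 := fun b =>
    β_horLift Ψ hz.2 _
  have hβ' : (sasaki g K a a' Ψ).β z (sasakiFrame g K a a' Ψ (.inr ()) z) = 1 := β_ξ hΨ hz.2
  have hf' : (sasakiFrame g K a a' Ψ (.inr ()) z).1 = 0 := rfl
  have a1 := A.a_e hz.1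
  have a2 := A.a_e' hz.1
  have a3 := A.a'_e hz.1
  have a4 := A.a'_e' hz.1
  -- Base Ricci, `-3Ψ g`, plus the corrections of `curvForm_sasaki_block`. With `T3` the horizontal
  -- total is `-2Ψ g`, while `T2` collects four equal vertical contributions `-6Ψ²`.
  have T1 : ∑ b, ∑ c, curvForm (sasakiConn g K a a' Ψ) (.inl b) (.inl c) z
      (sasakiFrame g K a a' Ψ (.inl b) z) w * liftForm (Sum.elim a a' c) z v
      = -12 * Ψ / 4 * g z.1 v.1 w.1 + 3 / 2 * Ψ * g z.1 v.1 w.1 := by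
    rw [hg]
    simp only [A.curvForm_sasaki_block hz hΨ hs, hf, add_mul, Finset.sum_add_distrib, add_assoc]
    congr 1
    rw [hG]
    simp [Fintype.sum_sum_type, wedge, liftForm_apply, sasakiConn, hf, nullFrame, a1, a2, a3, a4,
      nullSign]
    ring_nf
    rw [h6]
    ring
  have T2 : ∑ b, curvForm (sasakiConn g K a a' Ψ) (.inl b) (.inr ()) z
      (sasakiFrame g K a a' Ψ (.inl b) z) w * (sasaki g K a a' Ψ).β z v
      = -24 * Ψ ^ 2 * ((sasaki g K a a' Ψ).β z v * (sasaki g K a a' Ψ).β z w) := by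
    simp [A.curvForm_sasaki_right hz, Fintype.sum_sum_type, wedge, liftForm_apply, hf, nullFrame,
      a1, a4, hβ]
    ring
  have T3 : ∑ c, curvForm (sasakiConn g K a a' Ψ) (.inr ()) (.inl c) z
      (sasakiFrame g K a a' Ψ (.inr ()) z) w * liftForm (Sum.elim a a' c) z v
      = - (Ψ / 2) * g z.1 v.1 w.1 := by
    rw [hG]
    simp [A.curvForm_sasaki_left hz, Fintype.sum_sum_type, wedge, liftForm_apply, hf', hβ',
      nullGram]
    ring
  have split : ∑ x, ∑ y, curvForm (sasakiConn g K a a' Ψ) x y z (sasakiFrame g K a a' Ψ x z) w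
      * sasakiCoframe g K a a' Ψ y z v = (-12 * Ψ / 4 * g z.1 v.1 w.1 + 3 / 2 * Ψ * g z.1 v.1 w.1)
      + -24 * Ψ ^ 2 * ((sasaki g K a a' Ψ).β z v * (sasaki g K a a' Ψ).β z w)
      + - (Ψ / 2) * g z.1 v.1 w.1 := by
    rw [← T1, ← T2, ← T3, sum_sum_unit, curvForm_sasaki_inr_inr, zero_mul, add_zero]
    rfl
  rw [split]
  field_simp
  ring

end IsAdaptedOn

end ParaKE

/-! ### Signature, integrability and the remaining para-Sasaki conditions. -/

namespace ParaKE

namespace IsAdaptedOn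

variable {s : Set E4} {g : E4 → E4 →L[ℝ] E4 →L[ℝ] ℝ} {K : E4 → E4 →L[ℝ] E4}
    {a a' : Fin 2 → E4 → E4 →L[ℝ] ℝ}

theorem horLift_injective (z : X5) : Function.Injective (horLift g a a' z) := fun u v h => by
  simpa [horLift_apply] using congrArg Prod.fst h

/-- The image of `φ` consists of horizontal lifts, so an eigenvector with eigenvalue `±1` is
horizontal, and on lifts `φ` acts as `K`. Ranks on the line bundle thus reduce to those on the base.
-/
theorem eig_φ_eq_map (Ψ : ℝ) (z : X5) {c : ℝ} (hc : c = 1 ∨ c = -1) :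
    eigDist (sasaki g K a a' Ψ).φ c z
      = (eigDist K c z.1).map (horLift g a a' z : E4 →ₗ[ℝ] X5) := by
  ext u
  have hK : ∀ w, w ∈ eigDist K c z.1 ↔ K z.1 w = c • w := fun w => by
    rw [eigDist, Module.End.mem_eigenspace_iff]; rfl
  simp only [Submodule.mem_map, hK, ContinuousLinearMap.coe_coe, horLift_apply]
  have hu : u ∈ eigDist (sasaki g K a a' Ψ).φ c z ↔
      K z.1 u.1 = c • u.1 ∧ u.2 = z.2 * traceConn g a a' z.1 u.1 := by
    rcases hc with rfl | rfl
    · rw [mem_eig_φ_one, one_smul]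
    · rw [mem_eig_φ_neg_one, neg_one_smul]
  rw [hu]
  constructor
  · rintro ⟨h1, h2⟩
    exact ⟨u.1, h1, Prod.ext rfl h2.symm⟩
  · rintro ⟨w, h1, rfl⟩
    exact ⟨h1, rfl⟩

theorem finrank_eig_φ (Ψ : ℝ) (z : X5) {c : ℝ} (hc : c = 1 ∨ c = -1) :
    Module.finrank ℝ (eigDist (sasaki g K a a' Ψ).φ c z) = Module.finrank ℝ (eigDist K c z.1) := by
  rw [eig_φ_eq_map Ψ z hc]
  exact (LinearEquiv.finrank_eq (Submodule.equivMapOfInjective _ (horLift_injective z) _)).symm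

theorem β_eq_zero_of_mem_eig {Ψ : ℝ} {z : X5} (hz : z.2 ≠ 0) {c : ℝ} (hc : c = 1 ∨ c = -1) {u : X5}
    (hu : u ∈ eigDist (sasaki g K a a' Ψ).φ c z) : (sasaki g K a a' Ψ).β z u = 0 := by
  rw [eig_φ_eq_map Ψ z hc] at hu
  obtain ⟨w, -, rfl⟩ := hu
  exact β_horLift Ψ hz w

theorem mem_eig_φ_of_β {Ψ : ℝ} (hΨ : Ψ ≠ 0) {z : X5} (hz : z.2 ≠ 0) {c : ℝ} (hc : c = 1 ∨ c = -1)
    {u : X5} (hu : u.1 ∈ eigDist K c z.1) (hβ : (sasaki g K a a' Ψ).β z u = 0) :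
    u ∈ eigDist (sasaki g K a a' Ψ).φ c z := by
  rw [eig_φ_eq_map Ψ z hc]
  refine ⟨u.1, hu, ?_⟩
  have := horLift_add_ξ (g := g) (K := K) (a := a) (a' := a') hΨ hz u
  rwa [hβ, zero_smul, add_zero] at this

theorem fst_mem_of_mem_eig {Ψ : ℝ} {z : X5} {c : ℝ} (hc : c = 1 ∨ c = -1)
    {u : X5} (hu : u ∈ eigDist (sasaki g K a a' Ψ).φ c z) : u.1 ∈ eigDist K c z.1 := by
  rw [eig_φ_eq_map Ψ z hc] at hu
  obtain ⟨w, hw, rfl⟩ := hu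
  simpa [horLift_apply] using hw

theorem sasaki_β_φ {Ψ : ℝ} {z : X5} (hz : z.2 ≠ 0) (u : X5) :
    (sasaki g K a a' Ψ).β z ((sasaki g K a a' Ψ).φ z u) = 0 := by
  rw [sasaki_φ, ← horLift_apply, β_horLift Ψ hz]

variable (A : IsAdaptedOn s g K a a')
include A

/-- Horizontal lifts of an orthonormal basis of `g`, scaled by `√|12Ψ|`, together with the unit
vector `ξ`, diagonalize `h`. For negative `Ψ` the positive and negative vectors of `g` change roles.
Since `(2,2)` is symmetric, `ξ` makes it `(3,2)` for either sign. -/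
theorem sasaki_signature {Ψ : ℝ} (hΨ : Ψ ≠ 0) {z : X5} (hz : z ∈ lineBundle s) :
    HasSignature ((sasaki g K a a' Ψ).h z) 3 2 := by
  obtain ⟨b, hb⟩ := A.pke.signature z.1 hz.1
  have e1 : ∀ u v, (sasaki g K a a' Ψ).h z (horLift g a a' z u) (horLift g a a' z v)
      = 1 / (12 * Ψ) * g z.1 u v := fun u v => by
    rw [A.sasaki_h Ψ hz, β_horLift Ψ hz.2, horLift_apply, horLift_apply]
    ring
  have e2 : ∀ u, (sasaki g K a a' Ψ).h z ((sasaki g K a a' Ψ).ξ z) (horLift g a a' z u) = 0 :=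
    fun u => by
      rw [A.sasaki_h Ψ hz, β_horLift Ψ hz.2, ξ_eq]
      simp
  have e3 : ∀ u, (sasaki g K a a' Ψ).h z (horLift g a a' z u) ((sasaki g K a a' Ψ).ξ z) = 0 :=
    fun u => by
      rw [A.sasaki_h Ψ hz, β_horLift Ψ hz.2, ξ_eq]
      simp
  have e4 : (sasaki g K a a' Ψ).h z ((sasaki g K a a' Ψ).ξ z) ((sasaki g K a a' Ψ).ξ z) = 1 := by
    rw [A.sasaki_h Ψ hz, β_ξ hΨ hz.2, ξ_eq]
    simp
  rcases lt_or_gt_of_ne hΨ with h | h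
  · set r := √(-(12 * Ψ)) with hr
    have hr2 : r * r = -(12 * Ψ) := Real.mul_self_sqrt (by linarith)
    have hm : ∀ t : ℝ, r * (r * (1 / (12 * Ψ) * t)) = -t := fun t => by
      rw [← mul_assoc, hr2]; field_simp
    refine hasSignature_of_family finrank_X5 (Sum.elim (Fin.cons ((sasaki g K a a' Ψ).ξ z)
      fun i => r • horLift g a a' z (b (.inr i))) fun i => r • horLift g a a' z (b (.inl i))) ?_
    rintro (i | i) (j | j)
    · refine Fin.cases ?_ (fun i => ?_) i <;> refine Fin.cases ?_ (fun j => ?_) j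
      · simp [e4]
      · simp [e2, (Fin.succ_ne_zero _).symm]
      · simp [e3]
      · simp only [Sum.elim_inl, Fin.cons_succ, map_smul, smul_apply, smul_eq_mul, e1, hm, hb]
        by_cases hij : i = j <;> simp [hij]
    · refine Fin.cases ?_ (fun i => ?_) i
      · simp [e2]
      · simp only [Sum.elim_inl, Sum.elim_inr, Fin.cons_succ, map_smul, smul_apply, smul_eq_mul,
          e1, hm, hb]
        simp
    · refine Fin.cases ?_ (fun j => ?_) j
      · simp [e3]
      · simp only [Sum.elim_inl, Sum.elim_inr, Fin.cons_succ, map_smul, smul_apply, smul_eq_mul,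
          e1, hm, hb]
        simp
    · simp only [Sum.elim_inr, map_smul, smul_apply, smul_eq_mul, e1, hm, hb]
      by_cases hij : i = j <;> simp [hij]
  · set r := √(12 * Ψ) with hr
    have hr2 : r * r = 12 * Ψ := Real.mul_self_sqrt (by linarith)
    have hm : ∀ t : ℝ, r * (r * (1 / (12 * Ψ) * t)) = t := fun t => by
      rw [← mul_assoc, hr2]; field_simp
    refine hasSignature_of_family finrank_X5 (Sum.elim (Fin.cons ((sasaki g K a a' Ψ).ξ z)
      fun i => r • horLift g a a' z (b (.inl i))) fun i => r • horLift g a a' z (b (.inr i))) ?_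
    rintro (i | i) (j | j)
    · refine Fin.cases ?_ (fun i => ?_) i <;> refine Fin.cases ?_ (fun j => ?_) j
      · simp [e4]
      · simp [e2, (Fin.succ_ne_zero _).symm]
      · simp [e3]
      · simp only [Sum.elim_inl, Fin.cons_succ, map_smul, smul_apply, smul_eq_mul, e1, hm, hb]
        by_cases hij : i = j <;> simp [hij]
    · refine Fin.cases ?_ (fun i => ?_) i
      · simp [e2]
      · simp only [Sum.elim_inl, Sum.elim_inr, Fin.cons_succ, map_smul, smul_apply, smul_eq_mul,
          e1, hm, hb]
        simp
    · refine Fin.cases ?_ (fun j => ?_) j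
      · simp [e3]
      · simp only [Sum.elim_inl, Sum.elim_inr, Fin.cons_succ, map_smul, smul_apply, smul_eq_mul,
          e1, hm, hb]
        simp
    · simp only [Sum.elim_inr, map_smul, smul_apply, smul_eq_mul, e1, hm, hb]
      by_cases hij : i = j <;> simp [hij]

/-- For sections `X, Y` of `ker β` one has `β([X,Y]) = -dβ(X,Y)`, a multiple of the para-Kähler
form. The bracket stays in `ker β` wherever `X, Y` are isotropic for that form, as holds inside
either eigendistribution. -/
theorem lieBracket_β {Ψ : ℝ} (hΨ : Ψ ≠ 0) (hs : ∀ y ∈ s, scal g y = -12 * Ψ) {O : Set X5}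
    (hO : IsOpen O) (hOs : O ⊆ lineBundle s) {X Y : X5 → X5} (hX : ContDiffOn ℝ ∞ X O)
    (hY : ContDiffOn ℝ ∞ Y O) (hXβ : ∀ z ∈ O, (sasaki g K a a' Ψ).β z (X z) = 0)
    (hYβ : ∀ z ∈ O, (sasaki g K a a' Ψ).β z (Y z) = 0) {z : X5} (hz : z ∈ O)
    (h0 : ∑ i, wedge (a i z.1) (a' i z.1) (X z).1 (Y z).1 = 0) :
    (sasaki g K a a' Ψ).β z (VectorField.lieBracket ℝ X Y z) = 0 := by
  rw [apply_lieBracket hO hz (diffAt_of_contDiffOn (A.smooth_β Ψ) (isOpen_lineBundle A.isOpen)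
    (hOs hz)) (diffAt_of_contDiffOn hX hO hz) (diffAt_of_contDiffOn hY hO hz) hXβ hYβ,
    A.d1_β hΨ hs (hOs hz), h0]
  simp

theorem integrable_φ_one {Ψ : ℝ} (hΨ : Ψ ≠ 0) (hs : ∀ y ∈ s, scal g y = -12 * Ψ) :
    IsInvolutiveOn (eigDist (sasaki g K a a' Ψ).φ 1) (lineBundle s) := by
  intro O hO hOs X Y hX hY hXD hYD z hz
  have k1 : ∀ Z : X5 → X5, (∀ z ∈ O, Z z ∈ eigDist (sasaki g K a a' Ψ).φ 1 z) → ∀ z ∈ O, ∀ i,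
      a' i z.1 (Z z).1 = 0 := fun Z hZ z hz =>
    (A.mem_eigDist_one (hOs hz).1).1 (fst_mem_of_mem_eig (.inl rfl) (hZ z hz))
  refine mem_eig_φ_of_β hΨ (hOs hz).2 (.inl rfl) ((A.mem_eigDist_one (hOs hz).1).2 fun i => ?_) ?_
  · have := apply_lieBracket (η := liftForm (a' i)) hO hz
      (diffAt_liftForm (A.diffAt_a' (hOs hz).1 i)) (diffAt_of_contDiffOn hX hO hz)
      (diffAt_of_contDiffOn hY hO hz) (fun z hz => k1 X hXD z hz i) fun z hz => k1 Y hYD z hz i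
    rw [d1_liftForm (A.diffAt_a' (hOs hz).1 i), A.d1_a' (hOs hz).1] at this
    refine this.trans ?_
    simp [wedge, k1 X hXD z hz, k1 Y hYD z hz]
  · refine A.lieBracket_β hΨ hs hO hOs hX hY
      (fun z hz => β_eq_zero_of_mem_eig (hOs hz).2 (.inl rfl) (hXD z hz))
      (fun z hz => β_eq_zero_of_mem_eig (hOs hz).2 (.inl rfl) (hYD z hz)) hz ?_
    simp [wedge, k1 X hXD z hz, k1 Y hYD z hz]

theorem integrable_φ_neg_one {Ψ : ℝ} (hΨ : Ψ ≠ 0) (hs : ∀ y ∈ s, scal g y = -12 * Ψ) :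
    IsInvolutiveOn (eigDist (sasaki g K a a' Ψ).φ (-1)) (lineBundle s) := by
  intro O hO hOs X Y hX hY hXD hYD z hz
  have k1 : ∀ Z : X5 → X5, (∀ z ∈ O, Z z ∈ eigDist (sasaki g K a a' Ψ).φ (-1) z) → ∀ z ∈ O, ∀ i,
      a i z.1 (Z z).1 = 0 := fun Z hZ z hz =>
    (A.mem_eigDist_neg_one (hOs hz).1).1 (fst_mem_of_mem_eig (.inr rfl) (hZ z hz))
  refine mem_eig_φ_of_β hΨ (hOs hz).2 (.inr rfl)
    ((A.mem_eigDist_neg_one (hOs hz).1).2 fun i => ?_) ?_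
  · have := apply_lieBracket (η := liftForm (a i)) hO hz
      (diffAt_liftForm (A.diffAt_a (hOs hz).1 i)) (diffAt_of_contDiffOn hX hO hz)
      (diffAt_of_contDiffOn hY hO hz) (fun z hz => k1 X hXD z hz i) fun z hz => k1 Y hYD z hz i
    rw [d1_liftForm (A.diffAt_a (hOs hz).1 i), A.d1_a (hOs hz).1] at this
    refine this.trans ?_
    simp [wedge, k1 X hXD z hz, k1 Y hYD z hz]
  · refine A.lieBracket_β hΨ hs hO hOs hX hY
      (fun z hz => β_eq_zero_of_mem_eig (hOs hz).2 (.inr rfl) (hXD z hz))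
      (fun z hz => β_eq_zero_of_mem_eig (hOs hz).2 (.inr rfl) (hYD z hz)) hz ?_
    simp [wedge, k1 X hXD z hz, k1 Y hYD z hz]

theorem isScaledParaSasakiEinsteinOn {Ψ : ℝ} (hΨ : Ψ ≠ 0) (hs : ∀ y ∈ s, scal g y = -12 * Ψ) :
    IsScaledParaSasakiEinsteinOn (2 * √6 * Ψ) (-24 * Ψ ^ 2) (lineBundle s)
      (sasaki g K a a' Ψ) where
  smooth_φ := A.smooth_φ Ψ
  smooth_ξ := contDiffOn_const.prodMk (contDiffOn_const.mul contDiff_snd.contDiffOn)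
  smooth_β := A.smooth_β Ψ
  smooth_h := A.smooth_h Ψ
  symm := fun z hz u v => by
    rw [A.sasaki_h Ψ hz, A.sasaki_h Ψ hz, A.pke.symm z.1 hz.1]
    ring
  signature := fun z hz => A.sasaki_signature hΨ hz
  φ_sq := fun z hz u => by
    have := horLift_add_ξ (g := g) (K := K) (a := a) (a' := a') hΨ hz.2 u
    rw [sasaki_φ, sasaki_φ, A.pke.para_complex z.1 hz.1, ← horLift_apply, eq_sub_iff_add_eq]
    exact this
  β_ξ := fun z hz => β_ξ hΨ hz.2
  φ_ξ := fun z hz => by simp [sasaki_φ, ξ_eq]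
  β_φ := fun z hz u => sasaki_β_φ hz.2 u
  h_ξ := fun z hz u => by
    rw [A.sasaki_h Ψ hz, β_ξ hΨ hz.2, ξ_eq]
    simp
  eig_le_ker := fun z hz u hu => hu.elim (β_eq_zero_of_mem_eig hz.2 (.inl rfl))
    (β_eq_zero_of_mem_eig hz.2 (.inr rfl))
  rank_pos := fun z hz => by rw [finrank_eig_φ Ψ z (.inl rfl), A.pke.rank_pos z.1 hz.1]
  rank_neg := fun z hz => by rw [finrank_eig_φ Ψ z (.inr rfl), A.pke.rank_neg z.1 hz.1]
  integrable_pos := A.integrable_φ_one hΨ hs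
  integrable_neg := A.integrable_φ_neg_one hΨ hs
  h_φ := fun z hz u v => by
    rw [A.sasaki_h Ψ hz, A.sasaki_h Ψ hz, sasaki_β_φ hz.2, sasaki_φ, sasaki_φ,
      A.pke.compatible z.1 hz.1]
    ring
  dβ := fun z hz u v => by
    rw [A.d1_β hΨ hs hz, A.sasaki_h Ψ hz, sasaki_β_φ hz.2, sasaki_φ, ← A.kahler_form hz.1]
    field_simp
    ring
  einstein := fun z hz u v => A.sasaki_ricci hz hΨ hs u v

end IsAdaptedOn

/-! ### Homotheties. -/

section Rescale

variable {V : Type*} [NormedAddCommGroup V] [NormedSpace ℝ V]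

variable [FiniteDimensional ℝ V]

theorem inverse_smul_apply_smul {B : V →L[ℝ] V →L[ℝ] ℝ} (hB : ∀ u, (∀ v, B u v = 0) → u = 0)
    {c : ℝ} (hc : c ≠ 0) (α : V →L[ℝ] ℝ) : (c • B).inverse (c • α) = B.inverse α := by
  have h1 : (c • B).IsInvertible := isInvertible_of_nondegenerate fun u hu => hB u fun v => by
    simpa [hc] using hu v
  have h2 : (c • B) (B.inverse α) = c • α := by
    rw [smul_apply, apply_inverse_of_isInvertible (isInvertible_of_nondegenerate hB)]
  rw [← h2]
  obtain ⟨f, hf⟩ := h1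
  rw [← hf, ContinuousLinearMap.inverse_equiv]
  exact f.symm_apply_apply _

theorem christoffel_const_smul {h : V → V →L[ℝ] V →L[ℝ] ℝ} {c : ℝ} (hc : c ≠ 0) {x : V}
    (hB : ∀ u, (∀ v, h x u v = 0) → u = 0) (u v : V) :
    christoffel (fun x => c • h x) x u v = christoffel h x u v := by
  have hf : fderiv ℝ (fun x => c • h x) x = c • fderiv ℝ h x :=
    congrFun (fderiv_const_smul_field (𝕜 := ℝ) (f := h) c) x
  rw [christoffel, christoffel, ← inverse_smul_apply_smul hB hc, hf]
  congr 1
  ext w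
  simp
  ring

/-- A constant factor in the metric cancels in the Koszul formula, so the Levi-Civita connection,
and with it the Ricci tensor, is unchanged. -/
theorem ricci_const_smul {h : V → V →L[ℝ] V →L[ℝ] ℝ} {c : ℝ} (hc : c ≠ 0) {s : Set V}
    (hs : IsOpen s) (hB : ∀ x ∈ s, ∀ u, (∀ v, h x u v = 0) → u = 0) {x : V} (hx : x ∈ s)
    (v w : V) : ricci (fun x => c • h x) x v w = ricci h x v w := by
  have e1 : ∀ u v w, fderiv ℝ (fun y => christoffel (fun x => c • h x) y v w) x u
      = fderiv ℝ (fun y => christoffel h y v w) x u := fun u v w =>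
    congrArg (fun L : V →L[ℝ] V => L u) (Filter.EventuallyEq.fderiv_eq
      (Filter.eventually_of_mem (hs.mem_nhds hx) fun y hy =>
        christoffel_const_smul hc (hB y hy) v w))
  simp only [ricci, riemann, e1, christoffel_const_smul hc (hB x hx)]

theorem HasSignature.const_sq_smul {B : V →L[ℝ] V →L[ℝ] ℝ} {p q : ℕ} (hB : HasSignature B p q)
    {κ : ℝ} (hκ : κ ≠ 0) : HasSignature (κ ^ 2 • B) p q := by
  obtain ⟨b, hb⟩ := hB
  refine hasSignature_of_family (by simpa using Module.finrank_eq_card_basis b)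
    (fun i => κ⁻¹ • b i) fun i j => ?_
  rw [← hb]
  simp
  field_simp

/-- Multiplying `β` by `κ` gives `d(κβ) = κ² h(φ·,·)`, which is the rescaled metric, so the factor
becomes `1`. The Ricci tensor is unchanged while the metric gains `κ²`, hence the Einstein constant
is divided by `κ²`. -/
theorem IsScaledParaSasakiEinsteinOn.rescale {κ lam : ℝ} {s : Set V} {S : ContactData V}
    (hs : IsOpen s) (hκ : κ ≠ 0) (h : IsScaledParaSasakiEinsteinOn κ lam s S) :
    IsParaSasakiEinsteinOn (lam / κ ^ 2) s (S.rescale κ) where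
  smooth_φ := h.smooth_φ
  smooth_ξ := h.smooth_ξ.const_smul _
  smooth_β := h.smooth_β.const_smul _
  smooth_h := h.smooth_h.const_smul _
  symm := fun z hz u v => by simp [ContactData.rescale, h.symm z hz u v]
  signature := fun z hz => (h.signature z hz).const_sq_smul hκ
  φ_sq := fun z hz u => by
    simp only [ContactData.rescale, h.φ_sq z hz, smul_apply, smul_eq_mul, smul_smul]
    field_simp
  β_ξ := fun z hz => by simp [ContactData.rescale, h.β_ξ z hz, hκ]
  φ_ξ := fun z hz => by simp [ContactData.rescale, h.φ_ξ z hz]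
  β_φ := fun z hz u => by simp [ContactData.rescale, h.β_φ z hz]
  h_ξ := fun z hz u => by
    simp [ContactData.rescale, h.h_ξ z hz]
    field_simp
  eig_le_ker := fun z hz u hu => by
    have := h.eig_le_ker z hz u hu
    simp [ContactData.rescale, this]
  rank_pos := h.rank_pos
  rank_neg := h.rank_neg
  integrable_pos := h.integrable_pos
  integrable_neg := h.integrable_neg
  h_φ := fun z hz u v => by
    simp [ContactData.rescale, h.h_φ z hz]
    ring
  dβ := fun z hz u v => by
    have := d1_const_smul (diffAt_of_contDiffOn h.smooth_β hs hz) κ u v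
    refine this.trans ?_
    rw [h.dβ z hz]
    simp [ContactData.rescale]
    ring
  einstein := fun z hz u v => by
    refine (ricci_const_smul (pow_ne_zero 2 hκ) hs
      (fun z hz u => (h.signature z hz).eq_zero) hz u v).trans ?_
    rw [h.einstein z hz]
    simp [ContactData.rescale]
    field_simp

end Rescale

theorem IsAdaptedOn.isParaSasakiEinsteinOn {s : Set E4} {g : E4 → E4 →L[ℝ] E4 →L[ℝ] ℝ}
    {K : E4 → E4 →L[ℝ] E4} {a a' : Fin 2 → E4 → E4 →L[ℝ] ℝ} (A : IsAdaptedOn s g K a a') {Ψ : ℝ}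
    (hΨ : Ψ ≠ 0) (hs : ∀ y ∈ s, scal g y = -12 * Ψ) :
    IsParaSasakiEinsteinOn (-1) (lineBundle s) ((sasaki g K a a' Ψ).rescale (2 * √6 * Ψ)) := by
  have hκ : 2 * √6 * Ψ ≠ 0 := by positivity
  have h := (A.isScaledParaSasakiEinsteinOn hΨ hs).rescale (isOpen_lineBundle A.isOpen) hκ
  have e : -24 * Ψ ^ 2 / (2 * √6 * Ψ) ^ 2 = -1 := by
    rw [mul_pow, mul_pow, sqrt_six_sq]
    field_simp
    norm_num
  rwa [e] at h

end ParaKE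

namespace ParaKE

/-! ### Adapted coframes at a point as a `GL₂(ℝ)`-torsor. -/

section CoframeChange

variable {V : Type*} [NormedAddCommGroup V] [NormedSpace ℝ V]

theorem IsDualFrame.change {α α' : Fin 2 → V →L[ℝ] ℝ} {e : Fin 2 ⊕ Fin 2 → V}
    (h : IsDualFrame (Sum.elim α α') e) {B C : Fin 2 → Fin 2 → ℝ}
    (hCB : ∀ i j, ∑ k, C i k * B k j = if i = j then 1 else 0)
    (hBC : ∀ i j, ∑ k, B i k * C k j = if i = j then 1 else 0) :
    IsDualFrame (Sum.elim (fun i => ∑ j, B i j • α j) fun i => ∑ j, C j i • α' j)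
      (Sum.elim (fun j => ∑ k, C k j • e (.inl k)) fun j => ∑ k, B j k • e (.inr k)) := by
  have p1 : ∀ i j, α i (e (.inl j)) = if i = j then 1 else 0 := fun i j => by
    simpa using h.pair (.inl i) (.inl j)
  have p2 : ∀ i j, α i (e (.inr j)) = 0 := fun i j => by simpa using h.pair (.inl i) (.inr j)
  have p3 : ∀ i j, α' i (e (.inl j)) = 0 := fun i j => by simpa using h.pair (.inr i) (.inl j)
  have p4 : ∀ i j, α' i (e (.inr j)) = if i = j then 1 else 0 := fun i j => by
    simpa using h.pair (.inr i) (.inr j)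
  simp only [Fin.sum_univ_two] at hCB hBC
  constructor
  · rintro (i | i) (j | j)
    · simpa [p1] using hBC i j
    · simp [p2]
    · simp [p3]
    · have := hBC j i
      simp only [eq_comm (a := j)] at this
      simp [p4]
      linarith
  · intro u
    rw [h.ext_iff]
    rintro (m | m)
    · have h0 := hCB m 0
      have h1 := hCB m 1
      fin_cases m <;> simp [Fintype.sum_sum_type, p1, p2] at h0 h1 ⊢ <;>
        linear_combination α 0 u * h0 + α 1 u * h1
    · have h0 := hCB 0 m
      have h1 := hCB 1 m
      fin_cases m <;> simp [Fintype.sum_sum_type, p3, p4] at h0 h1 ⊢ <;>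
        linear_combination α' 0 u * h0 + α' 1 u * h1

/-- The pairing of the two halves is invariant when they transform contragrediently. The shape of
`g`, and later the formula for `h` on the frame bundle, rest on this. -/
theorem sum_mul_change (α α' : Fin 2 → V →L[ℝ] ℝ) {B C : Fin 2 → Fin 2 → ℝ}
    (hCB : ∀ i j, ∑ k, C i k * B k j = if i = j then 1 else 0) (u v : V) :
    ∑ i, (∑ j, B i j • α j) u * (∑ j, C j i • α' j) v = ∑ i, α i u * α' i v := by
  have h00 := hCB 0 0
  have h01 := hCB 0 1
  have h10 := hCB 1 0
  have h11 := hCB 1 1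
  simp at h00 h01 h10 h11 ⊢
  linear_combination α 0 u * α' 0 v * h00 + α 1 u * α' 0 v * h01 + α 0 u * α' 1 v * h10
    + α 1 u * α' 1 v * h11

variable {g : E4 →L[ℝ] E4 →L[ℝ] ℝ} {K : E4 →L[ℝ] E4} {a a' : Fin 2 → E4 →L[ℝ] ℝ}

theorem IsAdaptedCoframe.change (h : IsAdaptedCoframe g K a a') (hg : HasSignature g 2 2)
    {B C : Fin 2 → Fin 2 → ℝ} (hCB : ∀ i j, ∑ k, C i k * B k j = if i = j then 1 else 0)
    (hBC : ∀ i j, ∑ k, B i k * C k j = if i = j then 1 else 0) :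
    IsAdaptedCoframe g K (fun i => ∑ j, B i j • a j) fun i => ∑ j, C j i • a' j := by
  refine ⟨((h.isDualFrame hg).change hCB hBC).linearIndependent, fun u v => ?_, fun i u => ⟨?_, ?_⟩⟩
  · have e1 := sum_mul_change a a' hCB u v
    have e2 := sum_mul_change a a' hCB v u
    rw [h.metric, Finset.sum_add_distrib, ← e1]
    simp only [mul_comm (a' _ u), ← e2]
    rw [← Finset.sum_add_distrib]
    refine Finset.sum_congr rfl fun i _ => ?_
    simp only [symProd]
    ring
  · simp only [sum_apply, smul_apply, (h.2.2 _ _).1]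
  · simp only [sum_apply, smul_apply, (h.2.2 _ _).2, smul_neg, Finset.sum_neg_distrib]

/-- Two adapted coframes at a point differ by `GL₂(ℝ)`. -/
theorem IsAdaptedCoframe.exists_change (h : IsAdaptedCoframe g K a a') (hg : HasSignature g 2 2)
    {b b' : Fin 2 → E4 →L[ℝ] ℝ} (hb : IsAdaptedCoframe g K b b') :
    (∀ i, b i = ∑ j, b i (g.inverse (a' j)) • a j) ∧
    (∀ i, b' i = ∑ j, b' i (g.inverse (a j)) • a' j) ∧
    ∀ i j, ∑ k, b' k (g.inverse (a i)) * b k (g.inverse (a' j)) = if i = j then 1 else 0 := by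
  have hd := h.isDualFrame hg
  have p1 : ∀ i j, a i (g.inverse (a' j)) = if i = j then 1 else 0 := fun i j => by
    simpa [nullFrame] using hd.pair (.inl i) (.inl j)
  have p2 : ∀ i j, a i (g.inverse (a j)) = 0 := fun i j => by
    simpa [nullFrame] using hd.pair (.inl i) (.inr j)
  have p3 : ∀ i j, a' i (g.inverse (a' j)) = 0 := fun i j => by
    simpa [nullFrame] using hd.pair (.inr i) (.inl j)
  have p4 : ∀ i j, a' i (g.inverse (a j)) = if i = j then 1 else 0 := fun i j => by
    simpa [nullFrame] using hd.pair (.inr i) (.inr j)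
  have k1 : ∀ j, K (g.inverse (a' j)) = g.inverse (a' j) := fun j => by
    rw [hd.ext_iff]
    rintro (i | i)
    · exact (h.2.2 i _).1
    · simp [(h.2.2 i _).2, p3]
  have k2 : ∀ j, K (g.inverse (a j)) = - g.inverse (a j) := fun j => by
    rw [hd.ext_iff]
    rintro (i | i)
    · simp [(h.2.2 i _).1, p2]
    · simp [(h.2.2 i _).2]
  have z1 : ∀ i j, b i (g.inverse (a j)) = 0 := fun i j => by
    have := (hb.2.2 i (g.inverse (a j))).1
    rw [k2, map_neg] at this
    linarith
  have z2 : ∀ i j, b' i (g.inverse (a' j)) = 0 := fun i j => by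
    have := (hb.2.2 i (g.inverse (a' j))).2
    rw [k1] at this
    linarith
  have hc : ∀ u, ∑ j, a j u • g.inverse (a' j) + ∑ j, a' j u • g.inverse (a j) = u := fun u => by
    have := hd.complete u
    rw [Fintype.sum_sum_type] at this
    exact this
  refine ⟨fun i => ?_, fun i => ?_, fun i j => ?_⟩
  · ext u
    conv_lhs => rw [← hc u]
    simp only [map_add, map_sum, map_smul, z1, sum_apply, smul_apply, smul_eq_mul, mul_zero,
      Finset.sum_const_zero, add_zero]
    exact Finset.sum_congr rfl fun _ _ => mul_comm _ _
  · ext u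
    conv_lhs => rw [← hc u]
    simp only [map_add, map_sum, map_smul, z2, sum_apply, smul_apply, smul_eq_mul, mul_zero,
      Finset.sum_const_zero, zero_add]
    exact Finset.sum_congr rfl fun _ _ => mul_comm _ _
  · have e := hb.metric (g.inverse (a i)) (g.inverse (a' j))
    rw [apply_inverse_of_isInvertible hg.isInvertible] at e
    simp only [z1, zero_mul, zero_add, p1] at e
    exact e.symm

theorem sum_mul_comm_of_inverse {B C : Fin 2 → Fin 2 → ℝ}
    (hCB : ∀ i j, ∑ k, C i k * B k j = if i = j then 1 else 0) (i j : Fin 2) :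
    ∑ k, B i k * C k j = if i = j then 1 else 0 := by
  have h : Matrix.of C * Matrix.of B = 1 := by
    ext i j
    rw [Matrix.mul_apply, Matrix.one_apply]
    exact hCB i j
  have h' : Matrix.of B * Matrix.of C = 1 := mul_eq_one_comm.1 h
  have := congrFun (congrFun h' i) j
  rwa [Matrix.mul_apply, Matrix.one_apply] at this

theorem sum_inv_mul {A : Fin 2 → Fin 2 → ℝ} (hA : (Matrix.of A).det ≠ 0) (i j : Fin 2) :
    ∑ k, (Matrix.of A)⁻¹ i k * A k j = if i = j then 1 else 0 := by
  have := congrFun (congrFun (Matrix.nonsing_inv_mul (Matrix.of A) (isUnit_iff_ne_zero.2 hA)) i) j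
  rwa [Matrix.mul_apply, Matrix.one_apply] at this

theorem eq_inv_of_sum_mul {B C : Fin 2 → Fin 2 → ℝ}
    (hCB : ∀ i j, ∑ k, C i k * B k j = if i = j then 1 else 0) :
    (Matrix.of B).det ≠ 0 ∧ ∀ i j, (Matrix.of B)⁻¹ i j = C i j := by
  have h : Matrix.of C * Matrix.of B = 1 := by
    ext i j
    rw [Matrix.mul_apply, Matrix.one_apply]
    exact hCB i j
  refine ⟨fun h0 => ?_, fun i j => ?_⟩
  · have := congrArg Matrix.det h
    simp only [Matrix.det_mul, Matrix.det_one, h0, mul_zero] at this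
    exact zero_ne_one this
  · rw [Matrix.inv_eq_left_inv h]
    rfl

/-- Compatibility with `K` forbids mixing the two halves, and the null form of `g` makes the matrix
on the second half the inverse transpose of that on the first. The matrix is unique because its
entries are the values of `b` on the dual frame. -/
theorem adaptedCoframe_iff (h : IsAdaptedCoframe g K a a') (hg : HasSignature g 2 2)
    (b b' : Fin 2 → E4 →L[ℝ] ℝ) : IsAdaptedCoframe g K b b' ↔
      ∃! A : Fin 2 → Fin 2 → ℝ, (Matrix.of A).det ≠ 0 ∧ (b = fun i => ∑ j, A i j • a j) ∧
        b' = fun i => ∑ j, (Matrix.of A)⁻¹ j i • a' j := by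
  constructor
  · intro hb
    obtain ⟨h1, h2, h3⟩ := h.exists_change hg hb
    obtain ⟨h4, h5⟩ := eq_inv_of_sum_mul (B := fun i j => b i (g.inverse (a' j)))
      (C := fun i j => b' j (g.inverse (a i))) h3
    refine ⟨fun i j => b i (g.inverse (a' j)), ⟨h4, funext h1, ?_⟩, ?_⟩
    · ext1 i
      simp only [h5]
      exact h2 i
    · rintro A ⟨-, rfl, -⟩
      have p1 : ∀ i j, a i (g.inverse (a' j)) = if i = j then 1 else 0 := fun i j => by
        simpa [nullFrame] using (h.isDualFrame hg).pair (.inl i) (.inl j)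
      ext i j
      fin_cases j <;> simp [p1]
  · rintro ⟨A, ⟨hA, rfl, rfl⟩, -⟩
    exact h.change hg (sum_inv_mul hA) (sum_mul_comm_of_inverse (sum_inv_mul hA))

end CoframeChange

end ParaKE

/-! ### Matrix coordinates, the determinant projection and the trace of the connection on the frame
bundle. -/

namespace ParaKE

/-- Matrix entries as functions on the frame bundle. -/
def entry (i j : Fin 2) (x : X8) : ℝ := x.2 i j

/-- Entries of the inverse matrix as functions on the frame bundle. -/
def invEntry (i j : Fin 2) (x : X8) : ℝ := (Matrix.of x.2)⁻¹ i j

/-- The differential of a matrix entry. -/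
def entryL (i j : Fin 2) : X8 →L[ℝ] ℝ :=
  (ContinuousLinearMap.proj j).comp
    ((ContinuousLinearMap.proj (φ := fun _ : Fin 2 => Fin 2 → ℝ) i).comp
      (ContinuousLinearMap.snd ℝ E4 (Fin 2 → Fin 2 → ℝ)))

theorem entryL_apply (i j : Fin 2) (x : X8) : entryL i j x = x.2 i j := rfl

theorem contDiff_entry (i j : Fin 2) : ContDiff ℝ ∞ (entry i j) := (entryL i j).contDiff

theorem fderiv_entry (i j : Fin 2) (x : X8) : fderiv ℝ (entry i j) x = entryL i j :=
  (entryL i j).fderiv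

theorem det_eq (x : X8) : (Matrix.of x.2).det = x.2 0 0 * x.2 1 1 - x.2 0 1 * x.2 1 0 := by
  simp [Matrix.det_fin_two]

/-- The frame bundle over `s`. -/
def glBundle (s : Set E4) : Set X8 := {x | x.1 ∈ s ∧ (Matrix.of x.2).det ≠ 0}

theorem contDiff_det : ContDiff ℝ ∞ fun x : X8 => (Matrix.of x.2).det := by
  have : (fun x : X8 => (Matrix.of x.2).det)
      = fun x => entry 0 0 x * entry 1 1 x - entry 0 1 x * entry 1 0 x := funext det_eq
  rw [this]
  exact ((contDiff_entry 0 0).mul (contDiff_entry 1 1)).sub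
    ((contDiff_entry 0 1).mul (contDiff_entry 1 0))

theorem isOpen_glBundle {s : Set E4} (hs : IsOpen s) : IsOpen (glBundle s) :=
  (hs.preimage continuous_fst).inter (isOpen_ne.preimage contDiff_det.continuous)

theorem invEntry_eq (x : X8) (i j : Fin 2) : invEntry i j x
    = (Matrix.of x.2).det⁻¹ * (!![x.2 1 1, -x.2 0 1; -x.2 1 0, x.2 0 0] : Matrix _ _ ℝ) i j := by
  simp [invEntry, Matrix.inv_def, Matrix.adjugate_fin_two]

theorem contDiffOn_invEntry (s : Set E4) (i j : Fin 2) :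
    ContDiffOn ℝ ∞ (invEntry i j) (glBundle s) := by
  have h1 : ContDiffOn ℝ ∞ (fun x : X8 => (Matrix.of x.2).det⁻¹) (glBundle s) :=
    contDiff_det.contDiffOn.inv fun x hx => hx.2
  have h2 : ContDiff ℝ ∞ fun x : X8 =>
      (!![x.2 1 1, -x.2 0 1; -x.2 1 0, x.2 0 0] : Matrix _ _ ℝ) i j := by
    fin_cases i <;> fin_cases j
    exacts [contDiff_entry 1 1, (contDiff_entry 0 1).neg, (contDiff_entry 1 0).neg,
      contDiff_entry 0 0]
  refine (h1.mul h2.contDiffOn).congr fun x _ => invEntry_eq x i j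

theorem invEntry_mul_entry {x : X8} (hx : (Matrix.of x.2).det ≠ 0) (i j : Fin 2) :
    ∑ k, invEntry i k x * entry k j x = if i = j then 1 else 0 := sum_inv_mul hx i j

theorem entry_mul_invEntry {x : X8} (hx : (Matrix.of x.2).det ≠ 0) (i j : Fin 2) :
    ∑ k, entry i k x * invEntry k j x = if i = j then 1 else 0 :=
  sum_mul_comm_of_inverse (sum_inv_mul hx) i j

/-- Pullback of a 1-form from the base to the frame bundle. -/
def pullForm (α : E4 → E4 →L[ℝ] ℝ) (x : X8) : X8 →L[ℝ] ℝ :=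
  (α x.1).comp (ContinuousLinearMap.fst ℝ E4 (Fin 2 → Fin 2 → ℝ))

theorem pullForm_apply (α : E4 → E4 →L[ℝ] ℝ) (x u : X8) : pullForm α x u = α x.1 u.1 := rfl

theorem d1_pullForm {α : E4 → E4 →L[ℝ] ℝ} {x : X8} (h : DifferentiableAt ℝ α x.1) (u v : X8) :
    d1 (pullForm α) x u v = d1 α x.1 u.1 v.1 :=
  d1_comp_clm (ContinuousLinearMap.fst ℝ E4 (Fin 2 → Fin 2 → ℝ)) (x := x) h u v

theorem contDiffOn_pullForm {α : E4 → E4 →L[ℝ] ℝ} {s : Set E4} (h : ContDiffOn ℝ ∞ α s) :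
    ContDiffOn ℝ ∞ (pullForm α) (glBundle s) :=
  (h.comp contDiff_fst.contDiffOn fun _ hz => hz.1).clm_comp contDiffOn_const

/-- The connection form on the frame bundle. -/
def frameConn (g : E4 → E4 →L[ℝ] E4 →L[ℝ] ℝ) (a a' : Fin 2 → E4 → E4 →L[ℝ] ℝ) (i j : Fin 2)
    (x : X8) : X8 →L[ℝ] ℝ :=
  gauge entry invEntry (fun k l => pullForm (conn g a a' k l)) i j x

/-- The projection `(y, A) ↦ (y, det A)` and its derivative. -/
def projDeriv (x : X8) : X8 →L[ℝ] X5 :=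
  (ContinuousLinearMap.fst ℝ E4 (Fin 2 → Fin 2 → ℝ)).prod
    ((x.2 0 0 • entryL 1 1 + x.2 1 1 • entryL 0 0) - (x.2 0 1 • entryL 1 0 + x.2 1 0 • entryL 0 1))

theorem fderiv_proj (x : X8) : fderiv ℝ AdaptedChart.proj x = projDeriv x := by
  have e : AdaptedChart.proj = fun x : X8 => (x.1, entry 0 0 x * entry 1 1 x
      - entry 0 1 x * entry 1 0 x) := by
    ext1 x
    rw [AdaptedChart.proj, det_eq]
    rfl
  have h : ∀ i j, HasFDerivAt (entry i j) (entryL i j) x := fun i j => (entryL i j).hasFDerivAt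
  rw [e]
  exact (hasFDerivAt_fst.prodMk (((h 0 0).mul (h 1 1)).sub ((h 0 1).mul (h 1 0)))).fderiv

theorem projDeriv_apply (x u : X8) : projDeriv x u = (u.1, (x.2 0 0 * u.2 1 1 + x.2 1 1 * u.2 0 0)
    - (x.2 0 1 * u.2 1 0 + x.2 1 0 * u.2 0 1)) := rfl

theorem contDiff_proj : ContDiff ℝ ∞ AdaptedChart.proj := contDiff_fst.prodMk contDiff_det

theorem proj_mem {s : Set E4} {x : X8} (hx : x ∈ glBundle s) :
    AdaptedChart.proj x ∈ lineBundle s := hx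

/-- Conjugation does not affect the trace, and `tr(dA A⁻¹) = d(det A)/det A`. The trace therefore
depends on the matrix only through its determinant and descends to the line bundle. -/
theorem frameConn_trace {s : Set E4} (g : E4 → E4 →L[ℝ] E4 →L[ℝ] ℝ)
    (a a' : Fin 2 → E4 → E4 →L[ℝ] ℝ) {x : X8} (hx : x ∈ glBundle s) :
    frameConn g a a' 0 0 x + frameConn g a a' 1 1 x
      = (traceForm g a a' (AdaptedChart.proj x)).comp (fderiv ℝ AdaptedChart.proj x) := by
  refine ContinuousLinearMap.ext fun u => ?_
  have h00 := invEntry_mul_entry hx.2 0 0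
  have h01 := invEntry_mul_entry hx.2 0 1
  have h10 := invEntry_mul_entry hx.2 1 0
  have h11 := invEntry_mul_entry hx.2 1 1
  -- Jacobi's formula for the derivative of the determinant.
  have e : ∑ i, ∑ k, invEntry k i x * u.2 i k
      = (Matrix.of x.2).det⁻¹ * (projDeriv x u).2 := by
    simp [invEntry_eq, projDeriv_apply]
    ring
  rw [fderiv_proj, ContinuousLinearMap.comp_apply, IsAdaptedOn.traceForm_apply]
  simp only [AdaptedChart.proj, ← e]
  simp [frameConn, gauge, fderiv_entry, entryL_apply, pullForm_apply, traceConn, projDeriv_apply]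
    at h00 h01 h10 h11 ⊢
  linear_combination conn g a a' 0 0 x.1 u.1 * h00 + conn g a a' 1 0 x.1 u.1 * h01
    + conn g a a' 0 1 x.1 u.1 * h10 + conn g a a' 1 1 x.1 u.1 * h11

end ParaKE

/-! ### Connection forms and the Pfaffian system over an adapted chart. -/

namespace ParaKE

namespace AdaptedChart

variable {M : Type*} [TopologicalSpace M] [ChartedSpace E4 M]
  {g : ∀ p : M, TangentSpace (𝓡 4) p →L[ℝ] TangentSpace (𝓡 4) p →L[ℝ] ℝ}
  {K : ∀ p : M, TangentSpace (𝓡 4) p →L[ℝ] TangentSpace (𝓡 4) p}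
  (c : AdaptedChart g K)

/-- The connection form on the frame bundle over an adapted chart. -/
def conn (i j : Fin 2) : X8 → X8 →L[ℝ] ℝ := frameConn (chartMetric g c.e) c.a c.a' i j

/-- The para-Sasaki structure on the leaf space over an adapted chart. -/
def sasaki (Ψ : ℝ) : ContactData X5 :=
  ParaKE.sasaki (chartMetric g c.e) (chartEndo K c.e) c.a c.a' Ψ

theorem isOpen_F : IsOpen c.F := isOpen_glBundle c.e.open_target

theorem θ_eq (i : Fin 2) (x : X8) : c.θ i x = ∑ j, entry i j x • pullForm (c.a j) x := by
  refine ContinuousLinearMap.ext fun u => ?_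
  simp [θ, cofr, pullForm, entry]

theorem θ'_eq (i : Fin 2) (x : X8) : c.θ' i x = ∑ j, invEntry j i x • pullForm (c.a' j) x := by
  refine ContinuousLinearMap.ext fun u => ?_
  simp [θ', cofr', pullForm, invEntry]

theorem a_fst_eq {x : X8} (hx : x ∈ c.F) (i : Fin 2) (u : X8) :
    c.a i x.1 u.1 = ∑ j, invEntry i j x * c.θ j x u := by
  have h0 := invEntry_mul_entry hx.2 i 0
  have h1 := invEntry_mul_entry hx.2 i 1
  simp only [θ_eq]
  fin_cases i <;> simp [pullForm_apply] at h0 h1 ⊢ <;>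
    linear_combination - c.a 0 x.1 u.1 * h0 - c.a 1 x.1 u.1 * h1

theorem a'_fst_eq {x : X8} (hx : x ∈ c.F) (i : Fin 2) (u : X8) :
    c.a' i x.1 u.1 = ∑ j, entry j i x * c.θ' j x u := by
  have h0 := invEntry_mul_entry hx.2 0 i
  have h1 := invEntry_mul_entry hx.2 1 i
  simp only [θ'_eq]
  fin_cases i <;> simp [pullForm_apply] at h0 h1 ⊢ <;>
    linear_combination - c.a' 0 x.1 u.1 * h0 - c.a' 1 x.1 u.1 * h1

theorem sum_θ_θ' {x : X8} (hx : x ∈ c.F) (u v : X8) :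
    ∑ i, c.θ i x u * c.θ' i x v = ∑ i, c.a i x.1 u.1 * c.a' i x.1 v.1 := by
  simp only [θ_eq, θ'_eq]
  exact sum_mul_change (fun i => pullForm (c.a i) x) (fun i => pullForm (c.a' i) x)
    (invEntry_mul_entry hx.2) u v

section

variable (hgK : IsParaKahlerEinstein g K)
include hgK

theorem isAdaptedOn :
    IsAdaptedOn c.e.target (chartMetric g c.e) (chartEndo K c.e) c.a c.a' where
  isOpen := c.e.open_target
  pke := hgK c.e c.mem_atlas
  smooth_a := c.smooth_a
  smooth_a' := c.smooth_a'
  adapted := c.adapted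

theorem coframe_iff {y : E4} (hy : y ∈ c.e.target) (a a' : Fin 2 → E4 →L[ℝ] ℝ) :
    IsAdaptedCoframe (chartMetric g c.e y) (chartEndo K c.e y) a a' ↔
      ∃! A : Fin 2 → Fin 2 → ℝ, (y, A) ∈ c.F ∧ a = c.cofr (y, A) ∧ a' = c.cofr' (y, A) := by
  rw [adaptedCoframe_iff (c.adapted y hy) ((hgK c.e c.mem_atlas).signature y hy) a a']
  have : ∀ A : Fin 2 → Fin 2 → ℝ, (y, A) ∈ c.F ↔ (Matrix.of A).det ≠ 0 := fun A =>
    ⟨fun h => h.2, fun h => ⟨hy, h⟩⟩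
  simp only [this]
  rfl

theorem scal_eq {Ψ : ℝ} (hΨ : HasConstantPsi2' g K Ψ) (y : E4) (hy : y ∈ c.e.target) :
    scal (chartMetric g c.e) y = -12 * Ψ := by
  have A := c.isAdaptedOn hgK
  have h1 := A.weyl4_nullFrame hy
  rw [hΨ c.e c.mem_atlas y hy _ _ _ _ (A.isAdaptedFrame hy)] at h1
  linarith

theorem isConnection : c.IsConnection c.conn where
  smooth := fun i j => by
    have hγ : ∀ k l, ContDiffOn ℝ ∞ (pullForm (ParaKE.conn (chartMetric g c.e) c.a c.a' k l)) c.F :=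
      fun k l => contDiffOn_pullForm ((c.isAdaptedOn hgK).smooth_conn k l)
    have hB : ∀ i j, ContDiffOn ℝ ∞ (entry i j) c.F := fun i j => (contDiff_entry i j).contDiffOn
    have hC : ∀ i j, ContDiffOn ℝ ∞ (invEntry i j) c.F := contDiffOn_invEntry c.e.target
    refine ContDiffOn.sub (ContDiffOn.sum fun k _ => ContDiffOn.sum fun l _ => ?_)
      (ContDiffOn.sum fun k _ => ?_)
    · exact ((hB i k).mul (hC l j)).smul (hγ k l)
    · exact (hC k j).smul (contDiffOn_fderiv (hB i k) c.isOpen_F)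
  dθ := fun x hx i u v => by
    have A := c.isAdaptedOn hgK
    have e : c.θ i = fun x => ∑ j, entry i j x • pullForm (c.a j) x := funext (c.θ_eq i)
    rw [e, d1_gauge (B := entry) (C := invEntry)
      (γ := fun k l => pullForm (ParaKE.conn (chartMetric g c.e) c.a c.a' k l))
      (fun i j => (entryL i j).differentiableAt)
      (fun i => diffAt_of_contDiffOn (contDiffOn_pullForm (c.smooth_a i)) c.isOpen_F hx)
      (invEntry_mul_entry hx.2) (fun i u v => by
        rw [d1_pullForm (A.diffAt_a hx.1 i), A.d1_a hx.1]
        rfl)]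
    simp only [θ_eq]
    rfl
  dθ' := fun x hx i u v => by
    have A := c.isAdaptedOn hgK
    have e : c.θ' i = fun x => ∑ j, invEntry j i x • pullForm (c.a' j) x := funext (c.θ'_eq i)
    rw [e, d1_gauge' (B := entry)
      (γ := fun k l => pullForm (ParaKE.conn (chartMetric g c.e) c.a c.a' k l))
      (fun i j => (entryL i j).differentiableAt)
      (fun i j => diffAt_of_contDiffOn (contDiffOn_invEntry c.e.target i j) c.isOpen_F hx)
      (fun i => diffAt_of_contDiffOn (contDiffOn_pullForm (c.smooth_a' i)) c.isOpen_F hx)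
      (Filter.eventually_of_mem (c.isOpen_F.mem_nhds hx) fun y hy => entry_mul_invEntry hy.2)
      (invEntry_mul_entry hx.2) (fun i u v => by
        rw [d1_pullForm (A.diffAt_a' hx.1 i), A.d1_a' hx.1]
        rfl)]
    simp only [θ'_eq]
    rfl

theorem exists_dual {x : X8} (hx : x ∈ c.F) : ∃ e e' : Fin 2 → X8,
    (∀ i j, c.θ i x (e j) = if i = j then 1 else 0) ∧ (∀ i j, c.θ' i x (e j) = 0) ∧
    (∀ i j, c.θ i x (e' j) = 0) ∧ ∀ i j, c.θ' i x (e' j) = if i = j then 1 else 0 := by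
  obtain ⟨E, hE⟩ : ∃ E, IsDualFrame (Sum.elim (fun i => c.cofr x i) fun i => c.cofr' x i) E :=
    ⟨_, ((c.isAdaptedOn hgK).dual hx.1).change (invEntry_mul_entry hx.2)
      (entry_mul_invEntry hx.2)⟩
  refine ⟨fun j => (E (.inl j), 0), fun j => (E (.inr j), 0), fun i j => ?_, fun i j => ?_,
    fun i j => ?_, fun i j => ?_⟩
  · simpa [θ] using hE.pair (.inl i) (.inl j)
  · simpa [θ'] using hE.pair (.inr i) (.inl j)
  · simpa [θ] using hE.pair (.inl i) (.inr j)
  · simpa [θ'] using hE.pair (.inr i) (.inr j)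

/-- The difference of two solutions has zero wedge with both halves of the coframe. The first half
gives that it vanishes on `ker θ`, the second that it vanishes on `ker θ'`, and these kernels span.
-/
theorem connection_unique {Γ' : Fin 2 → Fin 2 → X8 → X8 →L[ℝ] ℝ} (hΓ : c.IsConnection Γ')
    (i j : Fin 2) : Set.EqOn (Γ' i j) (c.conn i j) c.F := by
  intro x hx
  obtain ⟨e, e', h1, -, h3, h4⟩ := c.exists_dual hgK hx
  have hΓ' := c.isConnection hgK
  have := eq_zero_of_wedge (Δ := fun i j => Γ' i j x - c.conn i j x) h1 h3 h4
    (fun i u v => by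
      have := (hΓ.dθ x hx i u v).symm.trans (hΓ'.dθ x hx i u v)
      simp [wedge] at this ⊢
      linarith)
    (fun i u v => by
      have := (hΓ.dθ' x hx i u v).symm.trans (hΓ'.dθ' x hx i u v)
      simp [wedge] at this ⊢
      linarith) i j
  exact sub_eq_zero.1 this

theorem fst_eq_zero_iff {x : X8} (hx : x ∈ c.F) (u : X8) :
    u.1 = 0 ↔ (∀ i, c.θ i x u = 0) ∧ ∀ i, c.θ' i x u = 0 := by
  constructor
  · intro h
    simp [θ_eq, θ'_eq, pullForm_apply, h]
  · rintro ⟨h, h'⟩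
    refine (c.isAdaptedOn hgK).vec_ext hx.1 (fun i => ?_) fun i => ?_
    · rw [c.a_fst_eq hx]
      simp [h]
    · rw [c.a'_fst_eq hx]
      simp [h']

end

theorem trace_eq {x : X8} (hx : x ∈ c.F) : c.conn 0 0 x + c.conn 1 1 x
    = (traceForm (chartMetric g c.e) c.a c.a' (proj x)).comp (fderiv ℝ proj x) :=
  frameConn_trace _ _ _ hx

theorem trace_apply {x : X8} (hx : x ∈ c.F) (u : X8) : c.conn 0 0 x u + c.conn 1 1 x u
    = traceForm (chartMetric g c.e) c.a c.a' (proj x) (fderiv ℝ proj x u) :=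
  congrArg (fun L : X8 →L[ℝ] ℝ => L u) (c.trace_eq hx)

theorem ker_pfaffian_iff (Γ : Fin 2 → Fin 2 → X8 → X8 →L[ℝ] ℝ) (x u : X8) :
    (∀ k, c.pfaffian Γ k x u = 0) ↔
      ((∀ i, c.θ i x u = 0) ∧ ∀ i, c.θ' i x u = 0) ∧ Γ 0 0 x u + Γ 1 1 x u = 0 := by
  simp [Fin.forall_fin_succ, pfaffian, and_assoc]

section

variable (hgK : IsParaKahlerEinstein g K)
include hgK

/-- The forms `θ` cut out the vertical vectors, on which the trace form reduces to `-d(det A)/det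
A`. -/
theorem ker_proj {x : X8} (hx : x ∈ c.F) (u : X8) :
    fderiv ℝ proj x u = 0 ↔ ∀ k, c.pfaffian c.conn k x u = 0 := by
  rw [ker_pfaffian_iff, ← c.fst_eq_zero_iff hgK hx, c.trace_apply hx,
    IsAdaptedOn.traceForm_apply, fderiv_proj]
  have hd : (proj x).2⁻¹ ≠ 0 := inv_ne_zero hx.2
  constructor
  · intro h
    refine ⟨congrArg Prod.fst h, ?_⟩
    rw [h]
    simp
  · rintro ⟨h1, h2⟩
    have h3 : (projDeriv x u).1 = 0 := h1
    rw [h3] at h2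
    refine Prod.ext h3 ?_
    simpa [hd] using h2

theorem d1_trace {Ψ : ℝ} (hΨ : HasConstantPsi2' g K Ψ) {x : X8} (hx : x ∈ c.F) (u v : X8) :
    d1 (fun x => c.conn 0 0 x + c.conn 1 1 x) x u v
      = -3 * Ψ * ∑ i, wedge (c.a i x.1) (c.a' i x.1) u.1 v.1 := by
  have A := c.isAdaptedOn hgK
  have hz := proj_mem hx
  rw [d1_congr_on c.isOpen_F hx (fun y hy => c.trace_eq hy), d1_pullback c.isOpen_F hx
    contDiff_proj.contDiffOn (diffAt_of_contDiffOn A.smooth_traceForm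
    (isOpen_lineBundle A.isOpen) hz), A.d1_traceForm (c.scal_eq hgK hΨ) hz, fderiv_proj]
  rfl

theorem isIntegrablePfaffianOn {Ψ : ℝ} (hΨ : HasConstantPsi2' g K Ψ) :
    IsIntegrablePfaffianOn (c.pfaffian c.conn) c.F := by
  intro x hx
  constructor
  · obtain ⟨e, e', h1, h2, h3, h4⟩ := c.exists_dual hgK hx
    -- The vertical vector `(0, A)` is the Euler field of the fibre. All `θ` vanish on it, while the
    -- trace form equals `-tr(A A⁻¹) = -2`, which separates the fifth form from the other four.
    have hv : c.conn 0 0 x (0, x.2) + c.conn 1 1 x (0, x.2) = -2 := by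
      have h := hx.2
      rw [c.trace_apply hx, IsAdaptedOn.traceForm_apply, fderiv_proj, projDeriv_apply]
      simp only [proj, map_zero, zero_sub]
      field_simp
      rw [det_eq]
      ring
    have t1 : ∀ i, c.θ i x (0, x.2) = 0 := fun i => by simp [θ_eq, pullForm_apply]
    have t2 : ∀ i, c.θ' i x (0, x.2) = 0 := fun i => by simp [θ'_eq, pullForm_apply]
    rw [Fintype.linearIndependent_iff]
    intro f hf
    have ev : ∀ u, f 0 * c.θ 0 x u + f 1 * c.θ 1 x u + f 2 * c.θ' 0 x u + f 3 * c.θ' 1 x u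
        + f 4 * (c.conn 0 0 x u + c.conn 1 1 x u) = 0 := fun u => by
      have := congrArg (fun L : X8 →L[ℝ] ℝ => L u) hf
      simpa [Fin.sum_univ_five, pfaffian, mul_add] using this
    have k4 : f 4 = 0 := by
      have := ev (0, x.2)
      rw [hv, t1, t1, t2, t2] at this
      linarith
    have k0 : f 0 = 0 := by simpa [h1, h2, k4] using ev (e 0)
    have k1 : f 1 = 0 := by simpa [h1, h2, k4] using ev (e 1)
    have k2 : f 2 = 0 := by simpa [h3, h4, k4] using ev (e' 0)
    have k3 : f 3 = 0 := by simpa [h3, h4, k4] using ev (e' 1)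
    intro i
    fin_cases i
    exacts [k0, k1, k2, k3, k4]
  · intro k u v hu hv
    have hu' := (c.ker_pfaffian_iff c.conn x u).1 hu
    have hv' := (c.ker_pfaffian_iff c.conn x v).1 hv
    have hC := c.isConnection hgK
    have d0 : ∀ i, d1 (c.θ i) x u v = 0 := fun i => by
      rw [hC.dθ x hx]
      simp [wedge, hu'.1.1, hv'.1.1]
    have d0' : ∀ i, d1 (c.θ' i) x u v = 0 := fun i => by
      rw [hC.dθ' x hx]
      simp [wedge, hu'.1.2, hv'.1.2]
    -- The exterior derivative of the trace is a multiple of the pulled-back form `ρ`, so it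
    -- vanishes on vertical vectors.
    have dτ : d1 (fun x => c.conn 0 0 x + c.conn 1 1 x) x u v = 0 := by
      rw [c.d1_trace hgK hΨ hx, (c.fst_eq_zero_iff hgK hx u).2 hu'.1]
      simp [wedge]
    fin_cases k
    exacts [d0 0, d0 1, d0' 0, d0' 1, dτ]

end

end AdaptedChart

end ParaKE

/-! ### Leaves of the Pfaffian system and the explicit formulas. -/

namespace ParaKE

/-- The matrices of determinant `t ≠ 0` parametrized as rotation times upper triangular. -/
def iwasawa (t : ℝ) (p : ℝ × ℝ × ℝ) : Fin 2 → Fin 2 → ℝ :=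
  ![![Real.exp p.1 * Real.cos p.2.1,
      p.2.2 * Real.cos p.2.1 - t * Real.exp (-p.1) * Real.sin p.2.1],
    ![Real.exp p.1 * Real.sin p.2.1,
      p.2.2 * Real.sin p.2.1 + t * Real.exp (-p.1) * Real.cos p.2.1]]

theorem continuous_iwasawa (t : ℝ) : Continuous (iwasawa t) := by
  refine continuous_pi fun i => continuous_pi fun j => ?_
  fin_cases i <;> fin_cases j <;> simp [iwasawa] <;> fun_prop

theorem det_iwasawa (t : ℝ) (p : ℝ × ℝ × ℝ) : (Matrix.of (iwasawa t p)).det = t := by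
  have h1 : Real.exp p.1 * Real.exp (-p.1) = 1 := by rw [← Real.exp_add]; simp
  have h2 := Real.sin_sq_add_cos_sq p.2.1
  simp [Matrix.det_fin_two, iwasawa]
  linear_combination t * Real.exp p.1 * Real.exp (-p.1) * h2 + t * h1

/-- The first column, read as a nonzero complex number, has a logarithm giving its length and angle.
The last parameter is the component of the second column along the first; the orthogonal component
is determined by the determinant. -/
theorem exists_iwasawa {t : ℝ} (ht : t ≠ 0) {A : Fin 2 → Fin 2 → ℝ} (hA : (Matrix.of A).det = t) :
    ∃ p, iwasawa t p = A := by
  simp [Matrix.det_fin_two] at hA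
  set w : ℂ := ⟨A 0 0, A 1 0⟩ with hw
  have hw0 : w ≠ 0 := by
    intro h
    have h1 : A 0 0 = 0 := congrArg Complex.re h
    have h2 : A 1 0 = 0 := congrArg Complex.im h
    rw [h1, h2] at hA
    apply ht
    linarith
  set ρ := (Complex.log w).re
  set ϑ := (Complex.log w).im
  have e1 : Real.exp ρ * Real.cos ϑ = A 0 0 := by
    rw [← Complex.exp_re, Complex.exp_log hw0]
  have e2 : Real.exp ρ * Real.sin ϑ = A 1 0 := by
    rw [← Complex.exp_im, Complex.exp_log hw0]
  have h1 : Real.exp ρ * Real.exp (-ρ) = 1 := by rw [← Real.exp_add]; simp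
  have h2 := Real.sin_sq_add_cos_sq ϑ
  have e3 : t * Real.exp (-ρ) = Real.cos ϑ * A 1 1 - Real.sin ϑ * A 0 1 := by
    rw [← hA, ← e1, ← e2]
    linear_combination (Real.cos ϑ * A 1 1 - Real.sin ϑ * A 0 1) * h1
  refine ⟨(ρ, ϑ, A 0 1 * Real.cos ϑ + A 1 1 * Real.sin ϑ), ?_⟩
  ext i j
  fin_cases i <;> fin_cases j <;> simp [iwasawa, e1, e2, e3]
  · linear_combination A 0 1 * h2
  · linear_combination A 1 1 * h2

namespace AdaptedChart

variable {M : Type*} [TopologicalSpace M] [ChartedSpace E4 M]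
  {g : ∀ p : M, TangentSpace (𝓡 4) p →L[ℝ] TangentSpace (𝓡 4) p →L[ℝ] ℝ}
  {K : ∀ p : M, TangentSpace (𝓡 4) p →L[ℝ] TangentSpace (𝓡 4) p}
  (c : AdaptedChart g K)

/-- The matrices of determinant `t` are the continuous image of the connected parameter space `ℝ × ℝ
× ℝ`; this works for either sign of `t`. -/
theorem isConnected_fibre {z : X5} (hz : z ∈ c.Q) : IsConnected (c.F ∩ proj ⁻¹' {z}) := by
  have : c.F ∩ proj ⁻¹' {z} = Set.range fun p => (z.1, iwasawa z.2 p) := by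
    ext x
    simp only [Set.mem_inter_iff, Set.mem_preimage, Set.mem_singleton_iff, Set.mem_range]
    constructor
    · rintro ⟨-, rfl⟩
      obtain ⟨p, hp⟩ := exists_iwasawa hz.2 (A := x.2) rfl
      exact ⟨p, Prod.ext rfl hp⟩
    · rintro ⟨p, rfl⟩
      refine ⟨⟨hz.1, ?_⟩, Prod.ext rfl (det_iwasawa z.2 p)⟩
      rw [det_iwasawa]
      exact hz.2
  rw [this]
  exact isConnected_range (continuous_const.prodMk (continuous_iwasawa z.2))

theorem proj_eq_iff {x x' : X8} (hx : x ∈ c.F) : proj x = proj x' ↔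
    x.1 = x'.1 ∧ ∃ B : Matrix (Fin 2) (Fin 2) ℝ, B.det = 1 ∧
      Matrix.of x'.2 = B * Matrix.of x.2 := by
  simp only [proj, Prod.ext_iff]
  refine and_congr_right fun _ => ⟨fun h => ?_, ?_⟩
  · refine ⟨Matrix.of x'.2 * (Matrix.of x.2)⁻¹, ?_, ?_⟩
    · rw [Matrix.det_mul, Matrix.det_nonsing_inv, ← h, Ring.inverse_eq_inv',
        mul_inv_cancel₀ hx.2]
    · rw [Matrix.mul_assoc, Matrix.nonsing_inv_mul _ (isUnit_iff_ne_zero.2 hx.2), Matrix.mul_one]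
  · rintro ⟨B, hB, h⟩
    rw [h, Matrix.det_mul, hB, one_mul]

theorem image_proj : proj '' c.F = c.Q := by
  ext z
  constructor
  · rintro ⟨x, hx, rfl⟩
    exact proj_mem hx
  · intro hz
    obtain ⟨x, hx⟩ := (c.isConnected_fibre hz).nonempty
    exact ⟨x, hx.1, hx.2⟩

theorem surjective_fderiv_proj {x : X8} (hx : x ∈ c.F) :
    Function.Surjective (fderiv ℝ proj x) := by
  rintro ⟨w, r⟩
  -- The determinant is homogeneous of degree two, so its derivative in the direction `A` is `2 det
  -- A`.
  refine ⟨(w, (r / (2 * (Matrix.of x.2).det)) • x.2), ?_⟩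
  rw [fderiv_proj, projDeriv_apply]
  refine Prod.ext rfl ?_
  have h := hx.2
  rw [det_eq] at h ⊢
  simp
  field_simp
  ring

theorem isLeafProjection (hgK : IsParaKahlerEinstein g K) :
    IsLeafProjection (c.pfaffian c.conn) c.F c.Q proj where
  smooth := contDiff_proj.contDiffOn
  image := c.image_proj
  submersion := fun _ hx => c.surjective_fderiv_proj hx
  ker := fun _ hx u => c.ker_proj hgK hx u
  connected := fun _ hz => c.isConnected_fibre hz

theorem fst_fderiv_proj (x u : X8) : (fderiv ℝ proj x u).1 = u.1 := by
  rw [fderiv_proj]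
  rfl

theorem η_two_apply (Ψ : ℝ) {x : X8} (hx : x ∈ c.F) (u : X8) : c.η Ψ c.conn x 2 u
    = -1 / (6 * Ψ) * traceForm (chartMetric g c.e) c.a c.a' (proj x) (fderiv ℝ proj x u) := by
  rw [← c.trace_apply hx, mul_add]
  simp [η]

theorem isExplicit (hgK : IsParaKahlerEinstein g K) {Ψ : ℝ} (hΨ0 : Ψ ≠ 0) :
    c.IsExplicit Ψ c.conn (c.sasaki Ψ) where
  φ_eq := fun x hx u w h => by
    have A := c.isAdaptedOn hgK
    have h1 : w.1 = chartEndo K c.e x.1 u.1 := by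
      have := congrArg Prod.fst h
      rwa [sasaki, IsAdaptedOn.sasaki_φ, fst_fderiv_proj, fst_fderiv_proj] at this
    refine ⟨fun i => ?_, fun i => ?_, ?_⟩
    · simp [θ_eq, pullForm_apply, h1, A.a_K hx.1]
    · simp [θ'_eq, pullForm_apply, h1, A.a'_K hx.1]
      ring
    · have hz : (proj x).2 ≠ 0 := hx.2
      rw [c.η_two_apply Ψ hx, h, sasaki, IsAdaptedOn.sasaki_φ, IsAdaptedOn.traceForm_apply,
        inv_mul_cancel_left₀ hz, sub_self, mul_zero]
  ξ_eq := fun x hx u h => by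
    have h1 : u.1 = 0 := by
      have := congrArg Prod.fst h
      rwa [fst_fderiv_proj] at this
    obtain ⟨h2, h3⟩ := (c.fst_eq_zero_iff hgK hx u).1 h1
    have hz : (proj x).2 ≠ 0 := hx.2
    have h4 : c.η Ψ c.conn x 2 u = √(3 / 2) := by
      rw [c.η_two_apply Ψ hx, h, sasaki, IsAdaptedOn.ξ_eq, IsAdaptedOn.traceForm_apply, map_zero]
      field_simp
      ring
    intro k
    fin_cases k
    · simp [η, h2, h3]
    · simp [η, h2, h3]
    · simpa using h4
    · simp [η, h3]
    · simp [η, h3]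
  β_eq := fun x hx u => by
    rw [c.η_two_apply Ψ hx, sasaki, IsAdaptedOn.sasaki_β, IsAdaptedOn.traceForm_apply]
    ring
  h_eq := fun x hx u v => by
    have A := c.isAdaptedOn hgK
    have e1 := c.sum_θ_θ' hx u v
    have e2 := c.sum_θ_θ' hx v u
    have h2 : √(2 / 3 : ℝ) ^ 2 = 2 / 3 := Real.sq_sqrt (by norm_num)
    rw [sasaki, A.sasaki_h Ψ (proj_mem hx), IsAdaptedOn.sasaki_β, IsAdaptedOn.sasaki_β,
      ← IsAdaptedOn.traceForm_apply, ← IsAdaptedOn.traceForm_apply, fst_fderiv_proj,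
      fst_fderiv_proj, (A.adapted _ (proj_mem hx).1).metric]
    have e3 : c.η Ψ c.conn x 2 u = _ := c.η_two_apply Ψ hx u
    have e4 : c.η Ψ c.conn x 2 v = _ := c.η_two_apply Ψ hx v
    have h0 : ∀ w, c.η Ψ c.conn x 0 w = -1 / (6 * Ψ) * (c.θ 0 x w + c.θ' 1 x w) := fun w => by
      rw [mul_add]; simp [η]
    have h1 : ∀ w, c.η Ψ c.conn x 1 w = -1 / (6 * Ψ) * (c.θ 1 x w - c.θ' 0 x w) := fun w => by
      simp [η, mul_sub]
    have h3 : ∀ w, c.η Ψ c.conn x 3 w = c.θ' 1 x w := fun w => rfl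
    have h4 : ∀ w, c.η Ψ c.conn x 4 w = - c.θ' 0 x w := fun w => rfl
    simp only [symProd, e3, e4, h0, h1, h3, h4]
    simp only [Fin.sum_univ_two, proj] at e1 e2 ⊢
    -- In `η¹η⁵ - η²η⁴` the products `θ³θ⁴` cancel, leaving `(θ¹θ³ + θ²θ⁴)/(6Ψ) = g/(12Ψ)`. The last
    -- summand matches `(2/3)(η³)²` with `β ⊗ β`.
    linear_combination (-1 / (12 * Ψ)) * e1 + (-1 / (12 * Ψ)) * e2
      + (-1 / (6 * Ψ)) ^ 2 * (traceForm (chartMetric g c.e) c.a c.a' (x.1, (Matrix.of x.2).det)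
        (fderiv ℝ proj x u) * traceForm (chartMetric g c.e) c.a c.a' (x.1, (Matrix.of x.2).det)
        (fderiv ℝ proj x v)) * h2

end AdaptedChart

end ParaKE

namespace ParaKE

/-! ### Local existence of smooth adapted coframes. -/

section ExistsCoframe

theorem isDualFrame_of_pair {ι V : Type*} [NormedAddCommGroup V] [NormedSpace ℝ V]
    [FiniteDimensional ℝ V] [Fintype ι] [DecidableEq ι] {θ : ι → V →L[ℝ] ℝ} {e : ι → V}
    (hc : Fintype.card ι = Module.finrank ℝ V) (h : ∀ i j, θ i (e j) = if i = j then 1 else 0) :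
    IsDualFrame θ e := by
  have hli : LinearIndependent ℝ e := by
    rw [Fintype.linearIndependent_iff]
    intro c hc j
    simpa [h] using congrArg (θ j) hc
  refine ⟨h, fun u => ?_⟩
  obtain ⟨c, rfl⟩ : ∃ c : ι → ℝ, ∑ i, c i • e i = u := by
    have : u ∈ Submodule.span ℝ (Set.range e) := by
      rw [hli.span_eq_top_of_card_eq_finrank' hc]; trivial
    exact (Submodule.mem_span_range_iff_exists_fun ℝ).1 this
  simp [h]

variable {g : E4 →L[ℝ] E4 →L[ℝ] ℝ} {K : E4 →L[ℝ] E4}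

/-- Dual null frames of the eigenspaces of `K` give an adapted coframe. -/
theorem isAdaptedCoframe_of_frame (hs : ∀ u v, g u v = g v u) (hK : ∀ u, K (K u) = u)
    (hgK : ∀ u v, g (K u) (K v) = - g u v) {e f : Fin 2 → E4} (he : ∀ i, K (e i) = e i)
    (hf : ∀ i, K (f i) = - f i) (hef : ∀ i j, g (f i) (e j) = if i = j then 1 else 0) :
    IsAdaptedCoframe g K (fun i => g (f i)) fun i => g (e i) := by
  have z1 : ∀ i j, g (e i) (e j) = 0 := fun i j => by
    have := hgK (e i) (e j)
    rw [he, he] at this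
    linarith
  have z2 : ∀ i j, g (f i) (f j) = 0 := fun i j => by
    have := hgK (f i) (f j)
    rw [hf, hf, map_neg, map_neg, neg_apply, neg_neg] at this
    linarith
  have hd : IsDualFrame (Sum.elim (fun i => g (f i)) fun i => g (e i)) (Sum.elim e f) := by
    refine isDualFrame_of_pair (by simp [E4]) ?_
    rintro (i | i) (j | j)
    · simp [hef]
    · simp [z2]
    · simp [z1]
    · simp [hs (e i), hef, eq_comm]
  refine ⟨hd.linearIndependent, fun u v => ?_, fun i u => ⟨?_, ?_⟩⟩
  · have e1 := hd.complete u
    rw [Fintype.sum_sum_type] at e1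
    conv_lhs => rw [← e1]
    simp only [Sum.elim_inl, Sum.elim_inr, map_add, map_sum, map_smul, add_apply, sum_apply,
      smul_apply, smul_eq_mul, symProd, ← Finset.sum_add_distrib]
    exact Finset.sum_congr rfl fun i _ => by ring
  · have := hgK (f i) (K u)
    rw [hK, hf, map_neg, neg_apply] at this
    linarith
  · have := hgK (e i) (K u)
    rw [hK, he] at this
    linarith

/-- The projections `(1 ± K)/2` split every vector. The constant field at the base point `0` merely
expresses the eigenspaces of a single endomorphism through `eigDist`. -/
theorem exists_eigenbases (hK : ∀ u, K (K u) = u)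
    (hp : Module.finrank ℝ (eigDist (fun _ : E4 => K) 1 0) = 2)
    (hn : Module.finrank ℝ (eigDist (fun _ : E4 => K) (-1) 0) = 2) :
    ∃ v w : Fin 2 → E4, LinearIndependent ℝ v ∧ (∀ i, K (v i) = v i) ∧ (∀ i, K (w i) = - w i) ∧
      ∀ u, ∃ c d : Fin 2 → ℝ, u = ∑ i, c i • v i + ∑ i, d i • w i := by
  let bv := Module.finBasisOfFinrankEq ℝ _ hp
  let bw := Module.finBasisOfFinrankEq ℝ _ hn
  have m1 : ∀ u, u ∈ eigDist (fun _ : E4 => K) 1 0 ↔ K u = u := fun u => by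
    rw [eigDist, Module.End.mem_eigenspace_iff, one_smul]; rfl
  have m2 : ∀ u, u ∈ eigDist (fun _ : E4 => K) (-1) 0 ↔ K u = -u := fun u => by
    rw [eigDist, Module.End.mem_eigenspace_iff, neg_smul, one_smul]; rfl
  refine ⟨fun i => bv i, fun i => bw i, ?_, fun i => (m1 _).1 (bv i).2, fun i => (m2 _).1 (bw i).2,
    fun u => ?_⟩
  · exact bv.linearIndependent.map' (Submodule.subtype _) (Submodule.ker_subtype _)
  · have h1 : (1 / 2 : ℝ) • (u + K u) ∈ eigDist (fun _ : E4 => K) 1 0 := by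
      rw [m1, map_smul, map_add, hK, add_comm]
    have h2 : (1 / 2 : ℝ) • (u - K u) ∈ eigDist (fun _ : E4 => K) (-1) 0 := by
      rw [m2, map_smul, map_sub, hK, ← smul_neg, neg_sub]
    refine ⟨fun i => bv.repr ⟨_, h1⟩ i, fun i => bw.repr ⟨_, h2⟩ i, ?_⟩
    have e1 := congrArg Subtype.val (bv.sum_repr ⟨_, h1⟩)
    have e2 := congrArg Subtype.val (bw.sum_repr ⟨_, h2⟩)
    simp only [Submodule.coe_sum, Submodule.coe_smul] at e1 e2
    rw [e1, e2]
    module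

/-- Each eigenspace of `K` is isotropic, so `g` must pair the two nondegenerately: a kernel vector
of the Gram matrix would give an element of the `+1`-eigenspace orthogonal to everything. -/
theorem det_ne_zero_of_eigenbases {p q : ℕ} (hg : HasSignature g p q) (hs : ∀ u v, g u v = g v u)
    (hgK : ∀ u v, g (K u) (K v) = - g u v) {v w : Fin 2 → E4} (hv : LinearIndependent ℝ v)
    (hv' : ∀ i, K (v i) = v i) (hu : ∀ u, ∃ c d : Fin 2 → ℝ, u = ∑ i, c i • v i + ∑ i, d i • w i) :
    (Matrix.of fun i j => g (w i) (v j)).det ≠ 0 := by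
  intro h0
  obtain ⟨c, hc, h⟩ := Matrix.exists_mulVec_eq_zero_iff.2 h0
  have h' : ∀ i, ∑ j, c j * g (w i) (v j) = 0 := fun i => by
    have := congrFun h i
    simpa [Matrix.mulVec, dotProduct, mul_comm] using this
  have z : ∑ j, c j • v j = 0 := by
    refine hg.eq_zero fun u => ?_
    obtain ⟨d, d', rfl⟩ := hu u
    rw [hs]
    have z1 : ∀ i j, g (v i) (v j) = 0 := fun i j => by
      have := hgK (v i) (v j)
      rw [hv', hv'] at this
      linarith
    simp only [map_add, map_sum, map_smul, add_apply, sum_apply, smul_apply, smul_eq_mul, z1,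
      mul_zero, Finset.sum_const_zero, zero_add]
    have h0 := h' 0
    have h1 := h' 1
    simp only [Fin.sum_univ_two] at h0 h1 ⊢
    linear_combination d' 0 * h0 + d' 1 * h1
  exact hc (funext (Fintype.linearIndependent_iff.1 hv c z))

/-- Adapted coframes exist near every point. -/
theorem IsParaKahlerEinsteinOn.exists_adapted {s : Set E4} {g : E4 → E4 →L[ℝ] E4 →L[ℝ] ℝ}
    {K : E4 → E4 →L[ℝ] E4} (h : IsParaKahlerEinsteinOn s g K) (hs : IsOpen s) {y₀ : E4}
    (hy : y₀ ∈ s) : ∃ O, IsOpen O ∧ y₀ ∈ O ∧ O ⊆ s ∧ ∃ a a' : Fin 2 → E4 → E4 →L[ℝ] ℝ,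
      (∀ i, ContDiffOn ℝ ∞ (a i) O) ∧ (∀ i, ContDiffOn ℝ ∞ (a' i) O) ∧
      ∀ y ∈ O, IsAdaptedCoframe (g y) (K y) (fun i => a i y) fun i => a' i y := by
  obtain ⟨v, w, hv, hv', hw', hu⟩ := exists_eigenbases (h.para_complex y₀ hy) (h.rank_pos y₀ hy)
    (h.rank_neg y₀ hy)
  have hdet := det_ne_zero_of_eigenbases (h.signature y₀ hy) (h.symm y₀ hy) (h.compatible y₀ hy)
    hv hv' hu
  -- Projecting the fixed eigenvectors at `y₀` by `(1 ± K y)/2` gives smooth fields of eigenvectors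
  -- that agree with the original ones at `y₀`.
  let e : Fin 2 → E4 → E4 := fun i y => (1 / 2 : ℝ) • (v i + K y (v i))
  let f : Fin 2 → E4 → E4 := fun i y => (1 / 2 : ℝ) • (w i - K y (w i))
  have he : ∀ i, ContDiffOn ℝ ∞ (e i) s := fun i => ContDiffOn.const_smul _
    (contDiffOn_const.add (h.smooth_K.clm_apply contDiffOn_const))
  have hf : ∀ i, ContDiffOn ℝ ∞ (f i) s := fun i => ContDiffOn.const_smul _
    (contDiffOn_const.sub (h.smooth_K.clm_apply contDiffOn_const))
  let N : Fin 2 → Fin 2 → E4 → ℝ := fun i j y => g y (f i y) (e j y)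
  have hN : ∀ i j, ContDiffOn ℝ ∞ (N i j) s := fun i j =>
    (h.smooth_g.clm_apply (hf i)).clm_apply (he j)
  let D : E4 → ℝ := fun y => N 0 0 y * N 1 1 y - N 0 1 y * N 1 0 y
  have hD : ContDiffOn ℝ ∞ D s := ((hN 0 0).mul (hN 1 1)).sub ((hN 0 1).mul (hN 1 0))
  have hD0 : D y₀ ≠ 0 := by
    have e0 : ∀ i, e i y₀ = v i := fun i => by simp only [e, hv']; module
    have f0 : ∀ i, f i y₀ = w i := fun i => by simp only [f, hw']; module
    rw [Matrix.det_fin_two] at hdet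
    simpa only [D, N, e0, f0, Matrix.of_apply] using hdet
  have hO : IsOpen (s ∩ D ⁻¹' {0}ᶜ) :=
    hD.continuousOn.isOpen_inter_preimage hs isOpen_compl_singleton
  -- Inverting the Gram matrix `N` by its adjugate replaces `f` by the basis of the `-1`-eigenspace
  -- dual to `e` under `g`. This is possible where `D ≠ 0`, a neighbourhood of `y₀`.
  let F : Fin 2 → E4 → E4 := fun i y => (D y)⁻¹ • ![N 1 1 y • f 0 y - N 0 1 y • f 1 y,
    N 0 0 y • f 1 y - N 1 0 y • f 0 y] i
  have hF : ∀ i, ContDiffOn ℝ ∞ (F i) (s ∩ D ⁻¹' {0}ᶜ) := fun i => by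
    refine ((hD.mono Set.inter_subset_left).inv fun y hy => hy.2).smul ?_
    refine ContDiffOn.mono ?_ Set.inter_subset_left
    fin_cases i
    · exact ((hN 1 1).smul (hf 0)).sub ((hN 0 1).smul (hf 1))
    · exact ((hN 0 0).smul (hf 1)).sub ((hN 1 0).smul (hf 0))
  refine ⟨_, hO, ⟨hy, hD0⟩, Set.inter_subset_left, fun i y => g y (F i y), fun i y => g y (e i y),
    fun i => (h.smooth_g.mono Set.inter_subset_left).clm_apply (hF i),
    fun i => (h.smooth_g.clm_apply (he i)).mono Set.inter_subset_left, fun y hy => ?_⟩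
  have hK := h.para_complex y hy.1
  have ke : ∀ i, K y (e i y) = e i y := fun i => by
    simp only [e, map_smul, map_add, hK, add_comm]
  have kf : ∀ i, K y (f i y) = - f i y := fun i => by
    simp only [f, map_smul, map_sub, hK, ← smul_neg, neg_sub]
  refine isAdaptedCoframe_of_frame (h.symm y hy.1) hK (h.compatible y hy.1) ke (fun i => ?_) ?_
  · fin_cases i <;> simp [F, kf] <;> module
  · have hDy : D y ≠ 0 := hy.2
    have hDe : D y = N 0 0 y * N 1 1 y - N 0 1 y * N 1 0 y := rfl
    have hNe : ∀ i j, g y (f i y) (e j y) = N i j y := fun i j => rfl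
    intro i j
    fin_cases i <;> fin_cases j <;> simp [F, hNe]
    · field_simp
      rw [hDe]
      ring
    · exact Or.inr (by ring)
    · exact Or.inr (by ring)
    · field_simp
      rw [hDe]
      ring

end ExistsCoframe

end ParaKE

namespace ParaKE

/-! ### The trace of a gauge-transformed connection. -/

section ConnectionTransform

variable {V : Type*} [NormedAddCommGroup V] [NormedSpace ℝ V]

/-- The determinant of a `2 × 2` matrix of functions. -/
def detFun (B : Fin 2 → Fin 2 → V → ℝ) (x : V) : ℝ := B 0 0 x * B 1 1 x - B 0 1 x * B 1 0 x

/-- Conjugation leaves the trace alone, and `tr(dB B⁻¹)` is the logarithmic derivative of `det B`;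
Cramer's rule expresses the entries of `B` through those of `C`. -/
theorem trace_gauge {B C : Fin 2 → Fin 2 → V → ℝ} {γ : Fin 2 → Fin 2 → V → V →L[ℝ] ℝ} {x : V}
    (hB : ∀ i j, DifferentiableAt ℝ (B i j) x)
    (hCB : ∀ i j, ∑ k, C i k x * B k j x = if i = j then 1 else 0) (u : V) :
    detFun B x ≠ 0 ∧ ∑ i, gauge B C γ i i x u
      = ∑ i, γ i i x u - fderiv ℝ (detFun B) x u / detFun B x := by
  have h00 := hCB 0 0
  have h01 := hCB 0 1
  have h10 := hCB 1 0
  have h11 := hCB 1 1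
  simp only [Fin.sum_univ_two, Fin.isValue, if_true, zero_ne_one, one_ne_zero, if_false]
    at h00 h01 h10 h11
  have hd : (C 0 0 x * C 1 1 x - C 0 1 x * C 1 0 x) * detFun B x = 1 := by
    rw [detFun]
    linear_combination (C 1 0 x * B 0 1 x + C 1 1 x * B 1 1 x) * h00 + h11
      - (C 1 0 x * B 0 0 x + C 1 1 x * B 1 0 x) * h01
  have h0 : detFun B x ≠ 0 := right_ne_zero_of_mul_eq_one hd
  refine ⟨h0, ?_⟩
  have hD : fderiv ℝ (detFun B) x u = B 0 0 x * fderiv ℝ (B 1 1) x u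
      + B 1 1 x * fderiv ℝ (B 0 0) x u - B 0 1 x * fderiv ℝ (B 1 0) x u
      - B 1 0 x * fderiv ℝ (B 0 1) x u := by
    have : detFun B = fun x => B 0 0 x * B 1 1 x - B 0 1 x * B 1 0 x := rfl
    rw [this, fderiv_fun_sub ((hB _ _).fun_mul (hB _ _)) ((hB _ _).fun_mul (hB _ _)),
      fderiv_fun_mul (hB _ _) (hB _ _), fderiv_fun_mul (hB _ _) (hB _ _)]
    simp
    ring
  have c00 : detFun B x * C 0 0 x = B 1 1 x := by
    rw [detFun]; linear_combination B 1 1 x * h00 - B 1 0 x * h01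
  have c01 : detFun B x * C 0 1 x = - B 0 1 x := by
    rw [detFun]; linear_combination B 0 0 x * h01 - B 0 1 x * h00
  have c10 : detFun B x * C 1 0 x = - B 1 0 x := by
    rw [detFun]; linear_combination B 1 1 x * h10 - B 1 0 x * h11
  have c11 : detFun B x * C 1 1 x = B 0 0 x := by
    rw [detFun]; linear_combination B 0 0 x * h11 - B 0 1 x * h10
  rw [eq_sub_iff_add_eq, hD, ← c00, ← c11]
  have e1 : B 0 1 x = - (detFun B x * C 0 1 x) := by rw [c01, neg_neg]
  have e2 : B 1 0 x = - (detFun B x * C 1 0 x) := by rw [c10, neg_neg]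
  have hq : (detFun B x * C 1 1 x * fderiv ℝ (B 1 1) x u
      + detFun B x * C 0 0 x * fderiv ℝ (B 0 0) x u - B 0 1 x * fderiv ℝ (B 1 0) x u
      - B 1 0 x * fderiv ℝ (B 0 1) x u) / detFun B x
      = C 1 1 x * fderiv ℝ (B 1 1) x u + C 0 0 x * fderiv ℝ (B 0 0) x u
        + C 0 1 x * fderiv ℝ (B 1 0) x u + C 1 0 x * fderiv ℝ (B 0 1) x u := by
    rw [div_eq_iff h0, e1, e2]
    ring
  rw [hq]
  simp only [gauge, Fin.sum_univ_two, sub_apply, add_apply, smul_apply, smul_eq_mul]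
  linear_combination γ 0 0 x u * h00 + γ 1 1 x u * h11 + γ 0 1 x u * h10 + γ 1 0 x u * h01

end ConnectionTransform

/-- `f` maps the adapted structure on `s₀`, restricted to `s`, isometrically to the one on `t`. -/
structure IsAdaptedMap (s₀ s t : Set E4) (g g' : E4 → E4 →L[ℝ] E4 →L[ℝ] ℝ)
    (K K' : E4 → E4 →L[ℝ] E4) (a a' b b' : Fin 2 → E4 → E4 →L[ℝ] ℝ) (f : E4 → E4) : Prop where
  isOpen : IsOpen s
  subset : s ⊆ s₀
  source : IsAdaptedOn s₀ g K a a'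
  target : IsAdaptedOn t g' K' b b'
  smooth : ContDiffOn ℝ ∞ f s
  mapsTo : ∀ y ∈ s, f y ∈ t
  metric : ∀ y ∈ s, ∀ u v, g y u v = g' (f y) (fderiv ℝ f y u) (fderiv ℝ f y v)
  endo : ∀ y ∈ s, ∀ u, fderiv ℝ f y (K y u) = K' (f y) (fderiv ℝ f y u)

/-- Pullback of a 1-form. -/
def pullback (f : E4 → E4) (α : E4 → E4 →L[ℝ] ℝ) (y : E4) : E4 →L[ℝ] ℝ :=
  (α (f y)).comp (fderiv ℝ f y)

/-- The matrix `B` with `f^* b = B a`. -/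
def changeMatrix (g : E4 → E4 →L[ℝ] E4 →L[ℝ] ℝ) (a' b : Fin 2 → E4 → E4 →L[ℝ] ℝ) (f : E4 → E4)
    (i j : Fin 2) (y : E4) : ℝ := pullback f (b i) y ((g y).inverse (a' j y))

/-- The determinant of the change of coframe along `f`. -/
def coframeDet (g : E4 → E4 →L[ℝ] E4 →L[ℝ] ℝ) (a' b : Fin 2 → E4 → E4 →L[ℝ] ℝ) (f : E4 → E4) :
    E4 → ℝ := detFun (changeMatrix g a' b f)

/-! ### Naturality under isometries preserving the para-complex structure. -/

namespace IsAdaptedMap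

variable {s₀ s t : Set E4} {g g' : E4 → E4 →L[ℝ] E4 →L[ℝ] ℝ} {K K' : E4 → E4 →L[ℝ] E4}
  {a a' b b' : Fin 2 → E4 → E4 →L[ℝ] ℝ} {f : E4 → E4}
  (T : IsAdaptedMap s₀ s t g g' K K' a a' b b' f)
include T

theorem smooth_pullback {α : E4 → E4 →L[ℝ] ℝ} (hα : ContDiffOn ℝ ∞ α t) :
    ContDiffOn ℝ ∞ (pullback f α) s :=
  (hα.comp T.smooth T.mapsTo).clm_comp (contDiffOn_fderiv T.smooth T.isOpen)

theorem adapted {y : E4} (hy : y ∈ s) : IsAdaptedCoframe (g y) (K y) (fun i => pullback f (b i) y)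
    fun i => pullback f (b' i) y := by
  have h := T.target.adapted _ (T.mapsTo y hy)
  -- A map preserving a nondegenerate form has injective derivative; equality of dimensions makes it
  -- surjective, so a linear relation among the pulled-back covectors descends to the target.
  have hinj : Function.Injective (fderiv ℝ f y : E4 →ₗ[ℝ] E4) := by
    rw [injective_iff_map_eq_zero]
    intro u hu
    refine (T.source.pke.signature y (T.subset hy)).eq_zero fun v => ?_
    rw [T.metric y hy, show fderiv ℝ f y u = 0 from hu, map_zero, zero_apply]
  have hsurj := LinearMap.injective_iff_surjective.1 hinj
  refine ⟨?_, fun u v => ?_, fun i u => ?_⟩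
  · rw [Fintype.linearIndependent_iff]
    intro c hc
    refine Fintype.linearIndependent_iff.1 h.1 c (ContinuousLinearMap.ext fun v => ?_)
    obtain ⟨u, rfl⟩ := hsurj v
    have := congrArg (fun L : E4 →L[ℝ] ℝ => L u) hc
    simpa [pullback] using this
  · rw [T.metric y hy, h.2.1]
    rfl
  · simp only [pullback, ContinuousLinearMap.comp_apply, T.endo y hy]
    exact h.2.2 i _

theorem smooth_changeMatrix (i j : Fin 2) : ContDiffOn ℝ ∞ (changeMatrix g a' b f i j) s :=
  (T.smooth_pullback (T.target.smooth_a i)).clm_apply ((T.source.smooth_e j).mono T.subset)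

theorem smooth_changeMatrix' (i j : Fin 2) : ContDiffOn ℝ ∞ (changeMatrix g a b' f i j) s :=
  (T.smooth_pullback (T.target.smooth_a' i)).clm_apply ((T.source.smooth_e' j).mono T.subset)

theorem smooth_coframeDet : ContDiffOn ℝ ∞ (coframeDet g a' b f) s :=
  ((T.smooth_changeMatrix 0 0).mul (T.smooth_changeMatrix 1 1)).sub
    ((T.smooth_changeMatrix 0 1).mul (T.smooth_changeMatrix 1 0))

section

variable {y : E4} (hy : y ∈ s)
include hy

theorem pullback_eq (i : Fin 2) :
    pullback f (b i) y = ∑ j, changeMatrix g a' b f i j y • a j y :=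
  ((T.source.adapted y (T.subset hy)).exists_change (T.source.pke.signature y (T.subset hy))
    (T.adapted hy)).1 i

theorem pullback_eq' (i : Fin 2) :
    pullback f (b' i) y = ∑ j, changeMatrix g a b' f i j y • a' j y :=
  ((T.source.adapted y (T.subset hy)).exists_change (T.source.pke.signature y (T.subset hy))
    (T.adapted hy)).2.1 i

theorem sum_changeMatrix (i j : Fin 2) :
    ∑ k, changeMatrix g a b' f k i y * changeMatrix g a' b f k j y = if i = j then 1 else 0 :=
  ((T.source.adapted y (T.subset hy)).exists_change (T.source.pke.signature y (T.subset hy))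
    (T.adapted hy)).2.2 i j

theorem sum_changeMatrix' (i j : Fin 2) :
    ∑ k, changeMatrix g a' b f i k y * changeMatrix g a b' f j k y = if i = j then 1 else 0 :=
  sum_mul_comm_of_inverse (B := fun i j => changeMatrix g a' b f i j y)
    (C := fun i j => changeMatrix g a b' f j i y) (T.sum_changeMatrix hy) i j

theorem diffAt_changeMatrix (i j : Fin 2) : DifferentiableAt ℝ (changeMatrix g a' b f i j) y :=
  diffAt_of_contDiffOn (T.smooth_changeMatrix i j) T.isOpen hy

/-- Naturality of the connection form. -/
theorem pullback_conn (i j : Fin 2) : pullback f (conn g' b b' i j) y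
    = gauge (changeMatrix g a' b f) (fun i j => changeMatrix g a b' f j i) (conn g a a') i j y := by
  have hd := (T.adapted hy).isDualFrame (T.source.pke.signature y (T.subset hy))
  have hyt := T.mapsTo y hy
  have hys := T.subset hy
  rw [← sub_eq_zero]
  refine eq_zero_of_wedge (α := fun i => pullback f (b i) y) (α' := fun i => pullback f (b' i) y)
    (e := fun j => (g y).inverse (pullback f (b' j) y))
    (e' := fun j => (g y).inverse (pullback f (b j) y))
    (Δ := fun i j => pullback f (conn g' b b' i j) y - gauge (changeMatrix g a' b f)
      (fun i j => changeMatrix g a b' f j i) (conn g a a') i j y)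
    (fun i j => by simpa [nullFrame] using hd.pair (.inl i) (.inl j))
    (fun i j => by simpa [nullFrame] using hd.pair (.inl i) (.inr j))
    (fun i j => by simpa [nullFrame] using hd.pair (.inr i) (.inr j)) ?_ ?_ i j
  · intro i u v
    have e1 : d1 (pullback f (b i)) y u v
        = - ∑ j, wedge (pullback f (conn g' b b' i j) y) (pullback f (b j) y) u v := by
      have := d1_pullback T.isOpen hy T.smooth (T.target.diffAt_a hyt i) u v
      rw [T.target.d1_a hyt] at this
      exact this
    have e2 := d1_gauge (T.diffAt_changeMatrix hy) (fun i => T.source.diffAt_a hys i)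
      (T.sum_changeMatrix hy) (T.source.d1_a hys) i u v
    rw [← d1_congr_on T.isOpen hy (fun z hz => T.pullback_eq hz i), e1] at e2
    simp only [← T.pullback_eq hy] at e2
    have e3 := neg_injective e2
    rw [← sub_eq_zero, ← Finset.sum_sub_distrib] at e3
    rw [← e3]
    refine Finset.sum_congr rfl fun j _ => ?_
    simp only [wedge, sub_apply]
    ring
  · intro i u v
    have e1 : d1 (pullback f (b' i)) y u v
        = ∑ j, wedge (pullback f (conn g' b b' j i) y) (pullback f (b' j) y) u v := by
      have := d1_pullback T.isOpen hy T.smooth (T.target.diffAt_a' hyt i) u v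
      rw [T.target.d1_a' hyt] at this
      exact this
    have e2 := d1_gauge' (C := fun i j => changeMatrix g a b' f j i) (T.diffAt_changeMatrix hy)
      (fun i j => diffAt_of_contDiffOn (T.smooth_changeMatrix' j i) T.isOpen hy)
      (fun i => T.source.diffAt_a' hys i)
      (Filter.eventually_of_mem (T.isOpen.mem_nhds hy) fun z hz => T.sum_changeMatrix' hz)
      (T.sum_changeMatrix hy) (T.source.d1_a' hys) i u v
    rw [← d1_congr_on T.isOpen hy (fun z hz => T.pullback_eq' hz i), e1] at e2
    simp only [← T.pullback_eq' hy] at e2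
    rw [← sub_eq_zero, ← Finset.sum_sub_distrib] at e2
    rw [← e2]
    refine Finset.sum_congr rfl fun j _ => ?_
    simp only [wedge, sub_apply]
    ring

theorem coframeDet_ne_zero : coframeDet g a' b f y ≠ 0 :=
  (trace_gauge (γ := conn g a a') (T.diffAt_changeMatrix hy) (T.sum_changeMatrix hy) 0).1

theorem wedge_pullback (u v : E4) :
    wedge (pullback f (b 0) y) (pullback f (b 1) y) u v
      = coframeDet g a' b f y * wedge (a 0 y) (a 1 y) u v := by
  simp only [wedge, T.pullback_eq hy, coframeDet, detFun, Fin.sum_univ_two, add_apply, smul_apply,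
    smul_eq_mul]
  ring

/-- The trace of `pullback_conn`: under a change of coframe the trace connection changes by the
logarithmic derivative of the determinant. -/
theorem traceConn_map (u : E4) : traceConn g' b b' (f y) (fderiv ℝ f y u)
    = traceConn g a a' y u - fderiv ℝ (coframeDet g a' b f) y u / coframeDet g a' b f y := by
  have := (trace_gauge (γ := conn g a a') (T.diffAt_changeMatrix hy) (T.sum_changeMatrix hy) u).2
  simp only [← T.pullback_conn hy] at this
  rw [traceConn, traceConn, sum_apply, sum_apply]
  exact this

end

/-- The induced map of the leaf spaces. -/
theorem fderiv_leafMap {z : X5} (hz : z.1 ∈ s) (u : X5) :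
    fderiv ℝ (fun z : X5 => (f z.1, z.2 / coframeDet g a' b f z.1)) z u
      = (fderiv ℝ f z.1 u.1, u.2 / coframeDet g a' b f z.1
        - z.2 * fderiv ℝ (coframeDet g a' b f) z.1 u.1 / coframeDet g a' b f z.1 ^ 2) := by
  have h0 := T.coframeDet_ne_zero hz
  have hf := (diffAt_of_contDiffOn T.smooth T.isOpen hz).hasFDerivAt
  have hD := (diffAt_of_contDiffOn T.smooth_coframeDet T.isOpen hz).hasFDerivAt
  have h1 : HasFDerivAt (fun z : X5 => f z.1) _ z := hf.comp z hasFDerivAt_fst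
  have h2 : HasFDerivAt (fun z : X5 => coframeDet g a' b f z.1) _ z := hD.comp z hasFDerivAt_fst
  have h3 := (hasFDerivAt_snd (𝕜 := ℝ) (p := z)).fun_mul ((hasDerivAt_inv h0).comp_hasFDerivAt z h2)
  simp only [div_eq_mul_inv]
  have h4 : HasFDerivAt (fun z : X5 => (f z.1, z.2 * (coframeDet g a' b f z.1)⁻¹)) _ z :=
    h1.prodMk h3
  rw [h4.fderiv]
  ext1
  · simp
  · simp
    field_simp
    ring

variable (Ψ : ℝ) {z : X5} (hz : z.1 ∈ s) (hz2 : z.2 ≠ 0)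
include hz hz2

/-- The para-Sasaki structures on the leaf spaces correspond under the induced map. -/
theorem sasaki_agree (q : X5 → X5) (hq : q = fun z => (f z.1, z.2 / coframeDet g a' b f z.1)) :
    (∀ u, fderiv ℝ q z ((sasaki g K a a' Ψ).φ z u)
      = (sasaki g' K' b b' Ψ).φ (q z) (fderiv ℝ q z u)) ∧
    fderiv ℝ q z ((sasaki g K a a' Ψ).ξ z) = (sasaki g' K' b b' Ψ).ξ (q z) ∧
    (∀ u, (sasaki g K a a' Ψ).β z u = (sasaki g' K' b b' Ψ).β (q z) (fderiv ℝ q z u)) ∧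
    ∀ u v, (sasaki g K a a' Ψ).h z u v
      = (sasaki g' K' b b' Ψ).h (q z) (fderiv ℝ q z u) (fderiv ℝ q z v) := by
  subst hq
  have h0 := T.coframeDet_ne_zero hz
  -- With `t' = t / det B` one has `dt'/t' = dt/t - d(det B)/det B`, which matches the change of the
  -- trace connection. So `tr γ - dt/t`, and hence `β`, is preserved; since `h = g/(12Ψ) + β ⊗ β`,
  -- the metric is too.
  have hβ : ∀ u, (sasaki g K a a' Ψ).β z u = (sasaki g' K' b b' Ψ).β
      (f z.1, z.2 / coframeDet g a' b f z.1)
      (fderiv ℝ (fun z : X5 => (f z.1, z.2 / coframeDet g a' b f z.1)) z u) := fun u => by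
    rw [T.fderiv_leafMap hz, IsAdaptedOn.sasaki_β, IsAdaptedOn.sasaki_β]
    simp only [T.traceConn_map hz]
    congr 1
    field_simp
    ring
  refine ⟨fun u => ?_, ?_, hβ, fun u v => ?_⟩
  · rw [T.fderiv_leafMap hz, T.fderiv_leafMap hz, IsAdaptedOn.sasaki_φ, IsAdaptedOn.sasaki_φ]
    simp only [← T.endo _ hz, T.traceConn_map hz]
    ext1
    · rfl
    · field_simp
  · rw [T.fderiv_leafMap hz, IsAdaptedOn.ξ_eq, IsAdaptedOn.ξ_eq]
    simp
    field_simp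
  · rw [T.source.sasaki_h Ψ ⟨T.subset hz, hz2⟩, T.target.sasaki_h Ψ ⟨T.mapsTo _ hz,
      div_ne_zero hz2 h0⟩, ← hβ, ← hβ, T.metric _ hz, T.fderiv_leafMap hz, T.fderiv_leafMap hz]

end IsAdaptedMap

end ParaKE

namespace ParaKE

/-! ### Adapted charts on the manifold and their transition maps. -/

section Charts

variable {M : Type*} [TopologicalSpace M] [ChartedSpace E4 M]
  {g : ∀ p : M, TangentSpace (𝓡 4) p →L[ℝ] TangentSpace (𝓡 4) p →L[ℝ] ℝ}
  {K : ∀ p : M, TangentSpace (𝓡 4) p →L[ℝ] TangentSpace (𝓡 4) p}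

theorem exists_adaptedChart [IsManifold (𝓡 4) ∞ M] (hgK : IsParaKahlerEinstein g K) (p : M) :
    ∃ c : AdaptedChart g K, p ∈ c.e.source := by
  let e := chartAt E4 p
  have he : e ∈ IsManifold.maximalAtlas (𝓡 4) ∞ M := IsManifold.chart_mem_maximalAtlas p
  have hp : p ∈ e.source := mem_chart_source E4 p
  obtain ⟨O, hO, hpO, hOs, a, a', ha, ha', h⟩ :=
    (hgK e he).exists_adapted e.open_target (e.map_source hp)
  have hs : IsOpen (e.source ∩ e ⁻¹' O) := e.isOpen_inter_preimage hO
  have ht : (e.restr (e.source ∩ e ⁻¹' O)).target ⊆ O := by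
    intro y hy
    rw [e.restr_target, hs.interior_eq] at hy
    have := hy.2.2
    rwa [Set.mem_preimage, e.right_inv hy.1] at this
  refine ⟨⟨e.restr (e.source ∩ e ⁻¹' O), restr_mem_maximalAtlas _ he hs, a, a',
    fun i => (ha i).mono ht, fun i => (ha' i).mono ht, fun y hy => h y (ht hy)⟩, ?_⟩
  change p ∈ (e.restr (e.source ∩ e ⁻¹' O)).source
  rw [e.restr_source, hs.interior_eq]
  exact ⟨hp, hp, hpO⟩

namespace AdaptedChart

variable (c c' : AdaptedChart g K)

theorem isOpen_overlap : IsOpen (c.overlap c') := (c.e.symm.trans c'.e).open_source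

variable {c c'} in
theorem mem_overlap {y : E4} :
    y ∈ c.overlap c' ↔ y ∈ c.e.target ∧ c.e.symm y ∈ c'.e.source := by
  rw [overlap, OpenPartialHomeomorph.trans_source, OpenPartialHomeomorph.symm_source]
  rfl

theorem contDiffOn_trans : ContDiffOn ℝ ∞ (c.trans c') (c.overlap c') := by
  rw [← contMDiffOn_iff_contDiffOn]
  exact (contMDiffOn_of_mem_maximalAtlas c'.mem_atlas).comp
    ((contMDiffOn_symm_of_mem_maximalAtlas c.mem_atlas).mono fun y hy => (mem_overlap.1 hy).1)
    fun y hy => (mem_overlap.1 hy).2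

theorem mdifferentiableAt_symm {y : E4} (hy : y ∈ c.e.target) :
    MDifferentiableAt (𝓡 4) (𝓡 4) c.e.symm y :=
  ((contMDiffOn_symm_of_mem_maximalAtlas c.mem_atlas).contMDiffAt
    (c.e.open_target.mem_nhds hy)).mdifferentiableAt (by simp)

theorem mdifferentiableAt_chart {p : M} (hp : p ∈ c.e.source) :
    MDifferentiableAt (𝓡 4) (𝓡 4) c.e p :=
  ((contMDiffOn_of_mem_maximalAtlas c.mem_atlas).contMDiffAt
    (c.e.open_source.mem_nhds hp)).mdifferentiableAt (by simp)

variable {c c'} {y : E4} (hy : y ∈ c.overlap c')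
include hy

theorem trans_mem : c.trans c' y ∈ c'.e.target := c'.e.map_source (mem_overlap.1 hy).2

theorem symm_trans : c'.e.symm (c.trans c' y) = c.e.symm y := c'.e.left_inv (mem_overlap.1 hy).2

theorem mdifferentiableAt_trans : MDifferentiableAt (𝓡 4) (𝓡 4) (c.trans c') y :=
  (diffAt_of_contDiffOn (c.contDiffOn_trans c') (c.isOpen_overlap c') hy).mdifferentiableAt

theorem chartInvDeriv_trans :
    (chartInvDeriv c'.e (c.trans c' y)).comp (fderiv ℝ (c.trans c') y) = chartInvDeriv c.e y := by
  have h1 := mfderiv_comp y (c'.mdifferentiableAt_symm (trans_mem hy)) (mdifferentiableAt_trans hy)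
  have h2 : c'.e.symm ∘ c.trans c' =ᶠ[nhds y] c.e.symm :=
    Filter.eventually_of_mem ((c.isOpen_overlap c').mem_nhds hy) fun z hz => symm_trans hz
  have h3 := h2.mfderiv_eq (I := 𝓡 4) (I' := 𝓡 4)
  rw [mfderiv_eq_fderiv] at h1
  exact h1.symm.trans h3

theorem chartDeriv_trans : (fderiv ℝ (c.trans c') y).comp (chartDeriv c.e y)
    = chartDeriv c'.e (c.trans c' y) := by
  have hy1 := (mem_overlap.1 hy).1
  have hs : c.e.symm y ∈ c.e.source := c.e.map_target hy1
  have e0 : c.e (c.e.symm y) = y := c.e.right_inv hy1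
  have h0 : MDifferentiableAt (𝓡 4) (𝓡 4) (c.trans c') (c.e (c.e.symm y)) := by
    rw [e0]; exact mdifferentiableAt_trans hy
  have h1 := mfderiv_comp (c.e.symm y) h0 (c.mdifferentiableAt_chart hs)
  have h2 : c.trans c' ∘ c.e =ᶠ[nhds (c.e.symm y)] c'.e :=
    Filter.eventually_of_mem (c.e.open_source.mem_nhds hs) fun p hp =>
      congrArg c'.e (c.e.left_inv hp)
  have h3 := h2.mfderiv_eq (I := 𝓡 4) (I' := 𝓡 4)
  rw [mfderiv_eq_fderiv] at h1
  have h4 := h1.symm.trans h3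
  rw [chartDeriv, chartDeriv, symm_trans hy]
  rw [e0] at h4
  exact h4

theorem chartMetric_trans (u v : E4) : chartMetric g c.e y u v = chartMetric g c'.e (c.trans c' y)
    (fderiv ℝ (c.trans c') y u) (fderiv ℝ (c.trans c') y v) := by
  have e1 := fun w => congrArg (fun L : E4 →L[ℝ] E4 => L w) (chartInvDeriv_trans hy)
  simp only [ContinuousLinearMap.comp_apply] at e1
  -- Every tangent space is the model space by definition. Viewing `g` as a non-dependent function
  -- allows the base point to be rewritten along `symm_trans`.
  let G : M → E4 →L[ℝ] E4 →L[ℝ] ℝ := fun p => g p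
  change G (c.e.symm y) (chartInvDeriv c.e y u) (chartInvDeriv c.e y v)
    = G (c'.e.symm (c.trans c' y)) (chartInvDeriv c'.e (c.trans c' y) (fderiv ℝ (c.trans c') y u))
      (chartInvDeriv c'.e (c.trans c' y) (fderiv ℝ (c.trans c') y v))
  rw [e1, e1, symm_trans hy]

theorem chartEndo_trans (u : E4) : fderiv ℝ (c.trans c') y (chartEndo K c.e y u)
    = chartEndo K c'.e (c.trans c' y) (fderiv ℝ (c.trans c') y u) := by
  have e1 := fun w => congrArg (fun L : E4 →L[ℝ] E4 => L w) (chartInvDeriv_trans hy)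
  have e2 := fun w => congrArg (fun L : E4 →L[ℝ] E4 => L w) (chartDeriv_trans hy)
  simp only [ContinuousLinearMap.comp_apply] at e1 e2
  let k : M → E4 →L[ℝ] E4 := fun p => K p
  change fderiv ℝ (c.trans c') y (chartDeriv c.e y (k (c.e.symm y) (chartInvDeriv c.e y u)))
    = chartDeriv c'.e (c.trans c' y) (k (c'.e.symm (c.trans c' y))
      (chartInvDeriv c'.e (c.trans c' y) (fderiv ℝ (c.trans c') y u)))
  rw [e1, e2, symm_trans hy]

omit hy

theorem isAdaptedMap (hgK : IsParaKahlerEinstein g K) (c c' : AdaptedChart g K) :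
    IsAdaptedMap c.e.target (c.overlap c') c'.e.target (chartMetric g c.e) (chartMetric g c'.e)
      (chartEndo K c.e) (chartEndo K c'.e) c.a c.a' c'.a c'.a' (c.trans c') where
  isOpen := c.isOpen_overlap c'
  subset := fun _ hy => (mem_overlap.1 hy).1
  source := c.isAdaptedOn hgK
  target := c'.isAdaptedOn hgK
  smooth := c.contDiffOn_trans c'
  mapsTo := fun _ hy => trans_mem hy
  metric := fun _ hy => chartMetric_trans hy
  endo := fun _ hy => chartEndo_trans hy

end AdaptedChart

end Charts

end ParaKE

end

theorem mainTheorem12 {M : Type*} [TopologicalSpace M] [ChartedSpace E4 M]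
    [IsManifold (𝓡 4) ∞ M]
    (g : ∀ p : M, TangentSpace (𝓡 4) p →L[ℝ] TangentSpace (𝓡 4) p →L[ℝ] ℝ)
    (K : ∀ p : M, TangentSpace (𝓡 4) p →L[ℝ] TangentSpace (𝓡 4) p)
    (hgK : IsParaKahlerEinstein g K)
    (Ψ : ℝ) (hΨ0 : Ψ ≠ 0) (hΨ : HasConstantPsi2' g K Ψ) :
    -- adapted charts cover `M`, and over each of them the points of `c.F` are the adapted coframes
    (∀ p : M, ∃ c : AdaptedChart g K, p ∈ c.e.source) ∧
    (∀ c : AdaptedChart g K, ∀ y ∈ c.e.target, ∀ a a' : Fin 2 → E4 →L[ℝ] ℝ,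
      IsAdaptedCoframe (chartMetric g c.e y) (chartEndo K c.e y) a a' ↔
        ∃! A : Fin 2 → Fin 2 → ℝ, (y, A) ∈ c.F ∧ a = c.cofr (y, A) ∧ a' = c.cofr' (y, A)) ∧
    ∃ (Γ : AdaptedChart g K → Fin 2 → Fin 2 → X8 → X8 →L[ℝ] ℝ)
      (S : AdaptedChart g K → ContactData X5),
      (∀ c : AdaptedChart g K,
        -- the connection forms
        c.IsConnection (Γ c) ∧
        (∀ Γ', c.IsConnection Γ' → ∀ i j, Set.EqOn (Γ' i j) (Γ c i j) c.F) ∧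
        -- the leaf space, which is also the quotient by `SL₂(ℝ)`
        IsIntegrablePfaffianOn (c.pfaffian (Γ c)) c.F ∧
        IsLeafProjection (c.pfaffian (Γ c)) c.F c.Q AdaptedChart.proj ∧
        (∀ x ∈ c.F, ∀ x' ∈ c.F, AdaptedChart.proj x = AdaptedChart.proj x' ↔
          x.1 = x'.1 ∧ ∃ B : Matrix (Fin 2) (Fin 2) ℝ, B.det = 1 ∧
            Matrix.of x'.2 = B * Matrix.of x.2) ∧
        -- the explicit structure, its Einstein constant and its normalization
        c.IsExplicit Ψ (Γ c) (S c) ∧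
        IsScaledParaSasakiEinsteinOn (2 * √6 * Ψ) (-24 * Ψ ^ 2) c.Q (S c) ∧
        IsParaSasakiEinsteinOn (-1) c.Q ((S c).rescale (2 * √6 * Ψ))) ∧
      -- the local expressions define global tensor fields on the leaf space
      (∀ c c' : AdaptedChart g K, ∃ b : E4 → ℝ, c.IsCoframeDet c' b ∧
        c.Agree c' b (S c) (S c')) := by
  refine ⟨exists_adaptedChart hgK, fun c y hy a a' => c.coframe_iff hgK hy a a',
    fun c => c.conn, fun c => c.sasaki Ψ, fun c => ?_, fun c c' => ?_⟩
  · exact ⟨c.isConnection hgK, fun Γ' hΓ' i j => c.connection_unique hgK hΓ' i j,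
      c.isIntegrablePfaffianOn hgK hΨ, c.isLeafProjection hgK,
      fun x hx x' hx' => c.proj_eq_iff hx, c.isExplicit hgK hΨ0,
      (c.isAdaptedOn hgK).isScaledParaSasakiEinsteinOn hΨ0 (c.scal_eq hgK hΨ),
      (c.isAdaptedOn hgK).isParaSasakiEinsteinOn hΨ0 (c.scal_eq hgK hΨ)⟩
  · have T := AdaptedChart.isAdaptedMap hgK c c'
    -- The same coframe has matrices with `A' B = A` in the two trivializations, so the gluing
    -- function is the determinant of the change matrix `B`.
    exact ⟨coframeDet (chartMetric g c.e) c.a' c'.a (c.trans c'),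
      ⟨T.smooth_coframeDet, fun y hy => ⟨T.coframeDet_ne_zero hy, T.wedge_pullback hy⟩⟩,
      fun z hz hz2 => T.sasaki_agree Ψ hz hz2 _ rfl⟩
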